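/- Let $n\ge 1$ and write $B_R=\{x\in\mathbb R^n:|x|\le R\}$. For $A=(a_{jk}):\mathbb R^n\to\mathbb R^{n\times n}$ put $|\nabla A|=\big(\sum_{l,j,k}|\partial_l a_{jk}|^2\big)^{1/2}$, $|\nabla^\alpha A|=\big(\sum_{j,k}|\partial^\alpha a_{jk}|^2\big)^{1/2}$ and $\|A\|_{C^3}=\sum_{i=1}^{3}\sup_{x\in\mathbb R^n,\,|\alpha|=i}|\nabla^\alpha A(x)|$. There is a positive number $\varepsilon_0=\varepsilon_0(n,\lambda,\Lambda)$ such that the following holds. Let $\lambda,\Lambda>0$ and let $A\in C^3(\mathbb R^n)$ be real symmetric with $\|A\|_{C^3}<\infty$, $$\lambda|\xi|^2\le\sum_{j,k=1}^n a_{jk}(x)\xi_j\xi_k\le\Lambda|\xi|^2\quad (x,\xi\in\mathbb R^n),\qquad \sup_{x\in\mathbb R^n}|x||\nabla A(x)|<\varepsilon_0 .$$ Let $V\in L^\infty(\mathbb R\times\mathbb R^n,\mathbb C)$, $M_1=\|V\|_{L^\infty}$, and let $u\in L^\infty([0,1],L^2(\mathbb R^n))\cap L^2_{loc}((0,1),H^1(\mathbb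 R^n))$ be complex valued and satisfy $$\partial_t u=i\Big(\sum_{j,k=1}^n\partial_k(a_{kj}(x)\partial_j u)+V u\Big)$$ in the sense of distributions on $(0,1)\times\mathbb R^n$. Let $E_1,R_0$ be real numbers and $E_2,\varepsilon>0$ such that $$\int_{1/8}^{7/8}\int_{\mathbb R^n}(|u|^2+|\nabla u|^2)\,dx\,dt\le E_1^2,\qquad \int_{1/4}^{3/4}\int_{B_{R_0}\setminus B_{2\varepsilon}}|u|^2\,dx\,dt\ge E_2^2 .$$ Then there are positive constants $C_0=C_0(\lambda,\varepsilon)$ and $R_1$, $C$, both depending only on $n,\lambda,\Lambda,\varepsilon,E_1,E_2,R_0$ and on upper bounds for $\|A\|_{C^3}$ and $M_1$, such that for every $R>R_1$ $$\int_{1/8}^{7/8}\int_{B_R\setminus B_{R-1}}(|u|^2+|\nabla u|^2)\,dx\,dt\ge C\,e^{-C_0R^3}.$$ -/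

import Mathlib

open MeasureTheory Set
open scoped ContDiff

namespace VarSchrodinger

/-- The space `ℝⁿ` with its Euclidean norm. -/
abbrev Rn (n : ℕ) := EuclideanSpace ℝ (Fin n)

/-- Standard basis vector of `ℝⁿ`. -/
noncomputable def stdVec {n : ℕ} (k : Fin n) : Rn n := EuclideanSpace.single k (1 : ℝ)

/-- `A(x)` is symmetric and `lam |ξ|² ≤ ∑ a_{jk}(x) ξ_j ξ_k ≤ Lam |ξ|²` for all `x, ξ`. -/
def IsSymmElliptic {n : ℕ} (lam Lam : ℝ) (A : Rn n → Matrix (Fin n) (Fin n) ℝ) : Prop :=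
  ∀ x : Rn n, (A x).IsSymm ∧ ∀ ξ : Rn n,
    lam * ‖ξ‖ ^ 2 ≤ ∑ j, ∑ k, A x j k * ξ j * ξ k ∧
    ∑ j, ∑ k, A x j k * ξ j * ξ k ≤ Lam * ‖ξ‖ ^ 2

/-- `|∇^α A|(x)` for the derivative `∂^α = ∂_{J 0} ⋯ ∂_{J (i-1)}` of order `i`,
that is `(∑_{j,k} |∂^α a_{jk}(x)|²)^{1/2}`. Every multi-index `α` of length `i` is of this form. -/
noncomputable def derivNorm {n i : ℕ} (A : Rn n → Matrix (Fin n) (Fin n) ℝ)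
    (J : Fin i → Fin n) (x : Rn n) : ℝ :=
  Real.sqrt (∑ j, ∑ k,
    (iteratedFDeriv ℝ i (fun y => A y j k) x (fun m => stdVec (J m))) ^ 2)

/-- `‖A‖_{C³} = ∑_{i=1}^{3} sup_{x, |α| = i} |∇^α A|(x)`, as an extended real. -/
noncomputable def normC3 {n : ℕ} (A : Rn n → Matrix (Fin n) (Fin n) ℝ) : ENNReal :=
  ∑ i ∈ Finset.Icc 1 3, ⨆ (x : Rn n) (J : Fin i → Fin n), ENNReal.ofReal (derivNorm A J x)

/-- `|∇A|(x) = (∑_{l,j,k} |∂_l a_{jk}(x)|²)^{1/2}`. -/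
noncomputable def gradNorm {n : ℕ} (A : Rn n → Matrix (Fin n) (Fin n) ℝ) (x : Rn n) : ℝ :=
  Real.sqrt (∑ l, ∑ j, ∑ k, (fderiv ℝ (fun y => A y j k) x (stdVec l)) ^ 2)

/-- `g` is the weak gradient of `f` on `ℝⁿ`. -/
def HasWeakGradient {n : ℕ} (f : Rn n → ℂ) (g : Rn n → EuclideanSpace ℂ (Fin n)) : Prop :=
  LocallyIntegrable f volume ∧ LocallyIntegrable g volume ∧
    ∀ (j : Fin n) (χ : Rn n → ℂ), ContDiff ℝ ∞ χ → HasCompactSupport χ →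
      ∫ x, f x * fderiv ℝ χ x (stdVec j) = - ∫ x, g x j * χ x

/-- `u ∈ L^∞([0,1], L²(ℝⁿ))`, for a jointly measurable representative `u(t,x)`. -/
def MemLinftyL2 {n : ℕ} (u : ℝ → Rn n → ℂ) : Prop :=
  AEStronglyMeasurable (fun z : ℝ × Rn n => u z.1 z.2)
    ((volume.restrict (Icc (0 : ℝ) 1)).prod volume) ∧
  ∃ M : ℝ, ∀ᵐ t ∂(volume.restrict (Icc (0 : ℝ) 1)),
    eLpNorm (u t) 2 volume ≤ ENNReal.ofReal M

/-- `u ∈ L²_loc((0,1), H¹(ℝⁿ))`, where `Du(t,x)` is a jointly measurable representative of the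
weak spatial gradient of `u`. -/
def MemL2locH1 {n : ℕ} (u : ℝ → Rn n → ℂ) (Du : ℝ → Rn n → EuclideanSpace ℂ (Fin n)) : Prop :=
  AEStronglyMeasurable (fun z : ℝ × Rn n => u z.1 z.2)
    ((volume.restrict (Ioo (0 : ℝ) 1)).prod volume) ∧
  AEStronglyMeasurable (fun z : ℝ × Rn n => Du z.1 z.2)
    ((volume.restrict (Ioo (0 : ℝ) 1)).prod volume) ∧
  (∀ᵐ t ∂(volume.restrict (Ioo (0 : ℝ) 1)), HasWeakGradient (u t) (Du t)) ∧
  ∀ a b : ℝ, 0 < a → b < 1 →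
    ∫⁻ t in Icc a b, ∫⁻ x, (‖u t x‖ₑ ^ 2 + ‖Du t x‖ₑ ^ 2) < ⊤

/-- `∂_t u = i (∑ ∂_k (a_{kj} ∂_j u) + V u)` in the sense of distributions on `(0,1) × ℝⁿ`,
where `Du` is the weak spatial gradient of `u`. -/
def IsWeakSolution {n : ℕ} (A : Rn n → Matrix (Fin n) (Fin n) ℝ) (V : ℝ × Rn n → ℂ)
    (u : ℝ → Rn n → ℂ) (Du : ℝ → Rn n → EuclideanSpace ℂ (Fin n)) : Prop :=
  ∀ χ : ℝ × Rn n → ℂ, ContDiff ℝ ∞ χ → HasCompactSupport χ →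
    tsupport χ ⊆ Ioo (0 : ℝ) 1 ×ˢ (univ : Set (Rn n)) →
    - ∫ z in Ioo (0 : ℝ) 1 ×ˢ (univ : Set (Rn n)), u z.1 z.2 * fderiv ℝ χ z (1, 0) =
      Complex.I * ∫ z in Ioo (0 : ℝ) 1 ×ˢ (univ : Set (Rn n)),
        (- (∑ k, ∑ j, (A z.2 k j : ℂ) * Du z.1 z.2 j * fderiv ℝ χ z (0, stdVec k))
          + V z * u z.1 z.2 * χ z)

/-- The ball `B_R = {|x| ≤ R}` centered at the origin. -/
def ball0 (n : ℕ) (R : ℝ) : Set (Rn n) := Metric.closedBall 0 R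

/-- `∫_a^b ∫_S (|u|² + |∇u|²) dx dt`. -/
noncomputable def energy {n : ℕ} (u : ℝ → Rn n → ℂ) (Du : ℝ → Rn n → EuclideanSpace ℂ (Fin n))
    (a b : ℝ) (S : Set (Rn n)) : ENNReal :=
  ∫⁻ t in Icc a b, ∫⁻ x in S, (‖u t x‖ₑ ^ 2 + ‖Du t x‖ₑ ^ 2)

/-- `∫_a^b ∫_S |u|² dx dt`. -/
noncomputable def mass {n : ℕ} (u : ℝ → Rn n → ℂ) (a b : ℝ) (S : Set (Rn n)) : ENNReal :=
  ∫⁻ t in Icc a b, ∫⁻ x in S, ‖u t x‖ₑ ^ 2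

end VarSchrodinger

/-!
Lower bound for solutions of `∂_t u = i (div(A∇u) + V u)`. Mass at a fixed distance from the origin
forces energy in every shell `R - 1 < |x| ≤ R`, with a loss of `e^{-C₀R³}`.

The bound comes from a Carleman inequality with the weight `e^φ`, `φ = cR|x|² + cR³ b(t)`. After
conjugation by `e^φ` the operator is a symmetric part plus a skew-symmetric part, so its square norm
is at least the integral of their commutator. The Rellich-Pohozaev identity `nullInt_rellich`
expresses that integral by a pointwise density (`nullInt_commutator`). Every term of the density
with a first derivative of `A` carries the factor `|x||∇A|`. If this is small, the quadratic form in
the gradient is nonnegative, and the zero order term contains `16 (cR)³ lam² |x|²`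
(`commDensity_lower`). For `ε ≤ |x| ≤ R` and `c = (sup |b''| + 1)/(lam ε)` that term is of order `R³`
and dominates both `cR³ |b''|` and the term with second and third derivatives of `A`, which is of
order `R|x|` and is negligible for large `R` (`carleman_shell`).

The inequality is applied to `ζu` with a cutoff `ζ`. A weak solution has only one space derivative,
so `u` is mollified in space-time. By Friedrichs' lemma (`IsMollifier.tendsto_friedrichs`) the
commutators of mollification with the coefficients tend to zero in `L²`, and in the limit
(`carleman_limit`) the right-hand side contains only `ζ V u` and terms with `u`, `∇u` on the support
of the derivatives of `ζ`.

Let `b = 2` for `t` in `[1/4, 3/4]` and `b = 0` where `ζ` varies in time. Then `φ` on the set of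
assumed mass is at least its maximum over the inner shell and over the times where `ζ` varies, while
`φ ≤ 3cR³` on the outer shell. The gain `cR³` on the left absorbs `V` and the energy terms with the
smaller weight as soon as `R` is large (`mass_le_energy`). What remains compares the weight `e^{4cR³}`
of the mass with the weight `e^{6cR³}` of the energy in the outer shell, so that `C₀ = 2c`, which
depends on `lam` and `ε` only (`le_of_mass_le_energy`).

Complex functions are handled as pairs of real functions, their real and imaginary parts.
-/

namespace VarSchrodinger

/-! ### Directional derivatives -/

section DirectionalDerivatives

variable {E : Type*} [NormedAddCommGroup E] [NormedSpace ℝ E]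

/-- The derivative of a real function `f` in the constant direction `v`. -/
noncomputable def dd (v : E) (f : E → ℝ) : E → ℝ := fun z => fderiv ℝ f z v

lemma dd_add {f g : E → ℝ} (v : E) (hf : Differentiable ℝ f) (hg : Differentiable ℝ g) (z : E) :
    dd v (fun y => f y + g y) z = dd v f z + dd v g z := by
  simp [dd, fderiv_fun_add (hf z) (hg z)]

lemma dd_mul {f g : E → ℝ} (v : E) (hf : Differentiable ℝ f) (hg : Differentiable ℝ g) (z : E) :
    dd v (fun y => f y * g y) z = dd v f z * g z + f z * dd v g z := by
  simp [dd, fderiv_fun_mul (hf z) (hg z)]; ring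

lemma dd_const_mul {f : E → ℝ} (v : E) (c : ℝ) (hf : Differentiable ℝ f) (z : E) :
    dd v (fun y => c * f y) z = c * dd v f z := by
  simp [dd, fderiv_const_mul (hf z)]

@[simp] lemma dd_const (v : E) (c : ℝ) (z : E) : dd v (fun _ => c) z = 0 := by
  simp [dd]

lemma dd_sum {ι : Type*} {s : Finset ι} {f : ι → E → ℝ} (v : E)
    (hf : ∀ i, Differentiable ℝ (f i)) (z : E) :
    dd v (fun y => ∑ i ∈ s, f i y) z = ∑ i ∈ s, dd v (f i) z := by
  simp [dd, fderiv_fun_sum (fun i _ => hf i z)]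

lemma dd_comp {f : E → ℝ} (v : E) {h : ℝ → ℝ} (hh : Differentiable ℝ h)
    (hf : Differentiable ℝ f) (z : E) :
    dd v (fun y => h (f y)) z = deriv h (f z) * dd v f z := by
  have := ((hh (f z)).hasDerivAt.comp_hasFDerivAt z (hf z).hasFDerivAt).fderiv
  simp only [dd]
  change fderiv ℝ (h ∘ f) z v = _
  simp [this]

lemma contDiff_dd {f : E → ℝ} {m k : ℕ∞ω} (hf : ContDiff ℝ k f) (h : m + 1 ≤ k) (v : E) :
    ContDiff ℝ m (dd v f) :=
  (hf.fderiv_right h).clm_apply contDiff_const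

lemma dd_comm {f : E → ℝ} (hf : ContDiff ℝ 2 f) (v w : E) (z : E) :
    dd v (dd w f) z = dd w (dd v f) z := by
  have hd : Differentiable ℝ (fderiv ℝ f) :=
    (hf.fderiv_right (m := 1) (by norm_num)).differentiable (by norm_num)
  have key : ∀ a b : E, dd a (dd b f) z = fderiv ℝ (fderiv ℝ f) z a b := by
    intro a b
    change fderiv ℝ (fun y => fderiv ℝ f y b) z a = _
    rw [fderiv_clm_apply (hd z) (differentiableAt_const b)]
    simp
  rw [key, key]
  exact (hf.contDiffAt.isSymmSndFDerivAt (by simp)).eq v w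

lemma dd_eq_zero_of_notMem {f : E → ℝ} {K : Set E} (hK : IsClosed K)
    (hf : ∀ z ∉ K, f z = 0) (v : E) : ∀ z ∉ K, dd v f z = 0 := by
  intro z hz
  have : f =ᶠ[nhds z] fun _ => 0 := by
    filter_upwards [hK.isOpen_compl.mem_nhds hz] with y hy using hf y hy
  simp [dd, this.fderiv_eq]

end DirectionalDerivatives

/-! ### Functions with vanishing integral -/

section NullIntegrals

variable {α : Type*} [MeasurableSpace α] {μ : Measure α}

/-- `F` is integrable with vanishing integral. Integration by parts is carried out modulo such
functions. -/
def NullInt (μ : Measure α) (F : α → ℝ) : Prop := Integrable F μ ∧ ∫ z, F z ∂μ = 0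

lemma NullInt.add {F G : α → ℝ} (hF : NullInt μ F) (hG : NullInt μ G) :
    NullInt μ (fun z => F z + G z) :=
  ⟨hF.1.add hG.1, by rw [integral_add hF.1 hG.1, hF.2, hG.2, add_zero]⟩

lemma NullInt.const_mul {F : α → ℝ} (hF : NullInt μ F) (c : ℝ) :
    NullInt μ (fun z => c * F z) :=
  ⟨hF.1.const_mul c, by rw [integral_const_mul, hF.2, mul_zero]⟩

lemma NullInt.sub {F G : α → ℝ} (hF : NullInt μ F) (hG : NullInt μ G) :
    NullInt μ (fun z => F z - G z) :=
  ⟨hF.1.sub hG.1, by rw [integral_sub hF.1 hG.1, hF.2, hG.2, sub_zero]⟩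

lemma NullInt.sum {ι : Type*} {s : Finset ι} {F : ι → α → ℝ} (hF : ∀ i, NullInt μ (F i)) :
    NullInt μ (fun z => ∑ i ∈ s, F i z) :=
  ⟨integrable_finsetSum s fun i _ => (hF i).1, by
    rw [integral_finsetSum s fun i _ => (hF i).1]; simp [(hF _).2]⟩

end NullIntegrals

section Integrals

variable {E : Type*} [NormedAddCommGroup E] [MeasurableSpace E] [BorelSpace E] {μ : Measure E}

lemma integrable_of_continuous_of_notMem [IsFiniteMeasureOnCompacts μ] {F : E → ℝ} {K : Set E}
    (hF : Continuous F) (hK : IsCompact K) (h0 : ∀ z ∉ K, F z = 0) : Integrable F μ :=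
  hF.integrable_of_hasCompactSupport (HasCompactSupport.intro hK h0)

lemma nullInt_dd [NormedSpace ℝ E] [FiniteDimensional ℝ E] [μ.IsAddHaarMeasure] {F : E → ℝ} {K : Set E}
    (hF : ContDiff ℝ 1 F) (hK : IsCompact K) (h0 : ∀ z ∉ K, F z = 0) (v : E) :
    NullInt μ (dd v F) := by
  have hi : Integrable (dd v F) μ := integrable_of_continuous_of_notMem
    (contDiff_dd (m := 0) hF (by norm_num) v).continuous hK
    (dd_eq_zero_of_notMem hK.isClosed h0 v)
  have hiF : Integrable F μ := integrable_of_continuous_of_notMem hF.continuous hK h0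
  refine ⟨hi, ?_⟩
  have := integral_mul_fderiv_eq_neg_fderiv_mul_of_integrable (μ := μ) (f := fun _ : E => (1 : ℝ))
    (g := F) (v := v) (by simp)
    (by simp only [one_mul]; exact hi) (by simpa using hiF)
    (fun x _ => differentiableAt_const _) (fun x _ => (hF.differentiable (by norm_num)) x)
  simpa [dd] using this

end Integrals

/-! ### Divergence form operators -/

section Operators

variable {E : Type*} [NormedAddCommGroup E] [NormedSpace ℝ E] {n : ℕ}

/-- The bilinear form `∑ a_{kj} ∂_j f ∂_k h`, for derivatives in the directions `e`. -/
noncomputable def bil (e : Fin n → E) (a : Fin n → Fin n → E → ℝ) (f h : E → ℝ) (z : E) : ℝ :=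
  ∑ k, ∑ j, a k j z * dd (e j) f z * dd (e k) h z

/-- The divergence form operator `∑ ∂_k (a_{kj} ∂_j f)`, for derivatives in the directions `e`. -/
noncomputable def divA (e : Fin n → E) (a : Fin n → Fin n → E → ℝ) (f : E → ℝ) (z : E) : ℝ :=
  ∑ k, dd (e k) (fun y => ∑ j, a k j y * dd (e j) f y) z

/-- The divergence `∑ ∂_l X_l` in the directions `e`. -/
noncomputable def dvg (e : Fin n → E) (X : Fin n → E → ℝ) (z : E) : ℝ :=
  ∑ l, dd (e l) (X l) z

/-- The skew-adjoint first order operator `2 X · ∇ f + (div X) f`. -/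
noncomputable def skewOp (e : Fin n → E) (X : Fin n → E → ℝ) (f : E → ℝ) (z : E) : ℝ :=
  2 * ∑ l, X l z * dd (e l) f z + dvg e X z * f z

lemma contDiff_dvg {e : Fin n → E} {X : Fin n → E → ℝ} {m k : ℕ∞ω}
    (hX : ∀ l, ContDiff ℝ k (X l)) (h : m + 1 ≤ k) : ContDiff ℝ m (dvg e X) :=
  ContDiff.sum fun l _ => contDiff_dd (hX l) h (e l)

lemma contDiff_flux {e : Fin n → E} {a : Fin n → Fin n → E → ℝ} {f : E → ℝ} {m k : ℕ∞ω}
    (ha : ∀ k j, ContDiff ℝ m (a k j)) (hf : ContDiff ℝ k f) (h : m + 1 ≤ k) (i : Fin n) :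
    ContDiff ℝ m (fun y => ∑ j, a i j y * dd (e j) f y) :=
  ContDiff.sum fun j _ => (ha i j).mul (contDiff_dd hf h (e j))

lemma contDiff_divA {e : Fin n → E} {a : Fin n → Fin n → E → ℝ} {f : E → ℝ} {m r l : ℕ∞ω}
    (ha : ∀ k j, ContDiff ℝ r (a k j)) (hf : ContDiff ℝ l f) (h : m + 1 ≤ r) (h' : r + 1 ≤ l) :
    ContDiff ℝ m (divA e a f) :=
  ContDiff.sum fun i _ => contDiff_dd (contDiff_flux ha hf h' i) h (e i)

lemma contDiff_skewOp {e : Fin n → E} {X : Fin n → E → ℝ} {f : E → ℝ} {m k l : ℕ∞ω}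
    (hX : ∀ l, ContDiff ℝ k (X l)) (hf : ContDiff ℝ l f) (h : m + 1 ≤ k) (h' : m + 1 ≤ l) :
    ContDiff ℝ m (skewOp e X f) :=
  (contDiff_const.mul (ContDiff.sum fun i _ => ((hX i).of_le (le_self_add.trans h)).mul
    (contDiff_dd hf h' (e i)))).add
    ((contDiff_dvg hX h).mul (hf.of_le (le_self_add.trans h')))

lemma bil_comm {e : Fin n → E} {a : Fin n → Fin n → E → ℝ} (hs : ∀ k j z, a k j z = a j k z)
    (f h : E → ℝ) (z : E) : bil e a f h z = bil e a h f z := by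
  unfold bil
  rw [Finset.sum_comm]
  refine Finset.sum_congr rfl fun j _ => Finset.sum_congr rfl fun k _ => ?_
  rw [hs k j]; ring

end Operators

/-! ### Integration by parts -/

section IntegrationByParts

variable {E : Type*} [NormedAddCommGroup E] [NormedSpace ℝ E] [MeasurableSpace E] [BorelSpace E]
  [FiniteDimensional ℝ E] {μ : Measure E} [μ.IsAddHaarMeasure] {n : ℕ} {e : Fin n → E}
  {a : Fin n → Fin n → E → ℝ} {X : Fin n → E → ℝ} {K : Set E}

lemma nullInt_green (ha : ∀ k j, ContDiff ℝ 1 (a k j)) {f h : E → ℝ} (hf : ContDiff ℝ 2 f)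
    (hh : ContDiff ℝ 1 h) (hK : IsCompact K)
    (hf0 : ∀ z ∉ K, h z = 0 ∨ ∀ v, dd v f z = 0) :
    NullInt μ (fun z => divA e a f z * h z + bil e a f h z) := by
  have hfl : ∀ k, ContDiff ℝ 1 (fun y => ∑ j, a k j y * dd (e j) f y) :=
    contDiff_flux ha hf (by norm_num)
  have key : ∀ k, NullInt μ (dd (e k) (fun y => (∑ j, a k j y * dd (e j) f y) * h y)) := by
    intro k
    refine nullInt_dd ((hfl k).mul hh) hK (fun z hz => ?_) _
    rcases hf0 z hz with h1 | h1 <;> simp [h1]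
  have hs := NullInt.sum (s := Finset.univ) key
  convert hs using 2 with z
  rw [divA, bil, Finset.sum_mul, ← Finset.sum_add_distrib]
  refine Finset.sum_congr rfl fun k _ => ?_
  rw [dd_mul _ ((hfl k).differentiable (by norm_num)) (hh.differentiable (by norm_num)),
    Finset.sum_mul]

lemma nullInt_transport (hX : ∀ l, ContDiff ℝ 1 (X l)) {F : E → ℝ} (hF : ContDiff ℝ 1 F)
    (hK : IsCompact K) (h0 : ∀ z ∉ K, F z = 0) :
    NullInt μ (fun z => ∑ l, X l z * dd (e l) F z + dvg e X z * F z) := by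
  have key : ∀ l, NullInt μ (dd (e l) (fun y => X l y * F y)) := fun l =>
    nullInt_dd ((hX l).mul hF) hK (fun z hz => by simp [h0 z hz]) _
  have hs := NullInt.sum (s := Finset.univ) key
  convert hs using 2 with z
  rw [dvg, Finset.sum_mul, ← Finset.sum_add_distrib]
  refine Finset.sum_congr rfl fun l _ => ?_
  rw [dd_mul _ ((hX l).differentiable (by norm_num)) (hF.differentiable (by norm_num))]
  ring

lemma nullInt_skewOp (hX : ∀ l, ContDiff ℝ 1 (X l)) {f h : E → ℝ} (hf : ContDiff ℝ 1 f)
    (hh : ContDiff ℝ 1 h) (hK : IsCompact K) (h0 : ∀ z ∉ K, f z = 0) :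
    NullInt μ (fun z => h z * skewOp e X f z + f z * skewOp e X h z) := by
  have := (nullInt_transport (e := e) (μ := μ) hX (hf.mul hh) hK
    (fun z hz => by simp [h0 z hz])).const_mul 2
  convert this using 2 with z
  have hm : ∀ l, X l z * dd (e l) (fun y => f y * h y) z
      = h z * (X l z * dd (e l) f z) + f z * (X l z * dd (e l) h z) := by
    intro l
    rw [dd_mul _ (hf.differentiable (by norm_num)) (hh.differentiable (by norm_num))]
    ring
  simp only [skewOp, hm, Finset.sum_add_distrib, ← Finset.mul_sum]
  ring

/-- The Rellich-Pohozaev identity: `∫ div(A∇p) (2 X·∇p + (div X) p)` in terms of the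
deformation of the vector field `X` and of the derivative of the matrix `A` along `X`. -/
lemma nullInt_rellich (ha : ∀ k j, ContDiff ℝ 1 (a k j)) (hs : ∀ k j z, a k j z = a j k z)
    (hX : ∀ l, ContDiff ℝ 3 (X l)) {p : E → ℝ} (hp : ContDiff ℝ 2 p) (hK : IsCompact K)
    (h0 : ∀ z ∉ K, p z = 0) :
    NullInt μ (fun z => divA e a p z * skewOp e X p z
      + 2 * ∑ k, ∑ j, ∑ l, a k j z * dd (e k) (X l) z * dd (e j) p z * dd (e l) p z
      - ∑ k, ∑ j, ∑ l, X l z * dd (e l) (a k j) z * dd (e j) p z * dd (e k) p z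
      - 1 / 2 * (divA e a (dvg e X) z * p z ^ 2)) := by
  have hD : ContDiff ℝ 2 (dvg e X) := contDiff_dvg hX (by norm_num)
  have hX1 : ∀ l, ContDiff ℝ 1 (X l) := fun l => (hX l).of_le (by norm_num)
  have hp1 : ∀ v, ContDiff ℝ 1 (dd v p) := fun v => contDiff_dd hp (by norm_num) v
  have d1 : ∀ {f : E → ℝ}, ContDiff ℝ 1 f → Differentiable ℝ f :=
    fun hf => hf.differentiable (by norm_num)
  have d2 : ∀ {f : E → ℝ}, ContDiff ℝ 2 f → Differentiable ℝ f :=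
    fun hf => hf.differentiable (by norm_num)
  have hdp0 : ∀ v, ∀ z ∉ K, dd v p z = 0 := fun v => dd_eq_zero_of_notMem hK.isClosed h0 v
  have hQ : ContDiff ℝ 1 (bil e a p p) := ContDiff.sum fun k _ => ContDiff.sum fun j _ =>
    ((ha k j).mul (hp1 (e j))).mul (hp1 (e k))
  have N1 := nullInt_green (μ := μ) (e := e) ha hp
    (contDiff_skewOp (m := 1) (e := e) hX hp (by norm_num) (by norm_num)) hK
    (fun z hz => Or.inr fun v => hdp0 v z hz)
  have N2 := nullInt_transport (μ := μ) (e := e) hX1 hQ hK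
    (fun z hz => by simp [bil, hdp0 _ z hz])
  have N3 := nullInt_green (μ := μ) (e := e) ha hD (hp.of_le (by norm_num) |>.pow 2) hK
    (fun z hz => Or.inl (by simp [h0 z hz]))
  have N := (N1.sub N2).sub (N3.const_mul (1 / 2))
  convert N using 2 with z
  have e1 : ∀ k, dd (e k) (skewOp e X p) z
      = 2 * ∑ l, (dd (e k) (X l) z * dd (e l) p z + X l z * dd (e l) (dd (e k) p) z)
        + (dd (e k) (dvg e X) z * p z + dvg e X z * dd (e k) p z) := by
    intro k
    unfold skewOp
    rw [dd_add _ ?_ ((d2 hD).fun_mul (d2 hp)), dd_const_mul _ _ ?_, dd_sum _ ?_,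
      dd_mul _ (d2 hD) (d2 hp)]
    · congr 2
      refine Finset.sum_congr rfl fun l _ => ?_
      rw [dd_mul _ (d1 (hX1 l)) (d1 (hp1 _)), dd_comm hp]
    · exact fun l => (d1 (hX1 l)).fun_mul (d1 (hp1 _))
    · exact Differentiable.fun_sum fun l _ => (d1 (hX1 l)).fun_mul (d1 (hp1 _))
    · exact (Differentiable.fun_sum fun l _ => (d1 (hX1 l)).fun_mul (d1 (hp1 _))).const_mul 2
  have e2 : ∀ l, dd (e l) (bil e a p p) z
      = ∑ k, ∑ j, (dd (e l) (a k j) z * dd (e j) p z * dd (e k) p z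
        + a k j z * dd (e l) (dd (e j) p) z * dd (e k) p z
        + a k j z * dd (e j) p z * dd (e l) (dd (e k) p) z) := by
    intro l
    unfold bil
    rw [dd_sum _ fun k => Differentiable.fun_sum fun j _ =>
      ((d1 (ha k j)).fun_mul (d1 (hp1 _))).fun_mul (d1 (hp1 _))]
    refine Finset.sum_congr rfl fun k _ => ?_
    rw [dd_sum _ fun j => ((d1 (ha k j)).fun_mul (d1 (hp1 _))).fun_mul (d1 (hp1 _))]
    refine Finset.sum_congr rfl fun j _ => ?_
    rw [dd_mul _ ((d1 (ha k j)).fun_mul (d1 (hp1 _))) (d1 (hp1 _)),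
      dd_mul _ (d1 (ha k j)) (d1 (hp1 _))]
    ring
  have e3 : ∀ k, dd (e k) (fun y => p y ^ 2) z = 2 * p z * dd (e k) p z := by
    intro k
    simp only [pow_two]
    rw [dd_mul _ (d2 hp) (d2 hp)]; ring
  -- the two halves of the derivative of the quadratic form agree by the symmetry of `a`
  have sw : ∀ l, ∑ k, ∑ j, a k j z * dd (e l) (dd (e j) p) z * dd (e k) p z
      = ∑ k, ∑ j, a k j z * dd (e j) p z * dd (e l) (dd (e k) p) z := by
    intro l
    rw [Finset.sum_comm]
    refine Finset.sum_congr rfl fun j _ => Finset.sum_congr rfl fun k _ => ?_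
    rw [hs k j]; ring
  have sw2 : bil e a (dvg e X) (fun y => p y ^ 2) z
      = 2 * (p z * ∑ k, ∑ j, a k j z * dd (e j) p z * dd (e k) (dvg e X) z) := by
    rw [bil_comm hs]
    simp only [bil, e3, Finset.mul_sum]
    refine Finset.sum_congr rfl fun k _ => Finset.sum_congr rfl fun j _ => ?_
    ring
  have b1 : bil e a p (skewOp e X p) z
      = 2 * ∑ k, ∑ j, ∑ l, a k j z * dd (e k) (X l) z * dd (e j) p z * dd (e l) p z
      + 2 * ∑ l, X l z * ∑ k, ∑ j, a k j z * dd (e j) p z * dd (e l) (dd (e k) p) z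
      + p z * (∑ k, ∑ j, a k j z * dd (e j) p z * dd (e k) (dvg e X) z)
      + dvg e X z * bil e a p p z := by
    have c1 : ∑ l, X l z * ∑ k, ∑ j, a k j z * dd (e j) p z * dd (e l) (dd (e k) p) z
        = ∑ k, ∑ j, ∑ l, X l z * (a k j z * dd (e j) p z * dd (e l) (dd (e k) p) z) := by
      simp only [Finset.mul_sum]
      rw [Finset.sum_comm]
      refine Finset.sum_congr rfl fun k _ => ?_
      rw [Finset.sum_comm]
    rw [c1]
    simp only [bil, e1, Finset.mul_sum, ← Finset.sum_add_distrib]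
    refine Finset.sum_congr rfl fun k _ => Finset.sum_congr rfl fun j _ => ?_
    simp only [mul_add, Finset.mul_sum, Finset.sum_add_distrib, ← add_assoc]
    congr 1
    · congr 1
      · congr 1 <;> exact Finset.sum_congr rfl fun l _ => by ring
      · ring
    · ring
  have b2 : ∑ l, X l z * dd (e l) (bil e a p p) z
      = ∑ k, ∑ j, ∑ l, X l z * dd (e l) (a k j) z * dd (e j) p z * dd (e k) p z
      + 2 * ∑ l, X l z * ∑ k, ∑ j, a k j z * dd (e j) p z * dd (e l) (dd (e k) p) z := by
    have c1 : ∑ k, ∑ j, ∑ l, X l z * dd (e l) (a k j) z * dd (e j) p z * dd (e k) p z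
        = ∑ l, X l z * ∑ k, ∑ j, dd (e l) (a k j) z * dd (e j) p z * dd (e k) p z := by
      simp only [Finset.mul_sum]
      symm
      rw [Finset.sum_comm]
      refine Finset.sum_congr rfl fun k _ => ?_
      rw [Finset.sum_comm]
      refine Finset.sum_congr rfl fun j _ => Finset.sum_congr rfl fun l _ => by ring
    rw [c1, Finset.mul_sum, ← Finset.sum_add_distrib]
    refine Finset.sum_congr rfl fun l _ => ?_
    rw [e2]
    simp only [Finset.sum_add_distrib]
    rw [sw]; ring
  rw [b1, b2, sw2]
  ring

end IntegrationByParts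

/-! ### Conjugation by an exponential weight -/

section Conjugation

variable {E : Type*} [NormedAddCommGroup E] [NormedSpace ℝ E] {n : ℕ} {e : Fin n → E}
  {a : Fin n → Fin n → E → ℝ} {φ : E → ℝ}

/-- The vector field `A ∇φ`. -/
noncomputable def gradA (e : Fin n → E) (a : Fin n → Fin n → E → ℝ) (φ : E → ℝ) (l : Fin n)
    (z : E) : ℝ :=
  ∑ m, a l m z * dd (e m) φ z

lemma dd_exp_mul {g : E → ℝ} (hφ : Differentiable ℝ φ) (hg : Differentiable ℝ g) (v z : E) :
    dd v (fun y => Real.exp (φ y) * g y) z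
      = Real.exp (φ z) * (dd v g z + dd v φ z * g z) := by
  rw [dd_mul _ hφ.exp hg, dd_comp _ Real.differentiable_exp hφ]
  simp only [Real.deriv_exp]; ring

/-- Conjugation of `div(A∇·)` by `exp φ`: the symmetric part is `div(A∇·) + A∇φ·∇φ` and the
skew-symmetric part is `-skewOp` for the field `A∇φ`. -/
lemma exp_mul_divA (ha : ∀ k j, ContDiff ℝ 1 (a k j)) (hs : ∀ k j z, a k j z = a j k z)
    (hφ : ContDiff ℝ 2 φ) {g : E → ℝ} (hg : ContDiff ℝ 2 g) (z : E) :
    Real.exp (φ z) * divA e a g z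
      = divA e a (fun y => Real.exp (φ y) * g y) z
        + bil e a φ φ z * (Real.exp (φ z) * g z)
        - skewOp e (gradA e a φ) (fun y => Real.exp (φ y) * g y) z := by
  have d1 : ∀ {f : E → ℝ}, ContDiff ℝ 1 f → Differentiable ℝ f :=
    fun hf => hf.differentiable (by norm_num)
  have dφ : Differentiable ℝ φ := hφ.differentiable (by norm_num)
  have dg : Differentiable ℝ g := hg.differentiable (by norm_num)
  have hfl : ∀ k, ContDiff ℝ 1 (fun y => ∑ j, a k j y * dd (e j) g y) :=
    contDiff_flux ha hg (by norm_num)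
  have hX : ∀ k, ContDiff ℝ 1 (gradA e a φ k) := contDiff_flux ha hφ (by norm_num)
  have h1 : ∀ k, (fun y => ∑ j, a k j y * dd (e j) (fun y => Real.exp (φ y) * g y) y)
      = fun y => Real.exp (φ y) * (∑ j, a k j y * dd (e j) g y + gradA e a φ k y * g y) := by
    intro k
    funext y
    rw [gradA, Finset.sum_mul, ← Finset.sum_add_distrib, Finset.mul_sum]
    refine Finset.sum_congr rfl fun j _ => ?_
    rw [dd_exp_mul dφ dg]; ring
  have h2 : divA e a (fun y => Real.exp (φ y) * g y) z = Real.exp (φ z) *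
      (divA e a g z + (dvg e (gradA e a φ) z * g z + ∑ k, gradA e a φ k z * dd (e k) g z)
        + (∑ k, ∑ j, dd (e k) φ z * (a k j z * dd (e j) g z) + bil e a φ φ z * g z)) := by
    have hb : bil e a φ φ z = ∑ k, dd (e k) φ z * gradA e a φ k z := by
      simp only [bil, gradA, Finset.mul_sum]
      refine Finset.sum_congr rfl fun k _ => Finset.sum_congr rfl fun j _ => by ring
    unfold divA dvg
    rw [hb, Finset.sum_mul, Finset.sum_mul, ← Finset.sum_add_distrib, ← Finset.sum_add_distrib,
      ← Finset.sum_add_distrib, ← Finset.sum_add_distrib, Finset.mul_sum]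
    refine Finset.sum_congr rfl fun k _ => ?_
    rw [h1, dd_exp_mul dφ ((d1 (hfl k)).fun_add ((d1 (hX k)).fun_mul dg)),
      dd_add _ (d1 (hfl k)) ((d1 (hX k)).fun_mul dg), dd_mul _ (d1 (hX k)) dg, ← Finset.mul_sum]
    ring
  have h3 : ∑ k, ∑ j, dd (e k) φ z * (a k j z * dd (e j) g z)
      = ∑ k, gradA e a φ k z * dd (e k) g z := by
    rw [Finset.sum_comm]
    refine Finset.sum_congr rfl fun j _ => ?_
    rw [gradA, Finset.sum_mul]
    refine Finset.sum_congr rfl fun k _ => ?_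
    rw [hs k j]; ring
  have h4 : ∑ l, gradA e a φ l z * dd (e l) (fun y => Real.exp (φ y) * g y) z
      = Real.exp (φ z) * (∑ k, gradA e a φ k z * dd (e k) g z + bil e a φ φ z * g z) := by
    rw [bil, Finset.sum_mul, ← Finset.sum_add_distrib, Finset.mul_sum]
    refine Finset.sum_congr rfl fun k _ => ?_
    rw [dd_exp_mul dφ dg, ← Finset.sum_mul]
    simp only [gradA]; ring
  rw [skewOp, h2, h3, h4]
  ring

end Conjugation

/-! ### The commutator of the symmetric and skew-symmetric parts -/

section Commutator

variable {E : Type*} [NormedAddCommGroup E] [NormedSpace ℝ E] [MeasurableSpace E] [BorelSpace E]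
  [FiniteDimensional ℝ E] {μ : Measure E} [μ.IsAddHaarMeasure] {n : ℕ} {e : Fin n → E} {e₀ : E}
  {a : Fin n → Fin n → E → ℝ} {X : Fin n → E → ℝ} {K : Set E}

/-- The density of the commutator of the symmetric and the skew-symmetric part of the conjugated
Schrödinger operator, for the field `X`, the potential `q` and the time derivative `ψ` of the
weight. -/
noncomputable def commDensity (e₀ : E) (e : Fin n → E) (a : Fin n → Fin n → E → ℝ)
    (X : Fin n → E → ℝ) (q ψ f : E → ℝ) (z : E) : ℝ :=
  (dd e₀ ψ z + 2 * ∑ l, X l z * dd (e l) q z - divA e a (dvg e X) z) * f z ^ 2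
    + 4 * ∑ k, ∑ j, ∑ l, a k j z * dd (e k) (X l) z * dd (e j) f z * dd (e l) f z
    - 2 * ∑ k, ∑ j, ∑ l, X l z * dd (e l) (a k j) z * dd (e j) f z * dd (e k) f z

/-- For `f = p + i r`, `S = i ∂_t + div(A∇·) + q` and `K = -skewOp - i ψ`, the integral of
`2 Re (S f · conj (K f))` is that of the commutator densities of `p` and `r`. The time
derivative commutes with the skew-symmetric spatial part because `X` does not depend on time. -/
lemma nullInt_commutator (ha : ∀ k j, ContDiff ℝ 1 (a k j)) (hs : ∀ k j z, a k j z = a j k z)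
    (hX : ∀ l, ContDiff ℝ 3 (X l)) (hXt : ∀ l z, dd e₀ (X l) z = 0)
    {q ψ : E → ℝ} (hq : ContDiff ℝ 1 q) (hψ : ContDiff ℝ 1 ψ)
    (hψx : ∀ k z, dd (e k) ψ z = 0)
    {p r : E → ℝ} (hp : ContDiff ℝ 3 p) (hr : ContDiff ℝ 3 r) (hK : IsCompact K)
    (hp0 : ∀ z ∉ K, p z = 0) (hr0 : ∀ z ∉ K, r z = 0) :
    NullInt μ (fun z =>
      2 * ((-dd e₀ r z + divA e a p z + q z * p z) * (-skewOp e X p z + ψ z * r z)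
        + (dd e₀ p z + divA e a r z + q z * r z) * (-skewOp e X r z - ψ z * p z))
      - (commDensity e₀ e a X q ψ p z + commDensity e₀ e a X q ψ r z)) := by
  have d1 : ∀ {f : E → ℝ}, ContDiff ℝ 1 f → Differentiable ℝ f :=
    fun hf => hf.differentiable (by norm_num)
  have c1 : ∀ {f : E → ℝ}, ContDiff ℝ 3 f → ContDiff ℝ 1 f := fun hf => hf.of_le (by norm_num)
  have c2 : ∀ {f : E → ℝ}, ContDiff ℝ 3 f → ContDiff ℝ 2 f := fun hf => hf.of_le (by norm_num)
  have hX1 : ∀ l, ContDiff ℝ 1 (X l) := fun l => c1 (hX l)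
  have hD : ContDiff ℝ 2 (dvg e X) := contDiff_dvg hX (by norm_num)
  have hY : ∀ {f : E → ℝ}, ContDiff ℝ 3 f → ContDiff ℝ 1 (skewOp e X f) :=
    fun hf => contDiff_skewOp hX hf (by norm_num) (by norm_num)
  have hDt : ∀ z, dd e₀ (dvg e X) z = 0 := by
    intro z
    unfold dvg
    rw [dd_sum _ fun l => d1 (contDiff_dd (m := 1) (hX l) (by norm_num) (e l))]
    refine Finset.sum_eq_zero fun l _ => ?_
    rw [dd_comm (c2 (hX l)), funext (hXt l)]
    simp
  have hYt : ∀ z, skewOp e X (dd e₀ r) z = dd e₀ (skewOp e X r) z := by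
    intro z
    have hdr : ∀ l, Differentiable ℝ (dd (e l) r) :=
      fun l => d1 (contDiff_dd (m := 1) hr (by norm_num) (e l))
    have hdX : ∀ l, Differentiable ℝ (X l) := fun l => d1 (hX1 l)
    unfold skewOp
    rw [dd_add _ ?_ ?_, dd_const_mul _ _ ?_, dd_sum _ ?_, dd_mul _ (hD.differentiable (by norm_num))
      (d1 (c1 hr)), hDt]
    · have : ∀ l, dd e₀ (fun y => X l y * dd (e l) r y) z = X l z * dd (e l) (dd e₀ r) z := by
        intro l
        rw [dd_mul _ (hdX l) (hdr l), hXt, dd_comm (c2 hr)]; ring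
      simp only [this]; ring
    · exact fun l => (hdX l).fun_mul (hdr l)
    · exact Differentiable.fun_sum fun l _ => (hdX l).fun_mul (hdr l)
    · exact (Differentiable.fun_sum fun l _ => (hdX l).fun_mul (hdr l)).const_mul 2
    · exact (hD.differentiable (by norm_num)).fun_mul (d1 (c1 hr))
  have hpt := contDiff_dd (m := 1) hp (by norm_num) e₀
  have hrt := contDiff_dd (m := 1) hr (by norm_num) e₀
  have T1 : NullInt μ (fun z => dd e₀ r z * skewOp e X p z - dd e₀ p z * skewOp e X r z) := by
    have A := nullInt_skewOp (μ := μ) (e := e) hX1 (c1 hp) hrt hK hp0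
    have B := nullInt_dd (μ := μ) ((c1 hp).mul (hY hr)) hK (fun z hz => by simp [hp0 z hz]) e₀
    convert A.sub B using 2 with z
    rw [dd_mul _ (d1 (c1 hp)) (d1 (hY hr)), hYt]; ring
  have bψ : ∀ f h : E → ℝ, ContDiff ℝ 3 h → ∀ z,
      bil e a f (fun y => ψ y * h y) z = ψ z * bil e a f h z := by
    intro f h hh z
    simp only [bil, Finset.mul_sum]
    refine Finset.sum_congr rfl fun k _ => Finset.sum_congr rfl fun j _ => ?_
    rw [dd_mul _ (d1 hψ) (d1 (c1 hh)), hψx]; ring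
  have T3 : NullInt μ (fun z => ψ z * (r z * divA e a p z - p z * divA e a r z)) := by
    have A := nullInt_green (μ := μ) (e := e) ha (c2 hp) (hψ.mul (c1 hr)) hK
      (fun z hz => Or.inl (by simp [hr0 z hz]))
    have B := nullInt_green (μ := μ) (e := e) ha (c2 hr) (hψ.mul (c1 hp)) hK
      (fun z hz => Or.inl (by simp [hp0 z hz]))
    convert A.sub B using 2 with z
    rw [bψ _ _ hr, bψ _ _ hp, bil_comm hs r p]; ring
  have T2 : ∀ {f : E → ℝ}, ContDiff ℝ 3 f → (∀ z ∉ K, f z = 0) →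
      NullInt μ (fun z => dd e₀ ψ z * f z ^ 2 + 2 * ψ z * f z * dd e₀ f z) := by
    intro f hf hf0
    convert nullInt_dd (μ := μ) (hψ.mul ((c1 hf).mul (c1 hf))) hK
      (fun z hz => by simp [hf0 z hz]) e₀ using 2 with z
    rw [dd_mul _ (d1 hψ) ((d1 (c1 hf)).fun_mul (d1 (c1 hf))), dd_mul _ (d1 (c1 hf)) (d1 (c1 hf))]
    ring
  have T5 : ∀ {f : E → ℝ}, ContDiff ℝ 3 f → (∀ z ∉ K, f z = 0) →
      NullInt μ (fun z => q z * f z * skewOp e X f z + f z ^ 2 * ∑ l, X l z * dd (e l) q z) := by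
    intro f hf hf0
    convert nullInt_transport (μ := μ) (e := e) hX1 (hq.mul ((c1 hf).mul (c1 hf))) hK
      (fun z hz => by simp [hf0 z hz]) using 2 with z
    have : ∀ l, X l z * dd (e l) (fun y => q y * (f y * f y)) z
        = f z ^ 2 * (X l z * dd (e l) q z) + 2 * q z * f z * (X l z * dd (e l) f z) := by
      intro l
      rw [dd_mul _ (d1 hq) ((d1 (c1 hf)).fun_mul (d1 (c1 hf))), dd_mul _ (d1 (c1 hf)) (d1 (c1 hf))]
      ring
    simp only [this, Finset.sum_add_distrib, ← Finset.mul_sum, skewOp]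
    ring
  have Rp := nullInt_rellich (μ := μ) (e := e) ha hs hX (c2 hp) hK hp0
  have Rr := nullInt_rellich (μ := μ) (e := e) ha hs hX (c2 hr) hK hr0
  have N := ((((T1.add T3).const_mul 2).sub ((T2 hp hp0).add (T2 hr hr0))).sub
    ((Rp.add Rr).const_mul 2)).sub (((T5 hp hp0).add (T5 hr hr0)).const_mul 2)
  convert N using 2 with z
  unfold commDensity
  ring

/-- Carleman inequality for the pair `(Re, Im)` of a smooth compactly supported function, under a
pointwise lower bound on the commutator density. -/
lemma carleman_of_commDensity (ha : ∀ k j, ContDiff ℝ 3 (a k j))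
    (hs : ∀ k j z, a k j z = a j k z) (hat : ∀ k j z, dd e₀ (a k j) z = 0)
    {φ : E → ℝ} (hφ : ContDiff ℝ ∞ φ) (hφx : ∀ k z, dd (e k) (dd e₀ φ) z = 0)
    {κ : ℝ} {g₁ g₂ : E → ℝ} (hg₁ : ContDiff ℝ ∞ g₁) (hg₂ : ContDiff ℝ ∞ g₂) (hK : IsCompact K)
    (h₁ : ∀ z ∉ K, g₁ z = 0) (h₂ : ∀ z ∉ K, g₂ z = 0)
    (hpos : ∀ z ∈ K, ∀ f : E → ℝ,
      κ * f z ^ 2 ≤ commDensity e₀ e a (gradA e a φ) (bil e a φ φ) (dd e₀ φ) f z) :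
    κ * ∫ z, Real.exp (φ z) ^ 2 * (g₁ z ^ 2 + g₂ z ^ 2) ∂μ
      ≤ ∫ z, Real.exp (φ z) ^ 2 * ((divA e a g₁ z - dd e₀ g₂ z) ^ 2
        + (divA e a g₂ z + dd e₀ g₁ z) ^ 2) ∂μ := by
  have i3 : ∀ {f : E → ℝ}, ContDiff ℝ ∞ f → ContDiff ℝ 3 f :=
    fun hf => hf.of_le ENat.LEInfty.out
  have i2 : ∀ {f : E → ℝ}, ContDiff ℝ ∞ f → ContDiff ℝ 2 f :=
    fun hf => hf.of_le ENat.LEInfty.out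
  have i1 : ∀ {f : E → ℝ}, ContDiff ℝ ∞ f → Differentiable ℝ f :=
    fun hf => hf.differentiable (by simp)
  have ha1 : ∀ k j, ContDiff ℝ 1 (a k j) := fun k j => (ha k j).of_le (by norm_num)
  have hdφ : ∀ v, ContDiff ℝ ∞ (dd v φ) := fun v => contDiff_dd hφ (by simp) v
  have hX : ∀ l, ContDiff ℝ 3 (gradA e a φ l) := contDiff_flux ha
    (hφ.of_le (m := 4) ENat.LEInfty.out) (by norm_num)
  have hXt : ∀ l z, dd e₀ (gradA e a φ l) z = 0 := by
    intro l z
    unfold gradA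
    rw [dd_sum _ fun m => ((ha1 l m).differentiable (by norm_num)).fun_mul (i1 (hdφ _))]
    refine Finset.sum_eq_zero fun m _ => ?_
    rw [dd_mul _ ((ha1 l m).differentiable (by norm_num)) (i1 (hdφ _)), hat, dd_comm (i2 hφ), hφx]
    simp
  have hq : ContDiff ℝ 1 (bil e a φ φ) := ContDiff.sum fun k _ => ContDiff.sum fun j _ =>
    ((ha1 k j).mul ((hdφ _).of_le (by exact_mod_cast le_top))).mul
      ((hdφ _).of_le (by exact_mod_cast le_top))
  have hψ : ContDiff ℝ 1 (dd e₀ φ) := (hdφ _).of_le (by exact_mod_cast le_top)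
  set p : E → ℝ := fun y => Real.exp (φ y) * g₁ y with hp_def
  set r : E → ℝ := fun y => Real.exp (φ y) * g₂ y with hr_def
  have hp : ContDiff ℝ 3 p := i3 (hφ.exp.mul hg₁)
  have hr : ContDiff ℝ 3 r := i3 (hφ.exp.mul hg₂)
  have hp0 : ∀ z ∉ K, p z = 0 := fun z hz => by simp [p, h₁ z hz]
  have hr0 : ∀ z ∉ K, r z = 0 := fun z hz => by simp [r, h₂ z hz]
  have N := nullInt_commutator (μ := μ) (e := e) (e₀ := e₀) ha1 hs hX hXt hq hψ hφx hp hr hK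
    hp0 hr0
  have hL : ∀ {f : E → ℝ}, ContDiff ℝ ∞ f → Continuous (divA e a f) := fun hf =>
    (contDiff_divA (m := 0) ha1 (i2 hf) (by norm_num) (by norm_num)).continuous
  have hdt : ∀ {f : E → ℝ}, ContDiff ℝ ∞ f → Continuous (dd e₀ f) := fun hf =>
    (contDiff_dd (m := 0) (i2 hf) (by norm_num) e₀).continuous
  have hL0 : ∀ {f : E → ℝ}, (∀ z ∉ K, f z = 0) → ∀ z ∉ K, divA e a f z = 0 := by
    intro f hf z hz
    refine Finset.sum_eq_zero fun k _ => ?_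
    exact dd_eq_zero_of_notMem hK.isClosed
      (fun y hy => by simp [dd_eq_zero_of_notMem hK.isClosed hf _ y hy]) _ z hz
  have hT : Integrable (fun z => Real.exp (φ z) ^ 2 * ((divA e a g₁ z - dd e₀ g₂ z) ^ 2
        + (divA e a g₂ z + dd e₀ g₁ z) ^ 2)) μ := by
    refine integrable_of_continuous_of_notMem ?_ hK fun z hz => ?_
    · exact (hφ.continuous.rexp.pow 2).mul ((((hL hg₁).sub (hdt hg₂)).pow 2).add
        (((hL hg₂).add (hdt hg₁)).pow 2))
    · simp [hL0 h₁ z hz, hL0 h₂ z hz, dd_eq_zero_of_notMem hK.isClosed h₁ _ z hz,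
        dd_eq_zero_of_notMem hK.isClosed h₂ _ z hz]
  have hG : Integrable (fun z => Real.exp (φ z) ^ 2 * (g₁ z ^ 2 + g₂ z ^ 2)) μ := by
    refine integrable_of_continuous_of_notMem ?_ hK fun z hz => ?_
    · exact (hφ.continuous.rexp.pow 2).mul ((hg₁.continuous.pow 2).add (hg₂.continuous.pow 2))
    · simp [h₁ z hz, h₂ z hz]
  rw [← sub_nonneg, ← integral_const_mul, ← integral_sub hT (hG.const_mul κ), ← N.2]
  refine integral_mono N.1 (hT.sub (hG.const_mul κ)) fun z => ?_
  by_cases hz : z ∈ K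
  · have ep := hpos z hz p
    have er := hpos z hz r
    have k1 : Real.exp (φ z) * (divA e a g₁ z - dd e₀ g₂ z)
        = (-dd e₀ r z + divA e a p z + bil e a φ φ z * p z)
          + (-skewOp e (gradA e a φ) p z + dd e₀ φ z * r z) := by
      have := exp_mul_divA (e := e) ha1 hs (i2 hφ) (i2 hg₁) z
      rw [mul_sub, this, dd_exp_mul (i1 hφ) (i1 hg₂)]
      ring
    have k2 : Real.exp (φ z) * (divA e a g₂ z + dd e₀ g₁ z)
        = (dd e₀ p z + divA e a r z + bil e a φ φ z * r z)
          + (-skewOp e (gradA e a φ) r z - dd e₀ φ z * p z) := by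
      have := exp_mul_divA (e := e) ha1 hs (i2 hφ) (i2 hg₂) z
      rw [mul_add, this, dd_exp_mul (i1 hφ) (i1 hg₁)]
      ring
    have k3 : Real.exp (φ z) ^ 2 * ((divA e a g₁ z - dd e₀ g₂ z) ^ 2
        + (divA e a g₂ z + dd e₀ g₁ z) ^ 2)
        = (Real.exp (φ z) * (divA e a g₁ z - dd e₀ g₂ z)) ^ 2
          + (Real.exp (φ z) * (divA e a g₂ z + dd e₀ g₁ z)) ^ 2 := by ring
    have k4 : κ * (Real.exp (φ z) ^ 2 * (g₁ z ^ 2 + g₂ z ^ 2)) = κ * p z ^ 2 + κ * r z ^ 2 := by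
      simp only [p, r]; ring
    rw [k3, k4, k1, k2]
    -- `|s + t|² ≥ 2 s·t`, and the integral of the right-hand side is that of the commutator
    generalize -dd e₀ r z + divA e a p z + bil e a φ φ z * p z = s₁
    generalize dd e₀ p z + divA e a r z + bil e a φ φ z * r z = s₂
    generalize -skewOp e (gradA e a φ) p z + dd e₀ φ z * r z = t₁
    generalize -skewOp e (gradA e a φ) r z - dd e₀ φ z * p z = t₂
    nlinarith [sq_nonneg s₁, sq_nonneg s₂, sq_nonneg t₁, sq_nonneg t₂]
  · have dp : ∀ v, dd v p z = 0 := fun v => dd_eq_zero_of_notMem hK.isClosed hp0 v z hz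
    have dr : ∀ v, dd v r z = 0 := fun v => dd_eq_zero_of_notMem hK.isClosed hr0 v z hz
    have dg₁ : ∀ v, dd v g₁ z = 0 := fun v => dd_eq_zero_of_notMem hK.isClosed h₁ v z hz
    have dg₂ : ∀ v, dd v g₂ z = 0 := fun v => dd_eq_zero_of_notMem hK.isClosed h₂ v z hz
    simp [commDensity, skewOp, dp, dr, dg₁, dg₂, hp0 z hz, hr0 z hz, h₁ z hz, h₂ z hz,
      hL0 h₁ z hz, hL0 h₂ z hz]

end Commutator

/-! ### Pointwise bounds from ellipticity and decay of the gradient -/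

section PointwiseBounds

variable {n : ℕ}

/-- The pointwise bounds on the coefficients that enter the Carleman inequality: ellipticity,
bounds on derivatives of order one to three, and smallness of `|x||∇a|`. -/
structure CoeffBounds (lam Lam K δ : ℝ) (a : Fin n → Fin n → Rn n → ℝ) : Prop where
  smooth : ∀ k j, ContDiff ℝ 3 (a k j)
  symm : ∀ k j x, a k j x = a j k x
  elliptic : ∀ x (ξ : Rn n), lam * ‖ξ‖ ^ 2 ≤ ∑ k, ∑ j, a k j x * ξ j * ξ k
  entry : ∀ k j x, |a k j x| ≤ Lam
  deriv_one : ∀ k j l x, |dd (stdVec l) (a k j) x| ≤ K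
  deriv_two : ∀ k j l i x, |dd (stdVec i) (dd (stdVec l) (a k j)) x| ≤ K
  deriv_three : ∀ k j l i m x, |dd (stdVec m) (dd (stdVec i) (dd (stdVec l) (a k j))) x| ≤ K
  decay : ∀ k j l x, ‖x‖ * |dd (stdVec l) (a k j) x| ≤ δ

lemma abs_sum_le_card_mul {ι : Type*} [Fintype ι] {f : ι → ℝ} {C : ℝ} (h : ∀ i, |f i| ≤ C) :
    |∑ i, f i| ≤ Fintype.card ι * C := by
  calc |∑ i, f i| ≤ ∑ i, |f i| := Finset.abs_sum_le_sum_abs _ _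
    _ ≤ ∑ _i : ι, C := Finset.sum_le_sum fun i _ => h i
    _ = _ := by simp

lemma abs_coord_le (x : Rn n) (i : Fin n) : |x i| ≤ ‖x‖ := by
  simpa using PiLp.norm_apply_le x i

lemma norm_sq_eq_sum (x : Rn n) : ‖x‖ ^ 2 = ∑ i, x i ^ 2 := EuclideanSpace.real_norm_sq_eq x

lemma sq_mul_norm_sq_le_of_elliptic {lam : ℝ} (hlam : 0 < lam) (B : Fin n → Fin n → ℝ) (ξ : Rn n)
    (h : lam * ‖ξ‖ ^ 2 ≤ ∑ k, ∑ j, B k j * ξ j * ξ k) :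
    lam ^ 2 * ‖ξ‖ ^ 2 ≤ ∑ k, (∑ j, B k j * ξ j) ^ 2 := by
  have h1 : ∑ k, ∑ j, B k j * ξ j * ξ k = ∑ k, (∑ j, B k j * ξ j) * ξ k := by
    simp only [Finset.sum_mul]
  have cs := Finset.sum_mul_sq_le_sq_mul_sq Finset.univ (fun k => ∑ j, B k j * ξ j) ξ
  rw [← norm_sq_eq_sum] at cs
  rw [h1] at h
  rcases (norm_nonneg ξ).eq_or_lt with h0 | h0
  · rw [← h0]
    simpa using Finset.sum_nonneg fun k _ => sq_nonneg (∑ j, B k j * ξ j)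
  have hpos : 0 < ‖ξ‖ ^ 2 := by positivity
  refine le_of_mul_le_mul_right ?_ hpos
  calc lam ^ 2 * ‖ξ‖ ^ 2 * ‖ξ‖ ^ 2 = (lam * ‖ξ‖ ^ 2) ^ 2 := by ring
    _ ≤ (∑ k, (∑ j, B k j * ξ j) * ξ k) ^ 2 := pow_le_pow_left₀ (by positivity) h 2
    _ ≤ _ := cs

lemma abs_quartic_le {Lam δ : ℝ} (hLam : 0 ≤ Lam) {s d ρ y u v : ℝ} (hs : |s| ≤ Lam)
    (hd : ρ * |d| ≤ δ) (hy : |y| ≤ ρ) {N : ℝ} (hu : |u| ≤ N) (hv : |v| ≤ N) :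
    |s * d * y * u * v| ≤ Lam * δ * N ^ 2 := by
  have hN : 0 ≤ N := (abs_nonneg _).trans hu
  have h1 : |d| * |y| ≤ δ := by
    calc |d| * |y| ≤ |d| * ρ := by gcongr
      _ ≤ δ := by rw [mul_comm]; exact hd
  have hδ : 0 ≤ δ := (by positivity : 0 ≤ |d| * |y|).trans h1
  calc |s * d * y * u * v| = |s| * (|d| * |y|) * (|u| * |v|) := by
        simp only [abs_mul]; ring
    _ ≤ Lam * δ * (N * N) := by gcongr
    _ = _ := by ring

/-- With `X = 2β A x`, the deformation term dominates the derivative of `A` along `X`. Every term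
with a derivative of `A` carries a factor `|x||∇A|`, which is small. -/
lemma quadratic_form_nonneg {lam Lam δ β : ℝ} (hlam : 0 < lam) (hLam : 0 ≤ Lam) (hβ : 0 ≤ β)
    (hsmall : 2 * (n : ℝ) ^ 4 * Lam * δ ≤ lam ^ 2)
    (B : Fin n → Fin n → ℝ) (dB : Fin n → Fin n → Fin n → ℝ) (x ξ : Rn n)
    (hs : ∀ k j, B k j = B j k)
    (hell : lam * ‖ξ‖ ^ 2 ≤ ∑ k, ∑ j, B k j * ξ j * ξ k)
    (hB : ∀ k j, |B k j| ≤ Lam) (hdB : ∀ l k j, ‖x‖ * |dB l k j| ≤ δ) :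
    0 ≤ 4 * ∑ k, ∑ j, ∑ l, B k j * (2 * β * (B l k + ∑ m, dB k l m * x m)) * ξ j * ξ l
      - 2 * ∑ k, ∑ j, ∑ l, (2 * β * ∑ m, B l m * x m) * dB l k j * ξ j * ξ k := by
  have h1 := sq_mul_norm_sq_le_of_elliptic hlam B ξ hell
  have e1 : ∑ k, ∑ j, ∑ l, B k j * (2 * β * (B l k + ∑ m, dB k l m * x m)) * ξ j * ξ l
      = 2 * β * (∑ k, (∑ j, B k j * ξ j) ^ 2
        + ∑ k, ∑ j, ∑ l, ∑ m, B k j * dB k l m * x m * ξ j * ξ l) := by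
    rw [← Finset.sum_add_distrib, Finset.mul_sum]
    refine Finset.sum_congr rfl fun k _ => ?_
    rw [pow_two, Finset.sum_mul_sum, ← Finset.sum_add_distrib, Finset.mul_sum]
    refine Finset.sum_congr rfl fun j _ => ?_
    rw [← Finset.sum_add_distrib, Finset.mul_sum]
    refine Finset.sum_congr rfl fun l _ => ?_
    have : ∑ m, B k j * dB k l m * x m * ξ j * ξ l = B k j * (∑ m, dB k l m * x m) * ξ j * ξ l := by
      simp only [Finset.mul_sum, Finset.sum_mul]
      exact Finset.sum_congr rfl fun m _ => by ring
    rw [this, hs k l]; ring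
  have e2 : ∑ k, ∑ j, ∑ l, (2 * β * ∑ m, B l m * x m) * dB l k j * ξ j * ξ k
      = 2 * β * ∑ k, ∑ j, ∑ l, ∑ m, B l m * dB l k j * x m * ξ j * ξ k := by
    simp only [Finset.mul_sum, Finset.sum_mul]
    refine Finset.sum_congr rfl fun k _ => Finset.sum_congr rfl fun j _ =>
      Finset.sum_congr rfl fun l _ => Finset.sum_congr rfl fun m _ => by ring
  have b1 : |∑ k, ∑ j, ∑ l, ∑ m, B k j * dB k l m * x m * ξ j * ξ l|
      ≤ n * (n * (n * (n * (Lam * δ * ‖ξ‖ ^ 2)))) := by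
    have := abs_sum_le_card_mul fun k => abs_sum_le_card_mul fun j => abs_sum_le_card_mul fun l =>
      abs_sum_le_card_mul fun m => abs_quartic_le hLam (hB k j) (hdB k l m) (abs_coord_le x m)
        (abs_coord_le ξ j) (abs_coord_le ξ l)
    simpa using this
  have b2 : |∑ k, ∑ j, ∑ l, ∑ m, B l m * dB l k j * x m * ξ j * ξ k|
      ≤ n * (n * (n * (n * (Lam * δ * ‖ξ‖ ^ 2)))) := by
    have := abs_sum_le_card_mul fun k => abs_sum_le_card_mul fun j => abs_sum_le_card_mul fun l =>
      abs_sum_le_card_mul fun m => abs_quartic_le hLam (hB l m) (hdB l k j) (abs_coord_le x m)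
        (abs_coord_le ξ j) (abs_coord_le ξ k)
    simpa using this
  have hsm : n * (n * (n * (n * (Lam * δ * ‖ξ‖ ^ 2)))) ≤ lam ^ 2 / 2 * ‖ξ‖ ^ 2 := by
    have := mul_le_mul_of_nonneg_right hsmall (sq_nonneg ‖ξ‖)
    nlinarith
  rw [e1, e2]
  have b1' := (abs_le.mp b1).1
  have b2' := (abs_le.mp b2).2
  have hp : 0 ≤ lam ^ 2 * ‖ξ‖ ^ 2 := by positivity
  have : 0 ≤ 2 * (∑ k, (∑ j, B k j * ξ j) ^ 2
        + ∑ k, ∑ j, ∑ l, ∑ m, B k j * dB k l m * x m * ξ j * ξ l)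
      - ∑ k, ∑ j, ∑ l, ∑ m, B l m * dB l k j * x m * ξ j * ξ k := by
    linarith
  have := mul_nonneg hβ this
  linarith

/-- Lower bound for `A x · ∇(A x · x)`. For constant `A` it equals `2 |A x|²`; the smallness of
`|x||∇A|` costs half of that. -/
lemma radial_term_lower {lam Lam δ : ℝ} (hlam : 0 < lam) (hLam : 0 ≤ Lam)
    (hsmall : 2 * (n : ℝ) ^ 4 * Lam * δ ≤ lam ^ 2)
    (B : Fin n → Fin n → ℝ) (dB : Fin n → Fin n → Fin n → ℝ) (x : Rn n)
    (hell : lam * ‖x‖ ^ 2 ≤ ∑ k, ∑ j, B k j * x j * x k)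
    (hB : ∀ k j, |B k j| ≤ Lam) (hdB : ∀ l k j, ‖x‖ * |dB l k j| ≤ δ) :
    lam ^ 2 * ‖x‖ ^ 2 ≤ ∑ l, (∑ m, B l m * x m) *
      (∑ k, ∑ j, dB l k j * x j * x k + 2 * ∑ m, B l m * x m) := by
  have h1 := sq_mul_norm_sq_le_of_elliptic hlam B x hell
  have e1 : ∑ l, (∑ m, B l m * x m) * (∑ k, ∑ j, dB l k j * x j * x k + 2 * ∑ m, B l m * x m)
      = ∑ l, ∑ k, ∑ j, ∑ m, B l m * dB l k j * x m * x j * x k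
        + 2 * ∑ l, (∑ m, B l m * x m) ^ 2 := by
    rw [Finset.mul_sum, ← Finset.sum_add_distrib]
    refine Finset.sum_congr rfl fun l _ => ?_
    have : ∑ k, ∑ j, ∑ m, B l m * dB l k j * x m * x j * x k
        = (∑ m, B l m * x m) * ∑ k, ∑ j, dB l k j * x j * x k := by
      simp only [Finset.mul_sum, Finset.sum_mul]
      refine Finset.sum_congr rfl fun k _ => Finset.sum_congr rfl fun j _ =>
        Finset.sum_congr rfl fun m _ => by ring
    rw [this]; ring
  have b1 : |∑ l, ∑ k, ∑ j, ∑ m, B l m * dB l k j * x m * x j * x k|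
      ≤ n * (n * (n * (n * (Lam * δ * ‖x‖ ^ 2)))) := by
    have := abs_sum_le_card_mul fun l => abs_sum_le_card_mul fun k => abs_sum_le_card_mul fun j =>
      abs_sum_le_card_mul fun m => abs_quartic_le hLam (hB l m) (hdB l k j) (abs_coord_le x m)
        (abs_coord_le x j) (abs_coord_le x k)
    simpa using this
  have hsm : n * (n * (n * (n * (Lam * δ * ‖x‖ ^ 2)))) ≤ lam ^ 2 / 2 * ‖x‖ ^ 2 := by
    have := mul_le_mul_of_nonneg_right hsmall (sq_nonneg ‖x‖)
    nlinarith
  rw [e1]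
  have b1' := (abs_le.mp b1).1
  have hp : 0 ≤ lam ^ 2 * ‖x‖ ^ 2 := by positivity
  linarith

end PointwiseBounds

/-! ### Space-time and the Carleman weight -/

section SpaceTime

variable {n : ℕ}

/-- Space-time `ℝ × ℝⁿ`. -/
abbrev ST (n : ℕ) := ℝ × Rn n

/-- The direction of the `k`-th space variable in space-time. -/
noncomputable def ex (k : Fin n) : ST n := (0, stdVec k)

/-- The direction of time in space-time. -/
noncomputable def et : ST n := (1, 0)

/-- The `m`-th space coordinate. -/
noncomputable def coordX (m : Fin n) : ST n →L[ℝ] ℝ :=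
  (EuclideanSpace.proj m).comp (ContinuousLinearMap.snd ℝ ℝ (Rn n))

lemma dd_coordX (m : Fin n) (v z : ST n) : dd v (fun y : ST n => y.2 m) z = v.2 m := by
  have : (fun y : ST n => y.2 m) = coordX m := rfl
  simp [dd, this]; rfl

lemma contDiff_coord (m : Fin n) {r : ℕ∞ω} : ContDiff ℝ r (fun y : ST n => y.2 m) :=
  (coordX m).contDiff

lemma stdVec_apply (k m : Fin n) : (stdVec k : Rn n) m = if m = k then 1 else 0 := by
  simp [stdVec]

lemma dd_coord_ex (m k : Fin n) (z : ST n) :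
    dd (ex k) (fun y : ST n => y.2 m) z = if m = k then 1 else 0 := by
  rw [dd_coordX, ex, stdVec_apply]

lemma dd_comp_snd {F : Rn n → ℝ} (hF : Differentiable ℝ F) (v z : ST n) :
    dd v (fun y : ST n => F y.2) z = dd v.2 F z.2 := by
  have h := ((hF z.2).hasFDerivAt.comp z (hasFDerivAt_snd (𝕜 := ℝ))).fderiv
  change fderiv ℝ (F ∘ Prod.snd) z v = _
  rw [h]; simp [dd]

lemma dd_ex_comp_snd {F : Rn n → ℝ} (hF : Differentiable ℝ F) (k : Fin n) :
    dd (ex k) (fun y : ST n => F y.2) = fun y : ST n => dd (stdVec k) F y.2 :=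
  funext fun z => dd_comp_snd hF _ z

lemma dd_et_comp_snd {F : Rn n → ℝ} (hF : Differentiable ℝ F) (z : ST n) :
    dd et (fun y : ST n => F y.2) z = 0 := by
  rw [dd_comp_snd hF]; simp [dd, et]

lemma dd_comp_fst {b : ℝ → ℝ} (hb : Differentiable ℝ b) (v z : ST n) :
    dd v (fun y : ST n => b y.1) z = deriv b z.1 * v.1 := by
  have h := ((hb z.1).hasDerivAt.comp_hasFDerivAt z (hasFDerivAt_fst (𝕜 := ℝ))).fderiv
  change fderiv ℝ (b ∘ Prod.fst) z v = _
  rw [h]; simp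

/-- The coefficients as functions on space-time. -/
def stA (a : Fin n → Fin n → Rn n → ℝ) (k j : Fin n) (z : ST n) : ℝ := a k j z.2

/-- The Carleman weight `β |x|² + α b(t)`. -/
noncomputable def weight (β α : ℝ) (b : ℝ → ℝ) (z : ST n) : ℝ := β * ‖z.2‖ ^ 2 + α * b z.1

variable {β α : ℝ} {b : ℝ → ℝ}

lemma weight_eq : (weight β α b : ST n → ℝ)
    = fun z => β * ∑ m, z.2 m * z.2 m + α * b z.1 := by
  funext z
  rw [weight, norm_sq_eq_sum]
  simp only [pow_two]

lemma contDiff_weight (hb : ContDiff ℝ ∞ b) : ContDiff ℝ ∞ (weight β α b : ST n → ℝ) := by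
  rw [weight_eq]
  exact (contDiff_const.mul (ContDiff.sum fun m _ => (contDiff_coord m).mul (contDiff_coord m))).add
    (contDiff_const.mul (hb.comp contDiff_fst))

lemma dd_weight (hb : ContDiff ℝ ∞ b) (v z : ST n) :
    dd v (weight β α b) z = 2 * β * ∑ m, z.2 m * v.2 m + α * deriv b z.1 * v.1 := by
  have hbd : Differentiable ℝ b := hb.differentiable (by simp)
  have hc : ∀ m, Differentiable ℝ (fun y : ST n => y.2 m) := fun m => (coordX m).differentiable
  have hb1 : Differentiable ℝ (fun y : ST n => b y.1) := hbd.comp differentiable_fst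
  rw [weight_eq, dd_add _ ((Differentiable.fun_sum fun m _ => (hc m).fun_mul (hc m)).const_mul β)
    (hb1.const_mul α), dd_const_mul _ _ (Differentiable.fun_sum fun m _ => (hc m).fun_mul (hc m)),
    dd_const_mul _ _ hb1, dd_comp_fst hbd, dd_sum _ fun m => (hc m).fun_mul (hc m)]
  have : ∀ m, dd v (fun y : ST n => y.2 m * y.2 m) z = 2 * (z.2 m * v.2 m) := by
    intro m
    rw [dd_mul _ (hc m) (hc m), dd_coordX]; ring
  simp only [this, ← Finset.mul_sum]
  ring

lemma dd_ex_weight (hb : ContDiff ℝ ∞ b) (k : Fin n) (z : ST n) :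
    dd (ex k) (weight β α b) z = 2 * β * z.2 k := by
  rw [dd_weight hb]; simp [ex, stdVec_apply]

lemma dd_et_weight (hb : ContDiff ℝ ∞ b) :
    dd et (weight β α b : ST n → ℝ) = fun z => α * deriv b z.1 := by
  funext z
  rw [dd_weight hb]; simp [et]

variable {lam Lam K δ : ℝ} {a : Fin n → Fin n → Rn n → ℝ}

lemma contDiff_stA (ha : CoeffBounds lam Lam K δ a) (k j : Fin n) : ContDiff ℝ 3 (stA a k j) :=
  (ha.smooth k j).comp contDiff_snd

lemma dd_ex_stA (ha : CoeffBounds lam Lam K δ a) (k j l : Fin n) :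
    dd (ex l) (stA a k j) = fun z => dd (stdVec l) (a k j) z.2 :=
  dd_ex_comp_snd ((ha.smooth k j).differentiable (by norm_num)) l

lemma gradA_weight (hb : ContDiff ℝ ∞ b) (l : Fin n) :
    gradA ex (stA a) (weight β α b) l = fun z => 2 * β * ∑ m, a l m z.2 * z.2 m := by
  funext z
  simp only [gradA, dd_ex_weight hb, stA, Finset.mul_sum]
  exact Finset.sum_congr rfl fun m _ => by ring

lemma bil_weight (hb : ContDiff ℝ ∞ b) :
    bil ex (stA a) (weight β α b) (weight β α b)
      = fun z => 4 * β ^ 2 * ∑ k, ∑ j, a k j z.2 * z.2 j * z.2 k := by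
  funext z
  simp only [bil, dd_ex_weight hb, stA, Finset.mul_sum]
  exact Finset.sum_congr rfl fun m _ => Finset.sum_congr rfl fun m _ => by ring

end SpaceTime

/-! ### Lower bound for the commutator -/

section CommutatorBound

variable {n : ℕ} {β α : ℝ} {b : ℝ → ℝ} {lam Lam K δ : ℝ} {a : Fin n → Fin n → Rn n → ℝ}

lemma dd_ex_gradA (ha : CoeffBounds lam Lam K δ a) (hb : ContDiff ℝ ∞ b) (k l : Fin n) (z : ST n) :
    dd (ex k) (gradA ex (stA a) (weight β α b) l) z
      = 2 * β * (a l k z.2 + ∑ m, dd (stdVec k) (a l m) z.2 * z.2 m) := by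
  have da : ∀ m, Differentiable ℝ (fun y : ST n => a l m y.2) :=
    fun m => (contDiff_stA ha l m).differentiable (by norm_num)
  have dc : ∀ m, Differentiable ℝ (fun y : ST n => y.2 m) := fun m => (coordX m).differentiable
  rw [gradA_weight hb, dd_const_mul _ _ (Differentiable.fun_sum fun m _ => (da m).fun_mul (dc m)),
    dd_sum _ fun m => (da m).fun_mul (dc m)]
  have : ∀ m, dd (ex k) (fun y : ST n => a l m y.2 * y.2 m) z
      = dd (stdVec k) (a l m) z.2 * z.2 m + a l m z.2 * (if m = k then 1 else 0) := by
    intro m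
    rw [dd_mul _ (da m) (dc m), dd_coord_ex,
      dd_ex_comp_snd ((ha.smooth l m).differentiable (by norm_num))]
  simp only [this, Finset.sum_add_distrib]
  simp [add_comm]

lemma dd_ex_bil (ha : CoeffBounds lam Lam K δ a) (hb : ContDiff ℝ ∞ b) (l : Fin n) (z : ST n) :
    dd (ex l) (bil ex (stA a) (weight β α b) (weight β α b)) z
      = 4 * β ^ 2 * (∑ k, ∑ j, dd (stdVec l) (a k j) z.2 * z.2 j * z.2 k
        + 2 * ∑ m, a l m z.2 * z.2 m) := by
  have da : ∀ k m, Differentiable ℝ (fun y : ST n => a k m y.2) :=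
    fun k m => (contDiff_stA ha k m).differentiable (by norm_num)
  have dc : ∀ m, Differentiable ℝ (fun y : ST n => y.2 m) := fun m => (coordX m).differentiable
  have dt : ∀ k j, Differentiable ℝ (fun y : ST n => a k j y.2 * y.2 j * y.2 k) :=
    fun k j => ((da k j).fun_mul (dc j)).fun_mul (dc k)
  rw [bil_weight hb, dd_const_mul _ _ (Differentiable.fun_sum fun k _ =>
    Differentiable.fun_sum fun j _ => dt k j),
    dd_sum _ fun k => Differentiable.fun_sum fun j _ => dt k j]
  have h1 : ∀ k j, dd (ex l) (fun y : ST n => a k j y.2 * y.2 j * y.2 k) z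
      = dd (stdVec l) (a k j) z.2 * z.2 j * z.2 k
        + ((if j = l then a k j z.2 * z.2 k else 0) + if k = l then a k j z.2 * z.2 j else 0) := by
    intro k j
    rw [dd_mul _ ((da k j).fun_mul (dc j)) (dc k), dd_mul _ (da k j) (dc j), dd_coord_ex,
      dd_coord_ex, dd_ex_comp_snd ((ha.smooth k j).differentiable (by norm_num))]
    split_ifs <;> ring
  have h2 : ∀ k, dd (ex l) (fun y : ST n => ∑ j, a k j y.2 * y.2 j * y.2 k) z
      = ∑ j, dd (stdVec l) (a k j) z.2 * z.2 j * z.2 k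
        + (a k l z.2 * z.2 k + ∑ j, if k = l then a k j z.2 * z.2 j else 0) := by
    intro k
    rw [dd_sum _ fun j => dt k j]
    simp [h1, Finset.sum_add_distrib]
  have h3 : ∑ k, (∑ j, if k = l then a k j z.2 * z.2 j else 0) = ∑ m, a l m z.2 * z.2 m := by
    rw [Finset.sum_comm]
    simp
  simp only [h2, Finset.sum_add_distrib, h3]
  have h4 : ∑ k, a k l z.2 * z.2 k = ∑ m, a l m z.2 * z.2 m :=
    Finset.sum_congr rfl fun k _ => by rw [ha.symm]
  rw [h4]; ring

lemma abs_if_le_one (p : Prop) [Decidable p] : |(if p then (1 : ℝ) else 0)| ≤ 1 := by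
  split_ifs <;> simp

lemma abs_mul_ite_le (p : Prop) [Decidable p] {s C : ℝ} (hs : |s| ≤ C) :
    |s * (if p then (1 : ℝ) else 0)| ≤ C := by
  rw [abs_mul]
  calc |s| * |(if p then (1 : ℝ) else 0)| ≤ |s| * 1 := by gcongr; exact abs_if_le_one p
    _ ≤ C := by simpa using hs

lemma abs_mul_coord_le {s C : ℝ} (hs : |s| ≤ C) (x : Rn n) (m : Fin n) :
    |s * x m| ≤ C * ‖x‖ := by
  have := abs_nonneg s
  rw [abs_mul]
  exact mul_le_mul hs (abs_coord_le x m) (abs_nonneg _) (this.trans hs)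

/-- The zero order term `div(A∇ div X)`, `X = 2βA x`, grows at most linearly in `x`. The third
derivatives of the coefficients enter only here. -/
lemma abs_divA_dvg_le (ha : CoeffBounds lam Lam K δ a) (hb : ContDiff ℝ ∞ b) (hβ : 0 ≤ β)
    (z : ST n) :
    |divA ex (stA a) (dvg ex (gradA ex (stA a) (weight β α b))) z|
      ≤ β * (2 * n ^ 4 * (K + Lam) * K * (‖z.2‖ + 3)) := by
  rcases n.eq_zero_or_pos with hn | hn
  · subst hn; simp [divA]
  have i₀ : Fin n := ⟨0, hn⟩
  have hLam : 0 ≤ Lam := (abs_nonneg _).trans (ha.entry i₀ i₀ 0)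
  have hK : 0 ≤ K := (abs_nonneg _).trans (ha.deriv_one i₀ i₀ i₀ 0)
  have cf : ∀ l m, ContDiff ℝ 3 (fun y : ST n => a l m y.2) := fun l m => contDiff_stA ha l m
  have cd1 : ∀ l m i, ContDiff ℝ 2 (fun y : ST n => dd (stdVec i) (a l m) y.2) := fun l m i =>
    (contDiff_dd (ha.smooth l m) (by norm_num) _).comp contDiff_snd
  have cd2 : ∀ l m i j, ContDiff ℝ 1 (fun y : ST n => dd (stdVec j) (dd (stdVec i) (a l m)) y.2) :=
    fun l m i j => (contDiff_dd (m := 1) (contDiff_dd (m := 2) (ha.smooth l m) (by norm_num) _)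
      (by norm_num) _).comp contDiff_snd
  have df : ∀ l m, Differentiable ℝ (fun y : ST n => a l m y.2) := fun l m =>
    (cf l m).differentiable (by norm_num)
  have df1 : ∀ l m i, Differentiable ℝ (fun y : ST n => dd (stdVec i) (a l m) y.2) :=
    fun l m i => (cd1 l m i).differentiable (by norm_num)
  have df2 : ∀ l m i j,
      Differentiable ℝ (fun y : ST n => dd (stdVec j) (dd (stdVec i) (a l m)) y.2) :=
    fun l m i j => (cd2 l m i j).differentiable (by norm_num)
  have dc : ∀ m, Differentiable ℝ (fun y : ST n => y.2 m) := fun m => (coordX m).differentiable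
  have g0 : ∀ l m i, dd (ex i) (fun y : ST n => a l m y.2) = fun y => dd (stdVec i) (a l m) y.2 :=
    fun l m i => dd_ex_comp_snd ((ha.smooth l m).differentiable (by norm_num)) i
  have g1 : ∀ l m i j, dd (ex j) (fun y : ST n => dd (stdVec i) (a l m) y.2)
      = fun y => dd (stdVec j) (dd (stdVec i) (a l m)) y.2 := fun l m i j =>
    dd_ex_comp_snd ((contDiff_dd (m := 2) (ha.smooth l m) (by norm_num) _).differentiable
      (by norm_num)) j
  have g2 : ∀ l m i j k, dd (ex k) (fun y : ST n => dd (stdVec j) (dd (stdVec i) (a l m)) y.2)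
      = fun y => dd (stdVec k) (dd (stdVec j) (dd (stdVec i) (a l m))) y.2 := fun l m i j k =>
    dd_ex_comp_snd ((contDiff_dd (m := 1) (contDiff_dd (m := 2) (ha.smooth l m) (by norm_num) _)
      (by norm_num) _).differentiable (by norm_num)) k
  have hD : dvg ex (gradA ex (stA a) (weight β α b)) = fun y : ST n => 2 * β * ∑ l, ∑ m,
      (dd (stdVec l) (a l m) y.2 * y.2 m + a l m y.2 * (if m = l then 1 else 0)) := by
    funext y
    simp only [dvg, dd_ex_gradA ha hb, ← Finset.mul_sum, Finset.sum_add_distrib]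
    simp [add_comm]
  have dD0 : ∀ l m, Differentiable ℝ (fun y : ST n =>
      dd (stdVec l) (a l m) y.2 * y.2 m + a l m y.2 * (if m = l then 1 else 0)) :=
    fun l m => ((df1 _ _ _).fun_mul (dc m)).fun_add ((df l m).mul_const _)
  have hD1 : ∀ j, dd (ex j) (dvg ex (gradA ex (stA a) (weight β α b)))
      = fun y : ST n => 2 * β * ∑ l, ∑ m,
      (dd (stdVec j) (dd (stdVec l) (a l m)) y.2 * y.2 m
        + dd (stdVec l) (a l m) y.2 * (if m = j then 1 else 0)
        + dd (stdVec j) (a l m) y.2 * (if m = l then 1 else 0)) := by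
    intro j
    funext y
    rw [hD, dd_const_mul _ _ (Differentiable.fun_sum fun l _ =>
      Differentiable.fun_sum fun m _ => dD0 l m), dd_sum _ fun l =>
      Differentiable.fun_sum fun m _ => dD0 l m]
    congr 1
    refine Finset.sum_congr rfl fun l _ => ?_
    rw [dd_sum _ fun m => dD0 l m]
    refine Finset.sum_congr rfl fun m _ => ?_
    rw [dd_add _ ((df1 _ _ _).fun_mul (dc m)) ((df l m).mul_const _),
      dd_mul _ (df1 _ _ _) (dc m), dd_mul _ (df l m) (differentiable_const _), dd_coord_ex,
      g1, g0, dd_const]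
    ring
  have dD1 : ∀ j l m, Differentiable ℝ (fun y : ST n =>
      dd (stdVec j) (dd (stdVec l) (a l m)) y.2 * y.2 m
        + dd (stdVec l) (a l m) y.2 * (if m = j then 1 else 0)
        + dd (stdVec j) (a l m) y.2 * (if m = l then 1 else 0)) := fun j l m =>
    (((df2 _ _ _ _).fun_mul (dc m)).fun_add ((df1 _ _ _).mul_const _)).fun_add
      ((df1 _ _ _).mul_const _)
  have hD2 : ∀ k j, dd (ex k) (dd (ex j) (dvg ex (gradA ex (stA a) (weight β α b)))) z
      = 2 * β * ∑ l, ∑ m,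
      (dd (stdVec k) (dd (stdVec j) (dd (stdVec l) (a l m))) z.2 * z.2 m
        + dd (stdVec j) (dd (stdVec l) (a l m)) z.2 * (if m = k then 1 else 0)
        + dd (stdVec k) (dd (stdVec l) (a l m)) z.2 * (if m = j then 1 else 0)
        + dd (stdVec k) (dd (stdVec j) (a l m)) z.2 * (if m = l then 1 else 0)) := by
    intro k j
    rw [hD1, dd_const_mul _ _ (Differentiable.fun_sum fun l _ =>
      Differentiable.fun_sum fun m _ => dD1 j l m), dd_sum _ fun l =>
      Differentiable.fun_sum fun m _ => dD1 j l m]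
    congr 1
    refine Finset.sum_congr rfl fun l _ => ?_
    rw [dd_sum _ fun m => dD1 j l m]
    refine Finset.sum_congr rfl fun m _ => ?_
    rw [dd_add _ (((df2 _ _ _ _).fun_mul (dc m)).fun_add ((df1 _ _ _).mul_const _))
      ((df1 _ _ _).mul_const _), dd_add _ ((df2 _ _ _ _).fun_mul (dc m))
      ((df1 _ _ _).mul_const _), dd_mul _ (df2 _ _ _ _) (dc m),
      dd_mul _ (df1 _ _ _) (differentiable_const _), dd_mul _ (df1 _ _ _) (differentiable_const _),
      dd_coord_ex, g1, g1, g2, dd_const, dd_const]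
    ring
  have B1 : ∀ j, |dd (ex j) (dvg ex (gradA ex (stA a) (weight β α b))) z|
      ≤ 2 * β * (n * (n * (K * (‖z.2‖ + 3)))) := by
    intro j
    rw [hD1, abs_mul, abs_of_nonneg (by positivity : (0 : ℝ) ≤ 2 * β)]
    refine mul_le_mul_of_nonneg_left ?_ (by positivity)
    have := abs_sum_le_card_mul fun l => abs_sum_le_card_mul fun m => (show
      |dd (stdVec j) (dd (stdVec l) (a l m)) z.2 * z.2 m
        + dd (stdVec l) (a l m) z.2 * (if m = j then 1 else 0)
        + dd (stdVec j) (a l m) z.2 * (if m = l then 1 else 0)| ≤ K * (‖z.2‖ + 3) from ?_)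
    · simpa using this
    · have h1 := abs_mul_coord_le (ha.deriv_two l m l j z.2) z.2 m
      have h2 := abs_mul_ite_le (m = j) (ha.deriv_one l m l z.2)
      have h3 := abs_mul_ite_le (m = l) (ha.deriv_one l m j z.2)
      refine (abs_add_three _ _ _).trans ?_
      linarith
  have B2 : ∀ k j, |dd (ex k) (dd (ex j) (dvg ex (gradA ex (stA a) (weight β α b)))) z|
      ≤ 2 * β * (n * (n * (K * (‖z.2‖ + 3)))) := by
    intro k j
    rw [hD2, abs_mul, abs_of_nonneg (by positivity : (0 : ℝ) ≤ 2 * β)]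
    refine mul_le_mul_of_nonneg_left ?_ (by positivity)
    have := abs_sum_le_card_mul fun l => abs_sum_le_card_mul fun m => (show
      |dd (stdVec k) (dd (stdVec j) (dd (stdVec l) (a l m))) z.2 * z.2 m
        + dd (stdVec j) (dd (stdVec l) (a l m)) z.2 * (if m = k then 1 else 0)
        + dd (stdVec k) (dd (stdVec l) (a l m)) z.2 * (if m = j then 1 else 0)
        + dd (stdVec k) (dd (stdVec j) (a l m)) z.2 * (if m = l then 1 else 0)|
        ≤ K * (‖z.2‖ + 3) from ?_)
    · simpa using this
    · have h1 := abs_mul_coord_le (ha.deriv_three l m l j k z.2) z.2 m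
      have h2 := abs_mul_ite_le (m = k) (ha.deriv_two l m l j z.2)
      have h3 := abs_mul_ite_le (m = j) (ha.deriv_two l m l k z.2)
      have h4 := abs_mul_ite_le (m = l) (ha.deriv_two l m j k z.2)
      refine (abs_add_le _ _).trans ((add_le_add_left (abs_add_three _ _ _) _).trans ?_)
      linarith
  have cD1 : ∀ j, Differentiable ℝ (dd (ex j) (dvg ex (gradA ex (stA a) (weight β α b)))) := by
    intro j
    rw [hD1]
    exact (Differentiable.fun_sum fun l _ => Differentiable.fun_sum fun m _ => dD1 j l m).const_mul _
  have hE : divA ex (stA a) (dvg ex (gradA ex (stA a) (weight β α b))) z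
      = ∑ k, ∑ j, (dd (stdVec k) (a k j) z.2
          * dd (ex j) (dvg ex (gradA ex (stA a) (weight β α b))) z
        + a k j z.2 * dd (ex k) (dd (ex j) (dvg ex (gradA ex (stA a) (weight β α b)))) z) := by
    refine Finset.sum_congr rfl fun k _ => ?_
    simp only [stA]
    rw [dd_sum _ fun j => (df k j).fun_mul (cD1 j)]
    refine Finset.sum_congr rfl fun j _ => ?_
    rw [dd_mul _ (df k j) (cD1 j), g0]
  rw [hE]
  have := abs_sum_le_card_mul fun k => abs_sum_le_card_mul fun j => (show
    |dd (stdVec k) (a k j) z.2 * dd (ex j) (dvg ex (gradA ex (stA a) (weight β α b))) z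
        + a k j z.2 * dd (ex k) (dd (ex j) (dvg ex (gradA ex (stA a) (weight β α b)))) z|
      ≤ (K + Lam) * (2 * β * (n * (n * (K * (‖z.2‖ + 3))))) from ?_)
  · refine this.trans (le_of_eq ?_)
    simp only [Fintype.card_fin]; ring
  · refine (abs_add_le _ _).trans ?_
    rw [abs_mul, abs_mul, add_mul]
    exact add_le_add (mul_le_mul (ha.deriv_one k j k z.2) (B1 j) (abs_nonneg _) hK)
      (mul_le_mul (ha.entry k j z.2) (B2 k j) (abs_nonneg _) hLam)

/-- The commutator density for the weight `β|x|² + α b(t)`: the gradient terms are nonnegative,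
and the zero order term is bounded below by its part of order `β³|x|²`. -/
lemma commDensity_lower (ha : CoeffBounds lam Lam K δ a) (hlam : 0 < lam) (hLam : 0 ≤ Lam)
    (hsmall : 2 * (n : ℝ) ^ 4 * Lam * δ ≤ lam ^ 2) (hb : ContDiff ℝ ∞ b) (hβ : 0 ≤ β)
    (f : ST n → ℝ) (z : ST n) :
    (α * deriv (deriv b) z.1 + 16 * β ^ 3 * lam ^ 2 * ‖z.2‖ ^ 2
      - β * (2 * n ^ 4 * (K + Lam) * K * (‖z.2‖ + 3))) * f z ^ 2
    ≤ commDensity et ex (stA a) (gradA ex (stA a) (weight β α b))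
        (bil ex (stA a) (weight β α b) (weight β α b)) (dd et (weight β α b)) f z := by
  have hb' : Differentiable ℝ (deriv b) :=
    ((contDiff_infty_iff_deriv.mp hb).2).differentiable (by simp)
  have hbc : Differentiable ℝ (fun y : ST n => deriv b y.1) := hb'.comp differentiable_fst
  have h1 : dd et (dd et (weight β α b : ST n → ℝ)) z = α * deriv (deriv b) z.1 := by
    rw [dd_et_weight hb, dd_const_mul _ _ hbc, dd_comp_fst hb']
    simp [et]
  have h2 := (abs_le.mp (abs_divA_dvg_le (α := α) ha hb hβ z)).2
  have h3 : 16 * β ^ 3 * lam ^ 2 * ‖z.2‖ ^ 2 ≤ 2 * ∑ l, gradA ex (stA a) (weight β α b) l z *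
      dd (ex l) (bil ex (stA a) (weight β α b) (weight β α b)) z := by
    have := radial_term_lower hlam hLam hsmall (fun k j => a k j z.2)
      (fun l k j => dd (stdVec l) (a k j) z.2) z.2 (ha.elliptic _ _) (fun k j => ha.entry k j _)
      (fun l k j => ha.decay k j l _)
    have e : ∑ l, gradA ex (stA a) (weight β α b) l z *
        dd (ex l) (bil ex (stA a) (weight β α b) (weight β α b)) z
        = 8 * β ^ 3 * ∑ l, (∑ m, a l m z.2 * z.2 m) * (∑ k, ∑ j,
          dd (stdVec l) (a k j) z.2 * z.2 j * z.2 k + 2 * ∑ m, a l m z.2 * z.2 m) := by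
      rw [Finset.mul_sum]
      refine Finset.sum_congr rfl fun l _ => ?_
      rw [dd_ex_bil ha hb, gradA_weight hb]
      ring
    rw [e]
    have := mul_le_mul_of_nonneg_left this (by positivity : 0 ≤ 16 * β ^ 3)
    linarith
  have h4 := quadratic_form_nonneg hlam hLam hβ hsmall (fun k j => a k j z.2)
      (fun l k j => dd (stdVec l) (a k j) z.2) z.2 (WithLp.toLp 2 fun j => dd (ex j) f z)
      (fun k j => ha.symm k j _) (ha.elliptic _ _) (fun k j => ha.entry k j _)
      (fun l k j => ha.decay k j l _)
  have h5 : ∀ l k j, dd (ex l) (stA a k j) z = dd (stdVec l) (a k j) z.2 := fun l k j => by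
    rw [dd_ex_stA ha]
  simp only [commDensity, h1, dd_ex_gradA ha hb, h5]
  have h6 : ∀ l, gradA ex (stA a) (weight β α b) l z = 2 * β * ∑ m, a l m z.2 * z.2 m :=
    fun l => by rw [gradA_weight hb]
  simp only [stA] at h2 h3 h6 ⊢
  simp only [h6] at h3 ⊢
  have h7 := mul_le_mul_of_nonneg_right (add_le_add (add_le_add_right h3 (α * deriv (deriv b) z.1))
    (neg_le_neg h2)) (sq_nonneg (f z))
  simp only [] at h4
  linarith

end CommutatorBound

/-! ### Carleman inequality in a shell -/

section Carleman

variable {n : ℕ} {b : ℝ → ℝ} {lam Lam K δ ε Bb R : ℝ} {a : Fin n → Fin n → Rn n → ℝ}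

/-- The Carleman weight at scale `R`, `c R |x|² + c R³ b(t)`. -/
noncomputable abbrev weightR (c R : ℝ) (b : ℝ → ℝ) : ST n → ℝ := weight (c * R) (c * R ^ 3) b

/-- Carleman inequality for the Schrödinger operator in the shell `ε ≤ |x| ≤ R`. The constant
`c = (Bb + 1) / (lam ε)` makes the term `16 β³ lam² |x|²` dominate `α b''`: both are of order
`R³`. -/
theorem carleman_shell (ha : CoeffBounds lam Lam K δ a) (hlam : 0 < lam) (hLam : 0 ≤ Lam)
    (hsmall : 2 * (n : ℝ) ^ 4 * Lam * δ ≤ lam ^ 2) (hb : ContDiff ℝ ∞ b)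
    (hε : 0 < ε) (hBb : ∀ t, |deriv (deriv b) t| ≤ Bb) (hR1 : 1 ≤ R)
    (hR : 2 * n ^ 4 * (K + Lam) * K ≤ R)
    {c : ℝ} (hc : c = (Bb + 1) / (lam * ε))
    {g₁ g₂ : ST n → ℝ} (hg₁ : ContDiff ℝ ∞ g₁) (hg₂ : ContDiff ℝ ∞ g₂) {S : Set (ST n)}
    (hS : IsCompact S) (h₁ : ∀ z ∉ S, g₁ z = 0) (h₂ : ∀ z ∉ S, g₂ z = 0)
    (hSR : ∀ z ∈ S, ε ≤ ‖z.2‖ ∧ ‖z.2‖ ≤ R) :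
    c * R ^ 3 * ∫ z, Real.exp (weightR c R b z) ^ 2 * (g₁ z ^ 2 + g₂ z ^ 2)
      ≤ ∫ z, Real.exp (weightR c R b z) ^ 2 * ((divA ex (stA a) g₁ z - dd et g₂ z) ^ 2
        + (divA ex (stA a) g₂ z + dd et g₁ z) ^ 2) := by
  have hBb0 : 0 ≤ Bb := (abs_nonneg _).trans (hBb 0)
  have hc0 : 0 < c := by rw [hc]; positivity
  have hce : c * (lam * ε) = Bb + 1 := by rw [hc]; field_simp
  have : (volume : Measure (ST n)).IsAddHaarMeasure := by
    rw [Measure.volume_eq_prod]; infer_instance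
  refine carleman_of_commDensity (contDiff_stA ha) (fun k j z => ha.symm k j z.2)
    (fun k j z => dd_et_comp_snd ((ha.smooth k j).differentiable (by norm_num)) z)
    (contDiff_weight hb) (fun k z => ?_) hg₁ hg₂ hS h₁ h₂ fun z hz f => ?_
  · have hb' : Differentiable ℝ (deriv b) :=
      ((contDiff_infty_iff_deriv.mp hb).2).differentiable (by simp)
    have hbc : Differentiable ℝ (fun y : ST n => deriv b y.1) := hb'.comp differentiable_fst
    rw [dd_et_weight hb, dd_const_mul _ _ hbc, dd_comp_fst hb']
    simp [ex]
  · refine le_trans (mul_le_mul_of_nonneg_right ?_ (sq_nonneg _))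
      (commDensity_lower ha hlam hLam hsmall hb (by positivity) f z)
    obtain ⟨h3, h4⟩ := hSR z hz
    have b1 := (abs_le.mp (hBb z.1)).1
    have p1 : 16 * (c * R) ^ 3 * lam ^ 2 * ε ^ 2 ≤ 16 * (c * R) ^ 3 * lam ^ 2 * ‖z.2‖ ^ 2 := by
      gcongr
    have p2 : 16 * (c * R) ^ 3 * lam ^ 2 * ε ^ 2 = 16 * (c * R ^ 3) * (Bb + 1) ^ 2 := by
      rw [← hce]; ring
    have p3 : 16 * (c * R ^ 3) * (Bb + 1) ≤ 16 * (c * R ^ 3) * (Bb + 1) ^ 2 := by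
      have : Bb + 1 ≤ (Bb + 1) ^ 2 := by nlinarith
      gcongr
    have p4 : c * R * (2 * n ^ 4 * (K + Lam) * K * (‖z.2‖ + 3)) ≤ c * R * (R * (4 * R)) := by
      gcongr
      linarith
    have p5 : c * R ^ 3 * (-Bb) ≤ c * R ^ 3 * deriv (deriv b) z.1 := by gcongr
    have p6 : 0 ≤ c * R ^ 3 := by positivity
    have p7 : 0 ≤ c * R ^ 3 * Bb := by positivity
    nlinarith

end Carleman

/-! ### Oscillation at small scale in `L²` -/

section Mollification

open Filter Topology

variable {E : Type*} [NormedAddCommGroup E] [NormedSpace ℝ E] [MeasurableSpace E] [BorelSpace E]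
  [FiniteDimensional ℝ E] {μ : Measure E} [μ.IsAddHaarMeasure]

lemma tendsto_eLpNorm_translate_sub {h : E → ℝ} (hh : MemLp h 2 μ) :
    Tendsto (fun v : E => eLpNorm (fun z => h (z - v) - h z) 2 μ) (𝓝 0) (𝓝 0) := by
  have hc : Continuous (fun v : E => (⟨fun z => z - v, by fun_prop⟩ : C(E, E))) := by
    let F : C(E × E, E) := ⟨fun p => p.2 - p.1, by fun_prop⟩
    exact (F.curry).continuous
  have hm : ∀ v : E, MeasurePreserving (fun z : E => z - v) μ μ := fun v =>
    measurePreserving_sub_right μ v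
  have ht : Tendsto (fun v : E => Lp.compMeasurePreserving
      ((⟨fun z => z - v, by fun_prop⟩ : C(E, E)) : E → E) (hm v) hh.toLp) (𝓝 0)
      (𝓝 (Lp.compMeasurePreserving
        ((⟨fun z => z - 0, by fun_prop⟩ : C(E, E)) : E → E) (hm 0) hh.toLp)) :=
    tendsto_const_nhds.compMeasurePreservingLp (hc.tendsto 0) hm (hm 0) (by norm_num)
  have h0 : Lp.compMeasurePreserving ((⟨fun z => z - 0, by fun_prop⟩ : C(E, E)) : E → E) (hm 0)
      (hh.toLp h) = hh.toLp h := by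
    rw [Lp.toLp_compMeasurePreserving]
    congr 1
    funext z; simp
  rw [h0, Lp.tendsto_Lp_iff_tendsto_eLpNorm'] at ht
  refine ht.congr fun v => eLpNorm_congr_ae ?_
  rw [Lp.toLp_compMeasurePreserving]
  filter_upwards [(hh.comp_measurePreserving (hm v)).coeFn_toLp, hh.coeFn_toLp] with z h1 h2
  simp only [Pi.sub_apply]
  rw [h2]
  exact congrArg (· - h z) h1

lemma enn_add_sq_le (s t : ENNReal) : (s + t) ^ 2 ≤ 2 * s ^ 2 + 2 * t ^ 2 := by
  have := ENNReal.rpow_add_le_mul_rpow_add_rpow s t (p := 2) (by norm_num)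
  norm_num at this
  rwa [mul_add] at this

lemma lintegral_sq_le_measure_mul {α : Type*} [MeasurableSpace α] (ν : Measure α)
    {f : α → ENNReal} (hf : AEMeasurable f ν) :
    (∫⁻ x, f x ∂ν) ^ 2 ≤ ν univ * ∫⁻ x, f x ^ 2 ∂ν := by
  have := ENNReal.lintegral_mul_le_Lp_mul_Lq ν Real.HolderConjugate.two_two hf
    (aemeasurable_const (b := (1 : ENNReal)))
  simp only [Pi.mul_apply, mul_one, ENNReal.rpow_ofNat, one_pow, lintegral_one] at this
  calc (∫⁻ x, f x ∂ν) ^ 2 ≤ ((∫⁻ x, f x ^ 2 ∂ν) ^ (1 / 2 : ℝ) * ν univ ^ (1 / 2 : ℝ)) ^ 2 := by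
        gcongr
    _ = _ := by
        rw [mul_pow, ← ENNReal.rpow_natCast, ← ENNReal.rpow_natCast, ← ENNReal.rpow_mul,
          ← ENNReal.rpow_mul]
        norm_num
        rw [mul_comm]

/-- The average oscillation of `h` at scale `δ`. -/
noncomputable def avgDiff (μ : Measure E) (δ : ℝ) (h : E → ℝ) (z : E) : ENNReal :=
  ∫⁻ y in Metric.closedBall (0 : E) 1, ‖h (z - δ • y) - h z‖ₑ ∂μ

lemma measurable_diff_uncurry {h : E → ℝ} (hm : Measurable h) (δ : ℝ) :
    Measurable (Function.uncurry fun z y : E => ‖h (z - δ • y) - h z‖ₑ) := by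
  have h1 : Measurable fun p : E × E => p.1 - δ • p.2 := by fun_prop
  exact ((hm.comp h1).sub (hm.comp measurable_fst)).enorm

lemma measurable_avgDiff {h : E → ℝ} (hm : Measurable h) (δ : ℝ) :
    Measurable (avgDiff μ δ h) :=
  (measurable_diff_uncurry hm δ).lintegral_prod_right'

lemma tendsto_avgDiff {h : E → ℝ} (hm : Measurable h) (hh : MemLp h 2 μ) :
    Tendsto (fun δ : ℝ => ∫⁻ z, avgDiff μ δ h z ^ 2 ∂μ) (𝓝[>] 0) (𝓝 0) := by
  set c := μ (Metric.closedBall (0 : E) 1) with hc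
  have hc0 : c ≠ 0 := (Metric.measure_closedBall_pos μ _ one_pos).ne'
  have hct : c ≠ ⊤ := measure_closedBall_lt_top.ne
  have h1 : Tendsto (fun v : E => (eLpNorm (fun z => h (z - v) - h z) 2 μ) ^ 2 * (c * c)) (𝓝 0)
      (𝓝 0) := by
    have := ENNReal.Tendsto.mul_const (b := c * c)
      ((ENNReal.continuous_pow 2).tendsto 0 |>.comp (tendsto_eLpNorm_translate_sub hh))
      (Or.inr (ENNReal.mul_ne_top hct hct))
    simpa using this
  rw [ENNReal.tendsto_nhds_zero] at h1 ⊢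
  intro η hη
  obtain ⟨r, hr, hball⟩ := Metric.eventually_nhds_iff.mp (h1 η hη)
  filter_upwards [Ioo_mem_nhdsGT hr] with δ hδ
  have hsq : ∀ v : E, ∫⁻ z, ‖h (z - v) - h z‖ₑ ^ 2 ∂μ
      = (eLpNorm (fun z => h (z - v) - h z) 2 μ) ^ 2 := by
    intro v
    have := eLpNorm_nnreal_pow_eq_lintegral (p := 2) (μ := μ) (f := fun z => h (z - v) - h z)
      (by norm_num)
    simp only [NNReal.coe_ofNat, ENNReal.coe_ofNat, ENNReal.rpow_ofNat] at this
    exact this.symm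
  calc ∫⁻ z, avgDiff μ δ h z ^ 2 ∂μ
      ≤ ∫⁻ z, c * ∫⁻ y in Metric.closedBall (0 : E) 1, ‖h (z - δ • y) - h z‖ₑ ^ 2 ∂μ ∂μ := by
        refine lintegral_mono fun z => ?_
        have := lintegral_sq_le_measure_mul (μ.restrict (Metric.closedBall (0 : E) 1))
          (f := fun y => ‖h (z - δ • y) - h z‖ₑ)
          ((measurable_diff_uncurry hm δ).comp measurable_prodMk_left).aemeasurable
        rwa [Measure.restrict_apply_univ] at this
    _ = c * ∫⁻ y in Metric.closedBall (0 : E) 1, ∫⁻ z, ‖h (z - δ • y) - h z‖ₑ ^ 2 ∂μ ∂μ := by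
        rw [lintegral_const_mul' _ _ hct, lintegral_lintegral_swap]
        exact ((measurable_diff_uncurry hm δ).pow_const 2).aemeasurable
    _ ≤ c * ∫⁻ y in Metric.closedBall (0 : E) 1, η / c / c ∂μ := by
        refine mul_le_mul' le_rfl ?_
        refine setLIntegral_mono (g := fun _ => η / c / c) measurable_const fun y hy => ?_
        rw [hsq, ENNReal.le_div_iff_mul_le (Or.inl hc0) (Or.inl hct),
          ENNReal.le_div_iff_mul_le (Or.inl hc0) (Or.inl hct), mul_assoc]
        refine hball ?_
        rw [dist_zero_right, norm_smul, Real.norm_of_nonneg hδ.1.le]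
        have : ‖y‖ ≤ 1 := by simpa using hy
        nlinarith [hδ.1, hδ.2]
    _ = η := by
        rw [setLIntegral_const, ← hc, ENNReal.div_mul_cancel hc0 hct,
          ENNReal.mul_div_cancel hc0 hct]

lemma tendsto_eLpNorm_of_tendsto_lintegral_sq {α : Type*} [MeasurableSpace α] {ν : Measure α}
    {ι : Type*} {l : Filter ι} {F : ι → α → ℝ}
    (h : Tendsto (fun i => ∫⁻ x, ‖F i x‖ₑ ^ 2 ∂ν) l (𝓝 0)) :
    Tendsto (fun i => eLpNorm (F i) 2 ν) l (𝓝 0) := by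
  have h2 := ((ENNReal.continuous_rpow_const (y := (1 / 2 : ℝ))).tendsto 0).comp h
  have h0 : (0 : ENNReal) ^ (1 / 2 : ℝ) = 0 := by simp
  rw [h0] at h2
  refine h2.congr fun i => ?_
  rw [eLpNorm_eq_lintegral_rpow_enorm_toReal (by norm_num) (by norm_num)]
  simp

/-- A bounded kernel at scale `δ` with small mean is controlled by the average oscillation: subtract
the value `h z` under the integral. -/
lemma enorm_kernel_integral_le {h : E → ℝ} {k : E → ℝ} {B η δ : ℝ} (z : E)
    (hk : Continuous k) (hkB : ∀ y, |k y| ≤ B) (hk0 : ∀ y ∉ Metric.closedBall (0 : E) 1, k y = 0)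
    (hint : |∫ y, k y ∂μ| ≤ η) (hh : Integrable (fun y => h (z - δ • y)) μ) :
    ‖∫ y, k y * h (z - δ • y) ∂μ‖ₑ
      ≤ ENNReal.ofReal B * avgDiff μ δ h z + ENNReal.ofReal η * ‖h z‖ₑ := by
  have hki : Integrable k μ :=
    integrable_of_continuous_of_notMem hk (isCompact_closedBall 0 1) hk0
  have hkh : Integrable (fun y => k y * h (z - δ • y)) μ :=
    hh.bdd_mul (c := B) hk.aestronglyMeasurable (Eventually.of_forall fun y => by
      simpa using hkB y)
  have e : ∫ y, k y * h (z - δ • y) ∂μ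
      = ∫ y, k y * (h (z - δ • y) - h z) ∂μ + (∫ y, k y ∂μ) * h z := by
    rw [← integral_mul_const, ← integral_add _ (hki.mul_const _)]
    · exact integral_congr_ae (Eventually.of_forall fun y => by ring)
    · exact (hkh.sub (hki.mul_const (h z))).congr
        (Eventually.of_forall fun y => by simp only [Pi.sub_apply]; ring)
  rw [e]
  refine (enorm_add_le _ _).trans (add_le_add ?_ ?_)
  · refine (enorm_integral_le_lintegral_enorm _).trans ?_
    rw [avgDiff, ← lintegral_const_mul' _ _ ENNReal.ofReal_ne_top,
      ← lintegral_indicator Metric.isClosed_closedBall.measurableSet]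
    refine lintegral_mono fun y => ?_
    by_cases hy : y ∈ Metric.closedBall (0 : E) 1
    · rw [indicator_of_mem hy, enorm_mul]
      gcongr
      rw [← ofReal_norm]
      exact ENNReal.ofReal_le_ofReal (by simpa using hkB y)
    · simp [hk0 y hy]
  · rw [enorm_mul]
    gcongr
    rw [← ofReal_norm]
    exact ENNReal.ofReal_le_ofReal (by simpa using hint)

/-- Functions that are dominated, at scale `δ`, by the average oscillation of `h` up to an error
`O(δ)|h|` tend to zero in `L²`. -/
lemma tendsto_kernel_operator {h : E → ℝ} (hm : Measurable h) (hh : MemLp h 2 μ)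
    {T : ℝ → E → ℝ} {B C : ℝ}
    (hT : ∀ δ, 0 < δ → δ ≤ 1 → ∀ z,
      ‖T δ z‖ₑ ≤ ENNReal.ofReal B * avgDiff μ δ h z + ENNReal.ofReal (C * δ) * ‖h z‖ₑ) :
    Tendsto (fun δ : ℝ => eLpNorm (T δ) 2 μ) (𝓝[>] 0) (𝓝 0) := by
  apply tendsto_eLpNorm_of_tendsto_lintegral_sq
  have hN : ∫⁻ z, ‖h z‖ₑ ^ 2 ∂μ ≠ ⊤ := by
    have := eLpNorm_nnreal_pow_eq_lintegral (p := 2) (μ := μ) (f := h) (by norm_num)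
    simp only [NNReal.coe_ofNat, ENNReal.coe_ofNat, ENNReal.rpow_ofNat] at this
    rw [← this]
    exact ENNReal.pow_ne_top hh.2.ne
  have h1 : Tendsto (fun δ : ℝ => 2 * (ENNReal.ofReal B ^ 2 * ∫⁻ z, avgDiff μ δ h z ^ 2 ∂μ)
      + 2 * (ENNReal.ofReal (C * δ) ^ 2 * ∫⁻ z, ‖h z‖ₑ ^ 2 ∂μ)) (𝓝[>] 0) (𝓝 0) := by
    have a1 : Tendsto (fun δ : ℝ => 2 * (ENNReal.ofReal B ^ 2 * ∫⁻ z, avgDiff μ δ h z ^ 2 ∂μ))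
        (𝓝[>] 0) (𝓝 (2 * (ENNReal.ofReal B ^ 2 * 0))) :=
      ENNReal.Tendsto.const_mul (ENNReal.Tendsto.const_mul (tendsto_avgDiff hm hh)
        (Or.inr (by finiteness))) (Or.inr (by norm_num))
    have a2 : Tendsto (fun δ : ℝ => ENNReal.ofReal (C * δ) ^ 2) (𝓝[>] 0) (𝓝 0) := by
      have : Continuous fun δ : ℝ => ENNReal.ofReal (C * δ) ^ 2 :=
        (ENNReal.continuous_pow 2).comp (ENNReal.continuous_ofReal.comp (by fun_prop))
      have := (this.tendsto 0).mono_left (nhdsWithin_le_nhds (s := Ioi 0))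
      simpa using this
    have a3 : Tendsto (fun δ : ℝ => 2 * (ENNReal.ofReal (C * δ) ^ 2 * ∫⁻ z, ‖h z‖ₑ ^ 2 ∂μ))
        (𝓝[>] 0) (𝓝 (2 * (0 * ∫⁻ z, ‖h z‖ₑ ^ 2 ∂μ))) :=
      ENNReal.Tendsto.const_mul (ENNReal.Tendsto.mul_const a2 (Or.inr hN)) (Or.inr (by norm_num))
    simpa using a1.add a3
  refine tendsto_of_tendsto_of_tendsto_of_le_of_le' tendsto_const_nhds h1
    (Eventually.of_forall fun _ => bot_le) ?_
  filter_upwards [Ioc_mem_nhdsGT one_pos] with δ hδ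
  have hms := measurable_avgDiff (μ := μ) hm δ
  rw [← lintegral_const_mul' _ _ (by finiteness), ← lintegral_const_mul' _ _ (by finiteness),
    ← lintegral_const_mul' _ _ (by finiteness), ← lintegral_const_mul' _ _ (by finiteness),
    ← lintegral_add_left ((hms.pow_const 2).const_mul _ |>.const_mul _)]
  refine lintegral_mono fun z => ?_
  refine (pow_le_pow_left' (hT δ hδ.1 hδ.2 z) 2).trans ?_
  refine (enn_add_sq_le _ _).trans (le_of_eq ?_)
  rw [mul_pow, mul_pow]

end Mollification

/-! ### Mollifiers and Friedrichs' lemma -/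

section Friedrichs

open Filter Topology Module

variable {E : Type*} [NormedAddCommGroup E] [NormedSpace ℝ E] [MeasurableSpace E]
  {μ : Measure E}

/-- A smooth function supported in the unit ball with integral one. -/
structure IsMollifier (μ : Measure E) (ρ : E → ℝ) : Prop where
  smooth : ContDiff ℝ ∞ ρ
  zero : ∀ y ∉ Metric.closedBall (0 : E) 1, ρ y = 0
  integral : ∫ y, ρ y ∂μ = 1

/-- The mollifier at scale `δ`. -/
noncomputable def rescale (ρ : E → ℝ) (δ : ℝ) (v : E) : ℝ :=
  (δ ^ finrank ℝ E)⁻¹ * ρ (δ⁻¹ • v)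

/-- The mollification of `h` at scale `δ`. -/
noncomputable def moll (μ : Measure E) (ρ : E → ℝ) (δ : ℝ) (h : E → ℝ) (z : E) : ℝ :=
  ∫ w, h w * rescale ρ δ (z - w) ∂μ

variable {ρ : E → ℝ} {δ : ℝ}

lemma IsMollifier.contDiff_rescale (hρ : IsMollifier μ ρ) : ContDiff ℝ ∞ (rescale ρ δ) :=
  contDiff_const.mul (hρ.smooth.comp (contDiff_const_smul _))

lemma IsMollifier.rescale_eq_zero (hρ : IsMollifier μ ρ) (hδ : 0 < δ) {v : E}
    (hv : v ∉ Metric.closedBall (0 : E) δ) : rescale ρ δ v = 0 := by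
  rw [rescale, hρ.zero, mul_zero]
  simp only [Metric.mem_closedBall, dist_zero_right, not_le] at hv ⊢
  rw [norm_smul, norm_inv, Real.norm_of_nonneg hδ.le, ← div_eq_inv_mul, one_lt_div hδ]
  exact hv

lemma dd_rescale (hρ : IsMollifier μ ρ) (v x : E) :
    dd v (rescale ρ δ) x = (δ ^ finrank ℝ E)⁻¹ * (δ⁻¹ * dd v ρ (δ⁻¹ • x)) := by
  have hd : Differentiable ℝ ρ := hρ.smooth.differentiable (by simp)
  have h1 : HasFDerivAt (fun y : E => δ⁻¹ • y) (δ⁻¹ • ContinuousLinearMap.id ℝ E) x :=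
    (hasFDerivAt_id x).const_smul δ⁻¹
  have h2 := ((hd (δ⁻¹ • x)).hasFDerivAt.comp x h1).const_mul ((δ ^ finrank ℝ E)⁻¹)
  simp only [dd]
  have : rescale ρ δ = fun y => (δ ^ finrank ℝ E)⁻¹ * (ρ ∘ fun y => δ⁻¹ • y) y := rfl
  rw [this, h2.fderiv]
  simp

lemma moll_eq_convolution (h : E → ℝ) :
    moll μ ρ δ h = MeasureTheory.convolution h (rescale ρ δ) (ContinuousLinearMap.mul ℝ ℝ) μ := rfl

lemma IsMollifier.dd_zero (hρ : IsMollifier μ ρ) (v : E) :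
    ∀ y ∉ Metric.closedBall (0 : E) 1, dd v ρ y = 0 :=
  dd_eq_zero_of_notMem Metric.isClosed_closedBall hρ.zero v

lemma IsMollifier.smooth_dd (hρ : IsMollifier μ ρ) (v : E) : ContDiff ℝ ∞ (dd v ρ) :=
  contDiff_dd hρ.smooth (by simp) v

variable [FiniteDimensional ℝ E]

lemma IsMollifier.hasCompactSupport_rescale (hρ : IsMollifier μ ρ) (hδ : 0 < δ) :
    HasCompactSupport (rescale ρ δ) :=
  HasCompactSupport.intro (isCompact_closedBall (0 : E) δ) fun _ hv => hρ.rescale_eq_zero hδ hv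

lemma IsMollifier.exists_bound (hρ : IsMollifier μ ρ) : ∃ B, ∀ y, |ρ y| ≤ B := by
  obtain ⟨B, hB⟩ := (HasCompactSupport.intro (isCompact_closedBall (0 : E) 1)
    hρ.zero).exists_bound_of_continuous hρ.smooth.continuous
  exact ⟨B, hB⟩

lemma IsMollifier.exists_bound_dd (hρ : IsMollifier μ ρ) (v : E) : ∃ B, ∀ y, |dd v ρ y| ≤ B := by
  obtain ⟨B, hB⟩ := (HasCompactSupport.intro (isCompact_closedBall (0 : E) 1)
    (hρ.dd_zero v)).exists_bound_of_continuous (hρ.smooth_dd v).continuous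
  exact ⟨B, hB⟩

variable [BorelSpace E]

lemma IsMollifier.contDiff_moll (hρ : IsMollifier μ ρ) (hδ : 0 < δ) {h : E → ℝ}
    (hh : Integrable h μ) : ContDiff ℝ ∞ (moll μ ρ δ h) := by
  rw [moll_eq_convolution]
  exact (hρ.hasCompactSupport_rescale hδ).contDiff_convolution_right _ hh.locallyIntegrable
    hρ.contDiff_rescale

variable [μ.IsAddHaarMeasure]

lemma exists_isMollifier : ∃ ρ : E → ℝ, IsMollifier μ ρ := by
  let f : ContDiffBump (0 : E) := ⟨1 / 2, 1, by norm_num, by norm_num⟩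
  refine ⟨f.normed μ, f.contDiff_normed, fun y hy => ?_, f.integral_normed⟩
  have : y ∉ tsupport (f.normed μ) := by rwa [f.tsupport_normed_eq]
  exact image_eq_zero_of_notMem_tsupport this

lemma IsMollifier.dd_moll (hρ : IsMollifier μ ρ) (hδ : 0 < δ) {h : E → ℝ}
    (hh : Integrable h μ) (v z : E) :
    dd v (moll μ ρ δ h) z = ∫ w, h w * dd v (rescale ρ δ) (z - w) ∂μ := by
  have hc := hρ.hasCompactSupport_rescale hδ
  have hs : ContDiff ℝ 1 (rescale ρ δ) := hρ.contDiff_rescale.of_le ENat.LEInfty.out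
  rw [moll_eq_convolution, dd, (hc.hasFDerivAt_convolution_right (ContinuousLinearMap.mul ℝ ℝ)
    hh.locallyIntegrable hs z).fderiv, convolution_precompR_apply _ hh.locallyIntegrable
    (hc.fderiv ℝ) (hs.continuous_fderiv (by norm_num))]
  rfl

lemma integral_eq_integral_scaled (hδ : 0 < δ) (F : E → ℝ) (z : E) :
    ∫ w, F w ∂μ = ∫ y, δ ^ finrank ℝ E * F (z - δ • y) ∂μ := by
  rw [integral_const_mul,
    Measure.integral_comp_smul_of_nonneg μ (fun y => F (z - y)) δ (hR := hδ.le),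
    integral_sub_left_eq_self F μ z, smul_eq_mul, mul_inv_cancel_left₀ (by positivity)]

lemma integrable_scaled (hδ : 0 < δ) {h : E → ℝ} (hh : Integrable h μ) (z : E) :
    Integrable (fun y => h (z - δ • y)) μ :=
  (hh.comp_sub_left z).comp_smul hδ.ne'

lemma moll_eq_scaled (hδ : 0 < δ) (h : E → ℝ) (z : E) :
    moll μ ρ δ h z = ∫ y, ρ y * h (z - δ • y) ∂μ := by
  rw [moll, integral_eq_integral_scaled hδ _ z]
  refine integral_congr_ae (Eventually.of_forall fun y => ?_)
  simp only [rescale, sub_sub_cancel, smul_smul, inv_mul_cancel₀ hδ.ne', one_smul]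
  field_simp

lemma IsMollifier.tendsto_moll (hρ : IsMollifier μ ρ) {h : E → ℝ} (hm : Measurable h)
    (hh : MemLp h 2 μ) (hi : Integrable h μ) :
    Tendsto (fun δ : ℝ => eLpNorm (fun z => moll μ ρ δ h z - h z) 2 μ) (𝓝[>] 0) (𝓝 0) := by
  obtain ⟨B, hB⟩ := hρ.exists_bound
  refine tendsto_kernel_operator hm hh (B := B) (C := 0) fun δ hδ _ z => ?_
  have hρi : Integrable ρ μ := integrable_of_continuous_of_notMem hρ.smooth.continuous
    (isCompact_closedBall 0 1) hρ.zero
  have hsc := integrable_scaled hδ hi z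
  have e : moll μ ρ δ h z - h z = ∫ y, ρ y * (h (z - δ • y) - h z) ∂μ := by
    have h1 : Integrable (fun y => ρ y * h (z - δ • y)) μ :=
      hsc.bdd_mul (c := B) hρ.smooth.continuous.aestronglyMeasurable
        (Eventually.of_forall fun y => by simpa using hB y)
    simp only [mul_sub]
    rw [moll_eq_scaled hδ, integral_sub h1 (hρi.mul_const _), integral_mul_const, hρ.integral,
      one_mul]
  rw [e]
  simp only [zero_mul, ENNReal.ofReal_zero, add_zero]
  refine (enorm_integral_le_lintegral_enorm _).trans ?_
  rw [avgDiff, ← lintegral_const_mul' _ _ ENNReal.ofReal_ne_top,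
    ← lintegral_indicator Metric.isClosed_closedBall.measurableSet]
  refine lintegral_mono fun y => ?_
  by_cases hy : y ∈ Metric.closedBall (0 : E) 1
  · rw [indicator_of_mem hy, enorm_mul]
    gcongr
    rw [← ofReal_norm]
    exact ENNReal.ofReal_le_ofReal (by simpa using hB y)
  · simp [hρ.zero y hy]

/-- The commutator of multiplication by `a` and mollification, differentiated along `v`. -/
noncomputable def friedrichs (μ : Measure E) (ρ : E → ℝ) (a : E → ℝ) (v : E) (δ : ℝ) (h : E → ℝ)
    (z : E) : ℝ :=
  dd v (fun y => a y * moll μ ρ δ h y) z - dd v (moll μ ρ δ fun w => a w * h w) z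

/-- Friedrichs' lemma. After rescaling, the commutator has the kernel
`∂_v a(z) ρ(y) + δ⁻¹ (a(z) - a(z - δ y)) ∂_v ρ(y)`, which is bounded, and whose mean is `O(δ)`
because `∫ (∂_v a(z) ρ + (Da(z) y) ∂_v ρ) dy = 0`. -/
lemma IsMollifier.tendsto_friedrichs (hρ : IsMollifier μ ρ) {a : E → ℝ} (ha : ContDiff ℝ 1 a)
    {L : ℝ} (hL : ∀ z w, |a z - a w| ≤ L * ‖z - w‖)
    (hT : ∀ z w, |a z - a w - fderiv ℝ a z (z - w)| ≤ L * ‖z - w‖ ^ 2) (v : E)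
    (hLv : ∀ z, |dd v a z| ≤ L)
    {h : E → ℝ} (hm : Measurable h) (hh : MemLp h 2 μ) (hi : Integrable h μ)
    (hai : Integrable (fun w => a w * h w) μ) :
    Tendsto (fun δ : ℝ => eLpNorm (friedrichs μ ρ a v δ h) 2 μ) (𝓝[>] 0) (𝓝 0) := by
  obtain ⟨B, hB⟩ := hρ.exists_bound
  obtain ⟨B', hB'⟩ := hρ.exists_bound_dd v
  have hL0 : 0 ≤ L := (abs_nonneg _).trans (hLv 0)
  have hB0 : 0 ≤ B := (abs_nonneg _).trans (hB 0)
  have hB'0 : 0 ≤ B' := (abs_nonneg _).trans (hB' 0)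
  have hρi : Integrable ρ μ := integrable_of_continuous_of_notMem hρ.smooth.continuous
    (isCompact_closedBall 0 1) hρ.zero
  have hdρc := (hρ.smooth_dd v).continuous
  have hda : Differentiable ℝ a := ha.differentiable (by norm_num)
  refine tendsto_kernel_operator hm hh (B := L * B + L * B')
    (C := L * B' * μ.real (Metric.closedBall (0 : E) 1)) fun δ hδ hδ1 z => ?_
  set k : E → ℝ := fun y => dd v a z * ρ y + δ⁻¹ * (a z - a (z - δ • y)) * dd v ρ y with hk
  have hsc := integrable_scaled hδ hi z
  have hmoll : Differentiable ℝ (moll μ ρ δ h) := (hρ.contDiff_moll hδ hi).differentiable (by simp)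
  have e : friedrichs μ ρ a v δ h z = ∫ y, k y * h (z - δ • y) ∂μ := by
    have i1 : Integrable (fun y => ρ y * h (z - δ • y)) μ :=
      hsc.bdd_mul (c := B) hρ.smooth.continuous.aestronglyMeasurable
        (Eventually.of_forall fun y => by simpa using hB y)
    have i2 : Integrable (fun y => dd v ρ y * h (z - δ • y)) μ :=
      hsc.bdd_mul (c := B') hdρc.aestronglyMeasurable
        (Eventually.of_forall fun y => by simpa using hB' y)
    have i3 : Integrable (fun y => dd v ρ y * (a (z - δ • y) * h (z - δ • y))) μ :=
      (integrable_scaled hδ hai z).bdd_mul (c := B') hdρc.aestronglyMeasurable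
        (Eventually.of_forall fun y => by simpa using hB' y)
    have s : ∀ g : E → ℝ, Integrable g μ → dd v (moll μ ρ δ g) z
        = δ⁻¹ * ∫ y, dd v ρ y * g (z - δ • y) ∂μ := by
      intro g hg
      rw [hρ.dd_moll hδ hg, integral_eq_integral_scaled hδ _ z, ← integral_const_mul]
      refine integral_congr_ae (Eventually.of_forall fun y => ?_)
      simp only [dd_rescale hρ, sub_sub_cancel, smul_smul, inv_mul_cancel₀ hδ.ne', one_smul]
      field_simp
    have i4 : Integrable (fun y => dd v a z * (ρ y * h (z - δ • y))
        + a z * (δ⁻¹ * (dd v ρ y * h (z - δ • y)))) μ :=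
      (i1.const_mul _).add ((i2.const_mul _).const_mul _)
    rw [friedrichs, dd_mul _ hda hmoll, s h hi, s _ hai, moll_eq_scaled hδ,
      ← integral_const_mul, ← integral_const_mul, ← integral_const_mul, ← integral_const_mul,
      ← integral_add (i1.const_mul _) ((i2.const_mul _).const_mul _),
      ← integral_sub i4 (i3.const_mul _)]
    refine integral_congr_ae (Eventually.of_forall fun y => ?_)
    simp only [hk]; ring
  rw [e]
  have hkc : Continuous k := by
    have := ha.continuous
    have := hρ.smooth.continuous
    simp only [hk]
    fun_prop
  have hk0 : ∀ y ∉ Metric.closedBall (0 : E) 1, k y = 0 := fun y hy => by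
    simp [hk, hρ.zero y hy, hρ.dd_zero v y hy]
  refine enorm_kernel_integral_le z hkc (fun y => ?_) hk0 ?_ hsc
  · by_cases hy : y ∈ Metric.closedBall (0 : E) 1
    · have hy1 : ‖y‖ ≤ 1 := by simpa using hy
      have h1 : |δ⁻¹ * (a z - a (z - δ • y))| ≤ L := by
        rw [abs_mul, abs_of_pos (inv_pos.2 hδ), inv_mul_le_iff₀ hδ]
        refine (hL _ _).trans ?_
        rw [sub_sub_cancel, norm_smul, Real.norm_of_nonneg hδ.le]
        nlinarith [mul_le_mul_of_nonneg_left hy1 (mul_nonneg hL0 hδ.le)]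
      refine (abs_add_le _ _).trans (add_le_add ?_ ?_)
      · rw [abs_mul]; exact mul_le_mul (hLv z) (hB y) (abs_nonneg _) hL0
      · rw [abs_mul]; exact mul_le_mul h1 (hB' y) (abs_nonneg _) hL0
    · rw [hk0 y hy, abs_zero]; positivity
  · -- the leading part of the kernel is a divergence
    have hdiv : ∫ y, (dd v a z * ρ y + fderiv ℝ a z y * dd v ρ y) ∂μ = 0 := by
      have := (nullInt_dd (μ := μ) (F := fun y => fderiv ℝ a z y * ρ y)
        (((fderiv ℝ a z).contDiff).mul (hρ.smooth.of_le ENat.LEInfty.out))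
        (isCompact_closedBall 0 1) (fun y hy => by simp [hρ.zero y hy]) v).2
      rw [← this]
      refine integral_congr_ae (Eventually.of_forall fun y => ?_)
      simp only []
      rw [dd_mul _ (fderiv ℝ a z).differentiable (hρ.smooth.differentiable (by simp))]
      simp [dd]
    have hki : Integrable k μ := integrable_of_continuous_of_notMem hkc
      (isCompact_closedBall 0 1) hk0
    have hdi : Integrable (fun y => dd v a z * ρ y + fderiv ℝ a z y * dd v ρ y) μ := by
      refine integrable_of_continuous_of_notMem ?_ (isCompact_closedBall 0 1) fun y hy => by
        simp [hρ.zero y hy, hρ.dd_zero v y hy]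
      have := hρ.smooth.continuous
      fun_prop
    rw [← sub_zero (∫ y, k y ∂μ), ← hdiv, ← integral_sub hki hdi]
    rw [← setIntegral_eq_integral_of_forall_compl_eq_zero (s := Metric.closedBall (0 : E) 1)
      fun y hy => by simp [hk0 y hy, hρ.zero y hy, hρ.dd_zero v y hy]]
    have := norm_setIntegral_le_of_norm_le_const (μ := μ) (s := Metric.closedBall (0 : E) 1)
      (C := L * B' * δ) (f := fun y => k y - (dd v a z * ρ y + fderiv ℝ a z y * dd v ρ y))
      measure_closedBall_lt_top (fun y hy => ?_)
    · refine this.trans (le_of_eq ?_)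
      ring
    · have hy1 : ‖y‖ ≤ 1 := by simpa using hy
      have e2 : k y - (dd v a z * ρ y + fderiv ℝ a z y * dd v ρ y)
          = δ⁻¹ * (a z - a (z - δ • y) - fderiv ℝ a z (z - (z - δ • y))) * dd v ρ y := by
        rw [sub_sub_cancel, map_smul, smul_eq_mul]
        simp only [hk]; field_simp; ring
      have h1 : |δ⁻¹ * (a z - a (z - δ • y) - fderiv ℝ a z (z - (z - δ • y)))| ≤ L * δ := by
        rw [abs_mul, abs_of_pos (inv_pos.2 hδ), inv_mul_le_iff₀ hδ]
        refine (hT _ _).trans ?_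
        rw [sub_sub_cancel, norm_smul, Real.norm_of_nonneg hδ.le]
        have : ‖y‖ ^ 2 ≤ 1 := pow_le_one₀ (norm_nonneg _) hy1
        nlinarith [mul_le_mul_of_nonneg_left this (mul_nonneg hL0 (mul_nonneg hδ.le hδ.le))]
      rw [e2, Real.norm_eq_abs, abs_mul]
      calc _ ≤ L * δ * B' := mul_le_mul h1 (hB' y) (abs_nonneg _) (by positivity)
        _ = _ := by ring

end Friedrichs

/-! ### Families that tend to zero in `L²` -/

section L2Null

open Filter Topology

variable {α : Type*} [MeasurableSpace α] {ν : Measure α}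

/-- The family `d δ` tends to zero in `L²` as `δ → 0+`. -/
def L2Null (ν : Measure α) (d : ℝ → α → ℝ) : Prop :=
  (∀ᶠ δ in 𝓝[>] (0 : ℝ), AEStronglyMeasurable (d δ) ν) ∧
    Tendsto (fun δ => eLpNorm (d δ) 2 ν) (𝓝[>] 0) (𝓝 0)

lemma L2Null.add {d d' : ℝ → α → ℝ} (h : L2Null ν d) (h' : L2Null ν d') :
    L2Null ν (fun δ x => d δ x + d' δ x) := by
  refine ⟨?_, ?_⟩
  · filter_upwards [h.1, h'.1] with δ a b using a.add b
  · refine tendsto_of_tendsto_of_tendsto_of_le_of_le' tendsto_const_nhds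
      (by simpa using h.2.add h'.2) (Eventually.of_forall fun _ => bot_le) ?_
    filter_upwards [h.1, h'.1] with δ a b
    exact eLpNorm_add_le a b (by norm_num)

lemma L2Null.bdd_mul {d : ℝ → α → ℝ} (h : L2Null ν d) {c : α → ℝ} {C : ℝ}
    (hc : AEStronglyMeasurable c ν) (hC : ∀ x, |c x| ≤ C) :
    L2Null ν (fun δ x => c x * d δ x) := by
  refine ⟨?_, ?_⟩
  · filter_upwards [h.1] with δ a using hc.mul a
  · have h1 : Tendsto (fun δ => ENNReal.ofReal C * eLpNorm (d δ) 2 ν) (𝓝[>] 0) (𝓝 0) := by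
      simpa using ENNReal.Tendsto.const_mul h.2 (Or.inr (ENNReal.ofReal_ne_top (r := C)))
    refine tendsto_of_tendsto_of_tendsto_of_le_of_le tendsto_const_nhds h1
      (fun _ => bot_le) fun δ => ?_
    refine eLpNorm_le_mul_eLpNorm_of_ae_le_mul (Eventually.of_forall fun x => ?_) 2
    rw [norm_mul]
    exact mul_le_mul_of_nonneg_right (hC x) (norm_nonneg _)

lemma L2Null.zero : L2Null ν (fun _ _ => 0) :=
  ⟨Eventually.of_forall fun _ => aestronglyMeasurable_const, by simp⟩

lemma L2Null.neg {d : ℝ → α → ℝ} (h : L2Null ν d) : L2Null ν (fun δ x => -d δ x) := by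
  simpa using h.bdd_mul (c := fun _ => -1) (C := 1) aestronglyMeasurable_const (by simp)

lemma L2Null.sum {ι : Type*} {s : Finset ι} {d : ι → ℝ → α → ℝ} (h : ∀ i, L2Null ν (d i)) :
    L2Null ν (fun δ x => ∑ i ∈ s, d i δ x) := by
  classical
  induction s using Finset.induction_on with
  | empty => simpa using L2Null.zero
  | insert i s hi ih => simpa [Finset.sum_insert hi] using (h i).add ih

lemma L2Null.congr {d d' : ℝ → α → ℝ} (h : L2Null ν d) (hd : ∀ᶠ δ in 𝓝[>] (0 : ℝ), d δ = d' δ) :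
    L2Null ν d' := by
  refine ⟨?_, h.2.congr' ?_⟩
  · filter_upwards [h.1, hd] with δ a b using b ▸ a
  · filter_upwards [hd] with δ b; rw [b]

lemma L2Null.tendsto {F : ℝ → α → ℝ} {f : α → ℝ} (hf : AEStronglyMeasurable f ν)
    (h : L2Null ν (fun δ x => F δ x - f x)) :
    Tendsto (fun δ => eLpNorm (F δ) 2 ν) (𝓝[>] 0) (𝓝 (eLpNorm f 2 ν)) := by
  have up : Tendsto (fun δ => eLpNorm f 2 ν + eLpNorm (fun x => F δ x - f x) 2 ν) (𝓝[>] 0)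
      (𝓝 (eLpNorm f 2 ν)) := by simpa using (tendsto_const_nhds (x := eLpNorm f 2 ν)).add h.2
  have lo : Tendsto (fun δ => eLpNorm f 2 ν - eLpNorm (fun x => F δ x - f x) 2 ν) (𝓝[>] 0)
      (𝓝 (eLpNorm f 2 ν)) := by
    simpa using ENNReal.Tendsto.sub (tendsto_const_nhds (x := eLpNorm f 2 ν)) h.2
      (Or.inr (by norm_num))
  refine tendsto_of_tendsto_of_tendsto_of_le_of_le' lo up ?_ ?_
  · filter_upwards [h.1] with δ a
    have hF : AEStronglyMeasurable (F δ) ν := (a.add hf).congr (Eventually.of_forall fun x => by simp)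
    rw [tsub_le_iff_right]
    have := eLpNorm_sub_le hF a (p := 2) (by norm_num)
    refine le_trans (le_of_eq ?_) this
    congr 1; funext x; simp
  · filter_upwards [h.1] with δ a
    have := eLpNorm_add_le hf a (p := 2) (by norm_num)
    refine le_trans (le_of_eq ?_) this
    congr 1; funext x; simp

end L2Null

/-! ### Friedrichs commutators with the coefficients -/

section Limit

open Filter Topology

variable {n : ℕ}

instance instIsAddHaarMeasureST : (volume : Measure (ST n)).IsAddHaarMeasure := by
  rw [Measure.volume_eq_prod]; infer_instance

lemma eLpNorm_two_sq_add {f g : ST n → ℝ} {S : Set (ST n)} (hS : IsCompact S)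
    (hf : Continuous f) (hg : Continuous g) (hf0 : ∀ z ∉ S, f z = 0) (hg0 : ∀ z ∉ S, g z = 0) :
    eLpNorm f 2 volume ^ 2 + eLpNorm g 2 volume ^ 2
      = ENNReal.ofReal (∫ z, (f z ^ 2 + g z ^ 2)) := by
  have key : ∀ {h : ST n → ℝ}, Continuous h → (∀ z ∉ S, h z = 0) →
      eLpNorm h 2 volume ^ 2 = ENNReal.ofReal (∫ z, h z ^ 2) := by
    intro h hh h0
    have := eLpNorm_nnreal_pow_eq_lintegral (p := 2) (μ := (volume : Measure (ST n))) (f := h)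
      (by norm_num)
    simp only [NNReal.coe_ofNat, ENNReal.coe_ofNat, ENNReal.rpow_ofNat] at this
    rw [this, ofReal_integral_eq_lintegral_ofReal]
    · refine lintegral_congr fun z => ?_
      rw [← ofReal_norm, ← ENNReal.ofReal_pow (norm_nonneg _), Real.norm_eq_abs, sq_abs]
    · exact integrable_of_continuous_of_notMem (hh.pow 2) hS fun z hz => by simp [h0 z hz]
    · exact Eventually.of_forall fun z => sq_nonneg _
  rw [key hf hf0, key hg hg0, ← ENNReal.ofReal_add (integral_nonneg fun _ => sq_nonneg _)
    (integral_nonneg fun _ => sq_nonneg _), integral_add]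
  · exact integrable_of_continuous_of_notMem (hf.pow 2) hS fun z hz => by simp [hf0 z hz]
  · exact integrable_of_continuous_of_notMem (hg.pow 2) hS fun z hz => by simp [hg0 z hz]

/-- Integrable and square integrable functions on space-time, the class to which mollification is
applied. Measurability is strict, so that the average oscillation is measurable. -/
structure L1L2 (h : ST n → ℝ) : Prop where
  meas : Measurable h
  sq : MemLp h 2 volume
  int : Integrable h volume

lemma divA_mul {e : Fin n → ST n} {a : Fin n → Fin n → ST n → ℝ}
    (ha : ∀ k j, ContDiff ℝ 1 (a k j)) (hs : ∀ k j z, a k j z = a j k z) {ζ u : ST n → ℝ}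
    (hζ : ContDiff ℝ 2 ζ) (hu : ContDiff ℝ 2 u) (z : ST n) :
    divA e a (fun y => ζ y * u y) z
      = ζ z * divA e a u z + 2 * bil e a u ζ z + u z * divA e a ζ z := by
  have d1 : ∀ {f : ST n → ℝ}, ContDiff ℝ 1 f → Differentiable ℝ f :=
    fun hf => hf.differentiable (by norm_num)
  have dζ : Differentiable ℝ ζ := hζ.differentiable (by norm_num)
  have du : Differentiable ℝ u := hu.differentiable (by norm_num)
  have hfζ : ∀ k, Differentiable ℝ (fun y => ∑ j, a k j y * dd (e j) ζ y) :=
    fun k => d1 (contDiff_flux ha hζ (by norm_num) k)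
  have hfu : ∀ k, Differentiable ℝ (fun y => ∑ j, a k j y * dd (e j) u y) :=
    fun k => d1 (contDiff_flux ha hu (by norm_num) k)
  have h1 : ∀ k, (fun y => ∑ j, a k j y * dd (e j) (fun y => ζ y * u y) y)
      = fun y => ζ y * (∑ j, a k j y * dd (e j) u y) + u y * (∑ j, a k j y * dd (e j) ζ y) := by
    intro k
    funext y
    rw [Finset.mul_sum, Finset.mul_sum, ← Finset.sum_add_distrib]
    refine Finset.sum_congr rfl fun j _ => ?_
    rw [dd_mul _ dζ du]; ring
  have h2 : 2 * bil e a u ζ z = bil e a u ζ z + bil e a ζ u z := by rw [bil_comm hs ζ u]; ring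
  rw [h2]
  simp only [divA, bil, Finset.mul_sum, ← Finset.sum_add_distrib]
  refine Finset.sum_congr rfl fun k _ => ?_
  rw [h1, dd_add _ (dζ.fun_mul (hfu k)) (du.fun_mul (hfζ k)), dd_mul _ dζ (hfu k),
    dd_mul _ du (hfζ k), Finset.sum_add_distrib, ← Finset.sum_mul, ← Finset.sum_mul]
  ring

variable {lam Lam K δ : ℝ} {a : Fin n → Fin n → Rn n → ℝ}

lemma norm_le_card_mul_of_coord {L : Rn n →L[ℝ] ℝ} {C : ℝ} (hL : ∀ i, |L (stdVec i)| ≤ C)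
    (v : Rn n) : |L v| ≤ n * C * ‖v‖ := by
  have hv : v = ∑ i, v i • (stdVec i : Rn n) := by
    ext j
    simp [stdVec_apply]
  have h1 : L v = ∑ i, L (stdVec i) * v i := by
    conv_lhs => rw [hv, map_sum]
    exact Finset.sum_congr rfl fun i _ => by rw [map_smul, smul_eq_mul, mul_comm]
  rw [h1]
  refine (abs_sum_le_card_mul fun i => abs_mul_coord_le (hL i) v i).trans (le_of_eq ?_)
  rw [Fintype.card_fin]; ring

lemma abs_sub_le_of_dd_le {F : Rn n → ℝ} (hF : Differentiable ℝ F) {C : ℝ} (hC0 : 0 ≤ C)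
    (hC : ∀ i x, |dd (stdVec i) F x| ≤ C) (x y : Rn n) : |F x - F y| ≤ n * C * ‖x - y‖ := by
  have := convex_univ.norm_image_sub_le_of_norm_fderiv_le (𝕜 := ℝ) (f := F) (C := n * C)
    (fun z _ => hF z) (fun z _ => ContinuousLinearMap.opNorm_le_bound _ (by positivity)
      fun v => norm_le_card_mul_of_coord (L := fderiv ℝ F z) (fun i => hC i z) v)
    (mem_univ y) (mem_univ x)
  simpa using this

lemma tendsto_friedrichs_coeff (ha : CoeffBounds lam Lam K δ a) (hK0 : 0 ≤ K)
    {ρ : ST n → ℝ} (hρ : IsMollifier volume ρ) (k j l : Fin n) {h : ST n → ℝ} (hh : L1L2 h)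
    (hai : Integrable (fun w => stA a k j w * h w)) :
    Tendsto (fun δ : ℝ => eLpNorm (friedrichs volume ρ (stA a k j) (ex l) δ h) 2 volume)
      (𝓝[>] 0) (𝓝 0) := by
  have hd : Differentiable ℝ (a k j) := (ha.smooth k j).differentiable (by norm_num)
  have hd1 : ∀ i, Differentiable ℝ (dd (stdVec i) (a k j)) := fun i =>
    (contDiff_dd (m := 2) (ha.smooth k j) (by norm_num) _).differentiable (by norm_num)
  have fsnd : ∀ z v : ST n, fderiv ℝ (stA a k j) z v = fderiv ℝ (a k j) z.2 v.2 := fun z v =>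
    dd_comp_snd hd v z
  have hsnd : ∀ z : ST n, ‖z.2‖ ≤ ‖z‖ := fun z => norm_snd_le z
  have n0 : (0 : ℝ) ≤ n := Nat.cast_nonneg n
  have lip := abs_sub_le_of_dd_le hd hK0 (ha.deriv_one k j)
  refine hρ.tendsto_friedrichs (L := n * K + n * (n * K) + K)
    ((contDiff_stA ha k j).of_le (by norm_num)) (fun z w => ?_) (fun z w => ?_) (ex l)
    (fun z => ?_) hh.meas hh.sq hh.int hai
  · refine (lip z.2 w.2).trans ?_
    have := hsnd (z - w)
    have h2 : 0 ≤ n * (n * K) + K := by positivity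
    calc n * K * ‖z.2 - w.2‖ ≤ n * K * ‖z - w‖ := by gcongr; exact this
      _ ≤ _ := by nlinarith [norm_nonneg (z - w)]
  · rw [fsnd]
    have hseg := (convex_segment z.2 w.2).norm_image_sub_le_of_norm_hasFDerivWithin_le
      (f := fun y => a k j y - fderiv ℝ (a k j) z.2 y)
      (f' := fun y => fderiv ℝ (a k j) y - fderiv ℝ (a k j) z.2)
      (C := n * (n * K * ‖z.2 - w.2‖)) (fun y _ => by
        exact ((hd y).hasFDerivAt.sub (fderiv ℝ (a k j) z.2).hasFDerivAt).hasFDerivWithinAt)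
      (fun y hy => ContinuousLinearMap.opNorm_le_bound _ (by positivity) fun v => by
        refine norm_le_card_mul_of_coord (fun i => ?_) v
        have h1 := abs_sub_le_of_dd_le (hd1 i) hK0 (fun i' x => ha.deriv_two k j i i' x) y z.2
        have h2 : ‖y - z.2‖ ≤ ‖z.2 - w.2‖ := by
          have h3 := norm_sub_le_of_mem_segment hy
          rwa [norm_sub_rev w.2] at h3
        calc _ ≤ n * K * ‖y - z.2‖ := h1
          _ ≤ _ := by gcongr) (right_mem_segment ℝ _ _) (left_mem_segment ℝ _ _)
    have e : stA a k j z - stA a k j w - fderiv ℝ (a k j) z.2 (z - w).2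
        = (a k j z.2 - fderiv ℝ (a k j) z.2 z.2) - (a k j w.2 - fderiv ℝ (a k j) z.2 w.2) := by
      simp only [stA, Prod.snd_sub, map_sub]; ring
    rw [e]
    refine hseg.trans ?_
    have h4 : ‖z.2 - w.2‖ ≤ ‖z - w‖ := hsnd (z - w)
    have h2 : 0 ≤ n * K + K := by positivity
    calc n * (n * K * ‖z.2 - w.2‖) * ‖z.2 - w.2‖ = n * (n * K) * ‖z.2 - w.2‖ ^ 2 := by ring
      _ ≤ n * (n * K) * ‖z - w‖ ^ 2 := by gcongr
      _ ≤ _ := by nlinarith [sq_nonneg ‖z - w‖]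
  · rw [dd_ex_stA ha]
    refine (ha.deriv_one k j l z.2).trans ?_
    have : 0 ≤ n * K + n * (n * K) := by positivity
    linarith

end Limit

/-! ### Carleman inequality for cut off weak solutions -/

section CutoffLimit

open Filter Topology

variable {n : ℕ} {lam Lam K : ℝ} {a : Fin n → Fin n → Rn n → ℝ}

/-- The real part `ζ, U, V, G, W ↦ -ζ W + 2 A∇ζ·G + U div(A∇ζ) - ζ_t V` of the Schrödinger
operator applied to `ζ u`, where `U, V` are the real and imaginary parts of `u`, `G` is the
gradient of `U`, and `W` is the real part of the potential term. The imaginary part has the same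
form, with `V = -Re u`. -/
noncomputable def cutoffTerm (a : Fin n → Fin n → Rn n → ℝ) (ζ U V : ST n → ℝ)
    (G : Fin n → ST n → ℝ) (W : ST n → ℝ) (z : ST n) : ℝ :=
  -(ζ z * W z) + 2 * ∑ k, ∑ j, stA a k j z * G j z * dd (ex k) ζ z
    + U z * divA ex (stA a) ζ z - dd et ζ z * V z

lemma CoeffBounds.integrable_mul {δ : ℝ} (ha : CoeffBounds lam Lam K δ a) (k j : Fin n)
    {h : ST n → ℝ} (hh : L1L2 h) : Integrable (fun w => stA a k j w * h w) :=
  hh.int.bdd_mul (c := Lam) (contDiff_stA ha k j).continuous.aestronglyMeasurable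
    (Eventually.of_forall fun z => by simpa [stA] using ha.entry k j z.2)

lemma exists_abs_le_of_continuous_of_notMem {c : ST n → ℝ} (hc : Continuous c) {S : Set (ST n)}
    (hS : IsCompact S) (h0 : ∀ z ∉ S, c z = 0) : ∃ C, ∀ z, |c z| ≤ C := by
  obtain ⟨C, hC⟩ := (HasCompactSupport.intro hS h0).exists_bound_of_continuous hc
  exact ⟨C, hC⟩

lemma L2Null.continuous_mul {d : ℝ → ST n → ℝ} (h : L2Null volume d) {c : ST n → ℝ}
    (hc : Continuous c) {S : Set (ST n)} (hS : IsCompact S) (h0 : ∀ z ∉ S, c z = 0) :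
    L2Null volume (fun δ x => c x * d δ x) := by
  obtain ⟨C, hC⟩ := exists_abs_le_of_continuous_of_notMem hc hS h0
  exact h.bdd_mul hc.aestronglyMeasurable hC

lemma IsMollifier.l2Null {ρ : ST n → ℝ} (hρ : IsMollifier volume ρ) {h : ST n → ℝ} (hh : L1L2 h) :
    L2Null volume (fun δ z => moll volume ρ δ h z - h z) := by
  refine ⟨?_, hρ.tendsto_moll hh.meas hh.sq hh.int⟩
  filter_upwards [self_mem_nhdsWithin] with δ hδ
  exact (hρ.contDiff_moll hδ hh.int).continuous.aestronglyMeasurable.sub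
    hh.meas.aestronglyMeasurable

lemma IsMollifier.l2Null_friedrichs {δ₀ : ℝ} (ha : CoeffBounds lam Lam K δ₀ a) (hK0 : 0 ≤ K)
    {ρ : ST n → ℝ} (hρ : IsMollifier volume ρ) (k j l : Fin n) {h : ST n → ℝ} (hh : L1L2 h) :
    L2Null volume (fun δ z => friedrichs volume ρ (stA a k j) (ex l) δ h z) := by
  refine ⟨?_, tendsto_friedrichs_coeff ha hK0 hρ k j l hh (ha.integrable_mul k j hh)⟩
  filter_upwards [self_mem_nhdsWithin] with δ hδ
  have h1 : ContDiff ℝ 3 (fun y => stA a k j y * moll volume ρ δ h y) :=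
    (contDiff_stA ha k j).mul ((hρ.contDiff_moll hδ hh.int).of_le ENat.LEInfty.out)
  have h2 := hρ.contDiff_moll hδ (ha.integrable_mul k j hh)
  exact ((contDiff_dd (m := 0) h1 (by norm_num) _).continuous.sub
    (contDiff_dd (m := 0) h2 (by simp) _).continuous).aestronglyMeasurable

/-- The cutoff equation for the mollified solution: on the open set `O`, where the mollified
functions satisfy the equation up to Friedrichs commutators, the real part of the operator
applied to `ζ u_δ`. -/
lemma divA_cutoff_moll {δ₀ δ : ℝ} (ha : CoeffBounds lam Lam K δ₀ a)
    {ρ : ST n → ℝ} (hρ : IsMollifier volume ρ) (hδ : 0 < δ) {U V W : ST n → ℝ}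
    {G : Fin n → ST n → ℝ} (hU : L1L2 U) (hV : L1L2 V) (hG : ∀ j, L1L2 (G j))
    {O : Set (ST n)} (hO : IsOpen O)
    (hx : ∀ z ∈ O, ∀ j, dd (ex j) (moll volume ρ δ U) z = moll volume ρ δ (G j) z)
    (ht : ∀ z ∈ O, dd et (moll volume ρ δ V) z
      = ∑ k, ∑ j, dd (ex k) (moll volume ρ δ fun w => stA a k j w * G j w) z
        + moll volume ρ δ W z)
    {ζ : ST n → ℝ} (hζ : ContDiff ℝ ∞ ζ) (hζ0 : ∀ z ∉ O, ζ =ᶠ[𝓝 z] 0) (z : ST n) :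
    divA ex (stA a) (fun y => ζ y * moll volume ρ δ U y) z
        - dd et (fun y => ζ y * moll volume ρ δ V y) z
      = ζ z * ∑ k, ∑ j, friedrichs volume ρ (stA a k j) (ex k) δ (G j) z
        + cutoffTerm a ζ (moll volume ρ δ U) (moll volume ρ δ V)
          (fun j => moll volume ρ δ (G j)) (moll volume ρ δ W) z := by
  have mU := hρ.contDiff_moll hδ hU.int
  have mV := hρ.contDiff_moll hδ hV.int
  have ha1 : ∀ k j, ContDiff ℝ 1 (stA a k j) := fun k j => (contDiff_stA ha k j).of_le (by norm_num)
  by_cases hz : z ∈ O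
  · rw [divA_mul ha1 (fun k j z => ha.symm k j z.2) (hζ.of_le ENat.LEInfty.out)
      (mU.of_le ENat.LEInfty.out), dd_mul _ (hζ.differentiable (by simp))
      (mV.differentiable (by simp)), ht z hz]
    have h1 : divA ex (stA a) (moll volume ρ δ U) z
        = ∑ k, ∑ j, dd (ex k) (fun y => stA a k j y * moll volume ρ δ (G j) y) z := by
      refine Finset.sum_congr rfl fun k _ => ?_
      have : (fun y => ∑ j, stA a k j y * dd (ex j) (moll volume ρ δ U) y)
          =ᶠ[𝓝 z] fun y => ∑ j, stA a k j y * moll volume ρ δ (G j) y := by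
        filter_upwards [hO.mem_nhds hz] with y hy
        exact Finset.sum_congr rfl fun j _ => by rw [hx y hy]
      rw [dd, this.fderiv_eq]
      exact dd_sum _ (fun j => ((ha1 k j).differentiable (by norm_num)).fun_mul
        ((hρ.contDiff_moll hδ (hG j).int).differentiable (by simp))) z
    have h2 : bil ex (stA a) (moll volume ρ δ U) ζ z
        = ∑ k, ∑ j, stA a k j z * moll volume ρ δ (G j) z * dd (ex k) ζ z :=
      Finset.sum_congr rfl fun k _ => Finset.sum_congr rfl fun j _ => by rw [hx z hz]
    rw [h1, h2]
    simp only [friedrichs, cutoffTerm, Finset.sum_sub_distrib]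
    ring
  · have h0 := hζ0 z hz
    have hζz : ζ z = 0 := h0.self_of_nhds
    have hd : ∀ v, dd v ζ =ᶠ[𝓝 z] 0 := by
      intro v
      filter_upwards [eventually_eventually_nhds.mpr h0] with y hy
      have : ζ =ᶠ[𝓝 y] fun _ => 0 := hy
      simp [dd, this.fderiv_eq]
    have hL : divA ex (stA a) ζ z = 0 := by
      refine Finset.sum_eq_zero fun k _ => ?_
      have : (fun y => ∑ j, stA a k j y * dd (ex j) ζ y) =ᶠ[𝓝 z] fun _ => 0 := by
        filter_upwards [eventually_all.mpr fun j => hd (ex j)] with y hy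
        exact Finset.sum_eq_zero fun j _ => by rw [hy j]; simp
      rw [dd, this.fderiv_eq]
      simp
    rw [divA_mul ha1 (fun k j z => ha.symm k j z.2) (hζ.of_le ENat.LEInfty.out)
      (mU.of_le ENat.LEInfty.out), dd_mul _ (hζ.differentiable (by simp))
      (mV.differentiable (by simp))]
    simp [cutoffTerm, bil, hζz, hL, (hd _).self_of_nhds]

/-- Passage to the limit in a Carleman inequality applied to the cut off mollified solution. -/
lemma carleman_limit {δ₀ κ : ℝ} (ha : CoeffBounds lam Lam K δ₀ a) (hK0 : 0 ≤ K) (hκ : 0 ≤ κ)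
    {ρ : ST n → ℝ} (hρ : IsMollifier volume ρ)
    {U₁ U₂ W₁ W₂ : ST n → ℝ} {G₁ G₂ : Fin n → ST n → ℝ} (hU₁ : L1L2 U₁) (hU₂ : L1L2 U₂)
    (hW₁ : L1L2 W₁) (hW₂ : L1L2 W₂) (hG₁ : ∀ j, L1L2 (G₁ j)) (hG₂ : ∀ j, L1L2 (G₂ j))
    {O S : Set (ST n)} (hO : IsOpen O) (hS : IsCompact S) (hSO : S ⊆ O)
    (hx : ∀ᶠ δ in 𝓝[>] (0 : ℝ), ∀ z ∈ O, ∀ j,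
      dd (ex j) (moll volume ρ δ U₁) z = moll volume ρ δ (G₁ j) z
      ∧ dd (ex j) (moll volume ρ δ U₂) z = moll volume ρ δ (G₂ j) z)
    (ht : ∀ᶠ δ in 𝓝[>] (0 : ℝ), ∀ z ∈ O,
      dd et (moll volume ρ δ U₂) z
        = ∑ k, ∑ j, dd (ex k) (moll volume ρ δ fun w => stA a k j w * G₁ j w) z
          + moll volume ρ δ W₁ z
      ∧ -dd et (moll volume ρ δ U₁) z
        = ∑ k, ∑ j, dd (ex k) (moll volume ρ δ fun w => stA a k j w * G₂ j w) z
          + moll volume ρ δ W₂ z)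
    {ζ w : ST n → ℝ} (hζ : ContDiff ℝ ∞ ζ) (hζ0 : ∀ z ∉ S, ζ z = 0) (hw : Continuous w)
    (hcarl : ∀ g₁ g₂ : ST n → ℝ, ContDiff ℝ ∞ g₁ → ContDiff ℝ ∞ g₂ → (∀ z ∉ S, g₁ z = 0) →
      (∀ z ∉ S, g₂ z = 0) →
      κ * ∫ z, w z ^ 2 * (g₁ z ^ 2 + g₂ z ^ 2)
        ≤ ∫ z, w z ^ 2 * ((divA ex (stA a) g₁ z - dd et g₂ z) ^ 2
          + (divA ex (stA a) g₂ z + dd et g₁ z) ^ 2)) :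
    ENNReal.ofReal κ * (eLpNorm (fun z => w z * (ζ z * U₁ z)) 2 volume ^ 2
        + eLpNorm (fun z => w z * (ζ z * U₂ z)) 2 volume ^ 2)
      ≤ eLpNorm (fun z => w z * cutoffTerm a ζ U₁ U₂ G₁ W₁ z) 2 volume ^ 2
        + eLpNorm (fun z => w z * cutoffTerm a ζ U₂ (fun z => -U₁ z) G₂ W₂ z) 2 volume ^ 2 := by
  have ha1 : ∀ k j, ContDiff ℝ 1 (stA a k j) := fun k j => (contDiff_stA ha k j).of_le (by norm_num)
  have hSc := hS.isClosed
  have hdζ : ∀ v, ContDiff ℝ ∞ (dd v ζ) := fun v => contDiff_dd hζ (by simp) v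
  have hdζ0 : ∀ v, ∀ z ∉ S, dd v ζ z = 0 := dd_eq_zero_of_notMem hSc hζ0
  have hLζ : Continuous (divA ex (stA a) ζ) :=
    (contDiff_divA (m := 0) (r := 1) (l := 2) ha1 (hζ.of_le ENat.LEInfty.out) (by norm_num)
      (by norm_num)).continuous
  have hLζ0 : ∀ z ∉ S, divA ex (stA a) ζ z = 0 := by
    intro z hz
    refine Finset.sum_eq_zero fun k _ => dd_eq_zero_of_notMem hSc (fun y hy => ?_) _ z hz
    exact Finset.sum_eq_zero fun j _ => by rw [hdζ0 _ y hy, mul_zero]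
  have hζO : ∀ z ∉ O, ζ =ᶠ[𝓝 z] 0 := by
    intro z hz
    filter_upwards [hSc.isOpen_compl.mem_nhds fun h => hz (hSO h)] with y hy using hζ0 y hy
  -- convergence of the left-hand sides
  have lhs : ∀ {U : ST n → ℝ}, L1L2 U → Tendsto
      (fun δ => eLpNorm (fun z => w z * (ζ z * moll volume ρ δ U z)) 2 volume) (𝓝[>] 0)
      (𝓝 (eLpNorm (fun z => w z * (ζ z * U z)) 2 volume)) := by
    intro U hU
    refine L2Null.tendsto ?_ ?_
    · exact hw.aestronglyMeasurable.mul
        (hζ.continuous.aestronglyMeasurable.mul hU.meas.aestronglyMeasurable)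
    · refine ((hρ.l2Null hU).continuous_mul (hw.mul hζ.continuous) hS
        (fun z hz => by simp [hζ0 z hz])).congr (Eventually.of_forall fun δ => ?_)
      funext z; simp only [Pi.mul_apply]; ring
  -- convergence of the right-hand sides
  have rhs : ∀ {U V W : ST n → ℝ} {G : Fin n → ST n → ℝ}, L1L2 U → L1L2 V → L1L2 W →
      (∀ j, L1L2 (G j)) → Tendsto
      (fun δ => eLpNorm (fun z => w z *
        (ζ z * ∑ k, ∑ j, friedrichs volume ρ (stA a k j) (ex k) δ (G j) z
        + cutoffTerm a ζ (moll volume ρ δ U) (moll volume ρ δ V)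
          (fun j => moll volume ρ δ (G j)) (moll volume ρ δ W) z)) 2 volume) (𝓝[>] 0)
      (𝓝 (eLpNorm (fun z => w z * cutoffTerm a ζ U V G W z) 2 volume)) := by
    intro U V W G hU hV hW hG
    refine L2Null.tendsto ?_ ?_
    · have m1 : Measurable (cutoffTerm a ζ U V G W) := by
        unfold cutoffTerm
        have h1 := hζ.continuous.measurable
        have h2 := hLζ.measurable
        have h3 := fun v => (hdζ v).continuous.measurable
        have h4 := fun k j => (ha1 k j).continuous.measurable
        have h5 := fun j => (hG j).meas
        have := hU.meas
        have := hV.meas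
        have := hW.meas
        fun_prop
      exact hw.aestronglyMeasurable.mul m1.aestronglyMeasurable
    · have n1 : L2Null volume (fun δ z => ∑ k, ∑ j,
          friedrichs volume ρ (stA a k j) (ex k) δ (G j) z) :=
        L2Null.sum fun k => L2Null.sum fun j => hρ.l2Null_friedrichs ha hK0 k j k (hG j)
      have n1' := n1.continuous_mul (hw.mul hζ.continuous) hS (fun z hz => by simp [hζ0 z hz])
      have n2 := ((hρ.l2Null hW).continuous_mul (hw.mul hζ.continuous) hS
        (fun z hz => by simp [hζ0 z hz])).neg
      have n3 : L2Null volume (fun δ z => ∑ k, ∑ j,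
          (2 * (w z * stA a k j z * dd (ex k) ζ z)) *
            (moll volume ρ δ (G j) z - G j z)) :=
        L2Null.sum fun k => L2Null.sum fun j => (hρ.l2Null (hG j)).continuous_mul
          (continuous_const.mul ((hw.mul (ha1 k j).continuous).mul (hdζ _).continuous)) hS
          (fun z hz => by simp [hdζ0 _ z hz])
      have n4 := (hρ.l2Null hU).continuous_mul (hw.mul hLζ) hS (fun z hz => by simp [hLζ0 z hz])
      have n5 := ((hρ.l2Null hV).continuous_mul (hw.mul (hdζ et).continuous) hS
        (fun z hz => by simp [hdζ0 _ z hz])).neg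
      refine ((((n1'.add n2).add n3).add n4).add n5).congr (Eventually.of_forall fun δ => ?_)
      funext z
      have e : ∑ k, ∑ j, (2 * (w z * stA a k j z * dd (ex k) ζ z)) *
            (moll volume ρ δ (G j) z - G j z)
          = w z * (2 * ∑ k, ∑ j, stA a k j z * moll volume ρ δ (G j) z * dd (ex k) ζ z
            - 2 * ∑ k, ∑ j, stA a k j z * G j z * dd (ex k) ζ z) := by
        simp only [Finset.mul_sum, ← Finset.sum_sub_distrib]
        exact Finset.sum_congr rfl fun k _ => Finset.sum_congr rfl fun j _ => by ring
      simp only [e, cutoffTerm, Pi.mul_apply]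
      ring
  have hU₁n : L1L2 (fun z => -U₁ z) := ⟨hU₁.meas.neg, hU₁.sq.neg, hU₁.int.neg⟩
  have limL : Tendsto (fun δ => ENNReal.ofReal κ *
      (eLpNorm (fun z => w z * (ζ z * moll volume ρ δ U₁ z)) 2 volume ^ 2
        + eLpNorm (fun z => w z * (ζ z * moll volume ρ δ U₂ z)) 2 volume ^ 2)) (𝓝[>] 0) _ :=
    ENNReal.Tendsto.const_mul ((((ENNReal.continuous_pow 2).tendsto _).comp (lhs hU₁)).add
      (((ENNReal.continuous_pow 2).tendsto _).comp (lhs hU₂))) (Or.inr ENNReal.ofReal_ne_top)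
  have limR := (((ENNReal.continuous_pow 2).tendsto _).comp (rhs hU₁ hU₂ hW₁ hG₁)).add
    (((ENNReal.continuous_pow 2).tendsto _).comp (rhs hU₂ hU₁n hW₂ hG₂))
  refine le_of_tendsto_of_tendsto limL limR ?_
  filter_upwards [hx, ht, self_mem_nhdsWithin] with δ hxδ htδ hδ
  have hδ' : (0 : ℝ) < δ := hδ
  have mneg : moll volume ρ δ (fun z => -U₁ z) = fun z => -moll volume ρ δ U₁ z := by
    funext z
    simp only [moll, neg_mul, integral_neg]
  set g₁ : ST n → ℝ := fun y => ζ y * moll volume ρ δ U₁ y with hg₁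
  set g₂ : ST n → ℝ := fun y => ζ y * moll volume ρ δ U₂ y with hg₂
  have c₁ : ContDiff ℝ ∞ g₁ := hζ.mul (hρ.contDiff_moll hδ' hU₁.int)
  have c₂ : ContDiff ℝ ∞ g₂ := hζ.mul (hρ.contDiff_moll hδ' hU₂.int)
  have z₁ : ∀ z ∉ S, g₁ z = 0 := fun z hz => by simp [hg₁, hζ0 z hz]
  have z₂ : ∀ z ∉ S, g₂ z = 0 := fun z hz => by simp [hg₂, hζ0 z hz]
  have E₁ := divA_cutoff_moll ha hρ hδ' (W := W₁) hU₁ hU₂ hG₁ hO (fun z hz j => (hxδ z hz j).1)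
    (fun z hz => (htδ z hz).1) hζ hζO
  have E₂ := divA_cutoff_moll ha hρ hδ' (V := fun z => -U₁ z) (W := W₂) hU₂ hU₁n hG₂ hO
    (fun z hz j => (hxδ z hz j).2)
    (fun z hz => by
      rw [mneg, ← (htδ z hz).2]
      simp [dd]) hζ hζO
  have hdg : ∀ z, dd et (fun y => ζ y * moll volume ρ δ (fun z => -U₁ z) y) z = -dd et g₁ z := by
    intro z
    rw [mneg]
    simp only [hg₁, mul_neg]
    simp [dd]
  have key := hcarl g₁ g₂ c₁ c₂ z₁ z₂
  have F₁ : ∀ z, divA ex (stA a) g₁ z - dd et g₂ z = _ := E₁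
  have F₂ : ∀ z, divA ex (stA a) g₂ z + dd et g₁ z = _ := fun z =>
    (show divA ex (stA a) g₂ z + dd et g₁ z = divA ex (stA a) g₂ z
      - dd et (fun y => ζ y * moll volume ρ δ (fun z => -U₁ z) y) z by rw [hdg]; ring).trans (E₂ z)
  have hLc : ∀ {f : ST n → ℝ}, ContDiff ℝ ∞ f → Continuous (divA ex (stA a) f) := fun hf =>
    (contDiff_divA (m := 0) (r := 1) (l := 2) ha1 (hf.of_le ENat.LEInfty.out) (by norm_num)
      (by norm_num)).continuous
  have hdc : ∀ {f : ST n → ℝ}, ContDiff ℝ ∞ f → Continuous (dd et f) := fun hf =>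
    (contDiff_dd (m := 0) hf (by simp) et).continuous
  have hL0 : ∀ {f : ST n → ℝ}, (∀ z ∉ S, f z = 0) → ∀ z ∉ S, divA ex (stA a) f z = 0 := by
    intro f hf z hz
    refine Finset.sum_eq_zero fun k _ => dd_eq_zero_of_notMem hSc (fun y hy => ?_) _ z hz
    exact Finset.sum_eq_zero fun j _ => by rw [dd_eq_zero_of_notMem hSc hf _ y hy, mul_zero]
  have l1 := eLpNorm_two_sq_add hS (hw.mul c₁.continuous) (hw.mul c₂.continuous)
    (fun z hz => by simp [z₁ z hz]) (fun z hz => by simp [z₂ z hz])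
  have l2 := eLpNorm_two_sq_add hS (hw.mul ((hLc c₁).sub (hdc c₂)))
    (hw.mul ((hLc c₂).add (hdc c₁)))
    (fun z hz => by simp [hL0 z₁ z hz, dd_eq_zero_of_notMem hSc z₂ _ z hz])
    (fun z hz => by simp [hL0 z₂ z hz, dd_eq_zero_of_notMem hSc z₁ _ z hz])
  simp only [Function.comp_def, ← F₁, ← F₂]
  refine (congrArg (ENNReal.ofReal κ * ·) l1).trans_le (le_trans ?_ l2.symm.le)
  rw [← ENNReal.ofReal_mul hκ]
  refine ENNReal.ofReal_le_ofReal ?_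
  simpa only [Pi.mul_apply, Pi.add_apply, Pi.sub_apply, mul_pow, ← mul_add] using key

end CutoffLimit

/-! ### Real form of the weak equation -/

section WeakFormulation

open Filter Topology

variable {n : ℕ}

lemma exists_L1L2 {f : ST n → ℝ} {Q : Set (ST n)} (hQ : IsCompact Q)
    (hf : AEStronglyMeasurable f (volume.restrict Q)) (hfin : ∫⁻ z in Q, ‖f z‖ₑ ^ 2 ≠ ⊤) :
    ∃ h, L1L2 h ∧ h =ᵐ[volume] Q.indicator f := by
  have hQm := hQ.isClosed.measurableSet
  have hmem : MemLp f 2 (volume.restrict Q) := by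
    refine ⟨hf, ?_⟩
    have := eLpNorm_nnreal_pow_eq_lintegral (p := 2) (μ := (volume : Measure (ST n)).restrict Q)
      (f := f) (by norm_num)
    simp only [NNReal.coe_ofNat, ENNReal.coe_ofNat, ENNReal.rpow_ofNat] at this
    rw [← this] at hfin
    rw [lt_top_iff_ne_top]
    intro h
    exact hfin (by rw [h]; simp)
  have : IsFiniteMeasure ((volume : Measure (ST n)).restrict Q) :=
    ⟨by rw [Measure.restrict_apply_univ]; exact hQ.measure_lt_top⟩
  have hm2 : MemLp (Q.indicator f) 2 volume := (memLp_indicator_iff_restrict hQm).2 hmem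
  have hi : Integrable (Q.indicator f) volume :=
    (integrable_indicator_iff hQm).2 (hmem.integrable (by norm_num))
  refine ⟨hm2.1.mk _, ⟨hm2.1.stronglyMeasurable_mk.measurable, ?_, ?_⟩, hm2.1.ae_eq_mk.symm⟩
  · exact hm2.ae_eq hm2.1.ae_eq_mk
  · exact hi.congr hm2.1.ae_eq_mk

lemma exists_L1L2_complex {F : ST n → ℂ} {Q : Set (ST n)} (hQ : IsCompact Q)
    (hF : AEStronglyMeasurable F (volume.restrict Q)) (hfin : ∫⁻ z in Q, ‖F z‖ₑ ^ 2 ≠ ⊤) :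
    ∃ H₁ H₂, L1L2 H₁ ∧ L1L2 H₂ ∧
      ∀ᵐ z, z ∈ Q → F z = ((H₁ z : ℝ) : ℂ) + Complex.I * ((H₂ z : ℝ) : ℂ) := by
  obtain ⟨H₁, h1, e1⟩ := exists_L1L2 hQ (f := fun z => (F z).re)
    (Complex.continuous_re.comp_aestronglyMeasurable hF)
    (ne_top_of_le_ne_top hfin (lintegral_mono fun z => by
      gcongr; rw [← ofReal_norm, ← ofReal_norm]
      exact ENNReal.ofReal_le_ofReal (Complex.abs_re_le_norm _)))
  obtain ⟨H₂, h2, e2⟩ := exists_L1L2 hQ (f := fun z => (F z).im)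
    (Complex.continuous_im.comp_aestronglyMeasurable hF)
    (ne_top_of_le_ne_top hfin (lintegral_mono fun z => by
      gcongr; rw [← ofReal_norm, ← ofReal_norm]
      exact ENNReal.ofReal_le_ofReal (Complex.abs_im_le_norm _)))
  refine ⟨H₁, H₂, h1, h2, ?_⟩
  filter_upwards [e1, e2] with z h1 h2 hz
  rw [h1, h2, indicator_of_mem hz, indicator_of_mem hz, mul_comm, Complex.re_add_im]

lemma fderiv_ofReal_apply {E : Type*} [NormedAddCommGroup E] [NormedSpace ℝ E] {X : E → ℝ}
    (hX : Differentiable ℝ X) (z v : E) :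
    fderiv ℝ (fun y => (X y : ℂ)) z v = ((dd v X z : ℝ) : ℂ) := by
  have := (Complex.ofRealCLM.hasFDerivAt.comp z (hX z).hasFDerivAt).fderiv
  change fderiv ℝ (Complex.ofRealCLM ∘ X) z v = _
  rw [this]
  simp [dd]

/-- The bounded space-time cylinder on which the solution is mollified. -/
def cyl (n : ℕ) (R : ℝ) : Set (ST n) := Icc (1 / 16 : ℝ) (15 / 16) ×ˢ Metric.closedBall (0 : Rn n) R

lemma isCompact_cyl (R : ℝ) : IsCompact (cyl n R) := isCompact_Icc.prod (isCompact_closedBall _ _)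

lemma cyl_subset (R : ℝ) : cyl n R ⊆ Ioo (0 : ℝ) 1 ×ˢ (univ : Set (Rn n)) := by
  rintro ⟨t, x⟩ ⟨ht, -⟩
  refine ⟨⟨?_, ?_⟩, mem_univ _⟩
  · have := ht.1; simp only at this ⊢; linarith
  · have := ht.2; simp only at this ⊢; linarith

/-- The real and imaginary parts of a weak solution, of its gradient and of the potential term on
the cylinder `cyl n R`, with the weak equations they satisfy against real test functions. -/
structure RealSolution (a : Fin n → Fin n → Rn n → ℝ) (R : ℝ) (U₁ U₂ W₁ W₂ : ST n → ℝ)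
    (G₁ G₂ : Fin n → ST n → ℝ) : Prop where
  u₁ : L1L2 U₁
  u₂ : L1L2 U₂
  w₁ : L1L2 W₁
  w₂ : L1L2 W₂
  g₁ : ∀ j, L1L2 (G₁ j)
  g₂ : ∀ j, L1L2 (G₂ j)
  grad : ∀ X : ST n → ℝ, ContDiff ℝ ∞ X → (∀ z ∉ cyl n R, X z = 0) → ∀ j,
    ∫ z, U₁ z * dd (ex j) X z = -∫ z, G₁ j z * X z ∧
    ∫ z, U₂ z * dd (ex j) X z = -∫ z, G₂ j z * X z
  eqn : ∀ X : ST n → ℝ, ContDiff ℝ ∞ X → (∀ z ∉ cyl n R, X z = 0) →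
    -∫ z, U₂ z * dd et X z
      = -(∑ k, ∑ j, ∫ z, stA a k j z * G₁ j z * dd (ex k) X z) + ∫ z, W₁ z * X z ∧
    ∫ z, U₁ z * dd et X z
      = -(∑ k, ∑ j, ∫ z, stA a k j z * G₂ j z * dd (ex k) X z) + ∫ z, W₂ z * X z

lemma L1L2.integrable_mul {h c : ST n → ℝ} (hh : L1L2 h) (hc : Continuous c) {Q : Set (ST n)}
    (hQ : IsCompact Q) (h0 : ∀ z ∉ Q, c z = 0) : Integrable (fun z => h z * c z) := by
  obtain ⟨C, hC⟩ := exists_abs_le_of_continuous_of_notMem hc hQ h0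
  exact (hh.int.bdd_mul (c := C) hc.aestronglyMeasurable
    (Eventually.of_forall fun z => by simpa using hC z)).congr
    (Eventually.of_forall fun z => mul_comm _ _)

/-- The integral of a complex function that agrees on `Q` with `H₁ + i H₂`, against a function
supported in `Q`. -/
lemma setIntegral_complex_mul {F : ST n → ℂ} {H₁ H₂ c : ST n → ℝ} {Q P : Set (ST n)}
    (hH₁ : L1L2 H₁) (hH₂ : L1L2 H₂) (hc : Continuous c) (hQ : IsCompact Q)
    (h0 : ∀ z ∉ Q, c z = 0) (hQP : Q ⊆ P)
    (hF : ∀ᵐ z, z ∈ Q → F z = (H₁ z : ℂ) + Complex.I * H₂ z) :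
    Integrable (fun z => F z * (c z : ℂ)) ∧
    ∫ z in P, F z * (c z : ℂ)
      = ((∫ z, H₁ z * c z : ℝ) : ℂ) + Complex.I * ((∫ z, H₂ z * c z : ℝ) : ℂ) := by
  have i1 := (hH₁.integrable_mul hc hQ h0).ofReal (𝕜 := ℂ)
  have i2 := (hH₂.integrable_mul hc hQ h0).ofReal (𝕜 := ℂ)
  have e : (fun z => F z * (c z : ℂ)) =ᵐ[volume] fun z => ((H₁ z * c z : ℝ) : ℂ)
      + Complex.I * ((H₂ z * c z : ℝ) : ℂ) := by
    filter_upwards [hF] with z hz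
    by_cases hzQ : z ∈ Q
    · rw [hz hzQ]; push_cast; ring
    · simp [h0 z hzQ]
  refine ⟨(i1.add (i2.const_mul Complex.I)).congr e.symm, ?_⟩
  rw [setIntegral_eq_integral_of_forall_compl_eq_zero
    (fun z hz => by simp [h0 z fun h => hz (hQP h)]), integral_congr_ae e]
  have e1 : ∫ z, ((H₁ z * c z : ℝ) : ℂ) = ((∫ z, H₁ z * c z : ℝ) : ℂ) := integral_ofReal
  have e2 : ∫ z, ((H₂ z * c z : ℝ) : ℂ) = ((∫ z, H₂ z * c z : ℝ) : ℂ) := integral_ofReal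
  rw [← e1, ← e2, ← integral_const_mul]
  exact integral_add i1 (i2.const_mul Complex.I)

lemma volume_restrict_cyl_le (R : ℝ) : (volume : Measure (ST n)).restrict (cyl n R)
    ≤ (volume.restrict (Ioo (0 : ℝ) 1)).prod volume := by
  rw [← Measure.restrict_univ (μ := (volume : Measure (Rn n))), Measure.prod_restrict,
    ← Measure.volume_eq_prod]
  exact Measure.restrict_mono (cyl_subset R) le_rfl

lemma MemL2locH1.lintegral_cyl_ne_top {u : ℝ → Rn n → ℂ} {Du : ℝ → Rn n → EuclideanSpace ℂ (Fin n)}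
    (hu : MemL2locH1 u Du) (R : ℝ) :
    ∫⁻ z in cyl n R, (‖u z.1 z.2‖ₑ ^ 2 + ‖Du z.1 z.2‖ₑ ^ 2) ≠ ⊤ := by
  have hm : AEMeasurable (fun z : ST n => ‖u z.1 z.2‖ₑ ^ 2 + ‖Du z.1 z.2‖ₑ ^ 2)
      (volume.restrict (cyl n R)) :=
    ((hu.1.mono_measure (volume_restrict_cyl_le R)).enorm.pow_const 2).add
      ((hu.2.1.mono_measure (volume_restrict_cyl_le R)).enorm.pow_const 2)
  refine ne_top_of_le_ne_top (hu.2.2.2 (1 / 16) (15 / 16) (by norm_num) (by norm_num)).ne ?_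
  unfold cyl at hm ⊢
  rw [Measure.volume_eq_prod] at hm ⊢
  rw [setLIntegral_prod _ hm]
  exact lintegral_mono fun t => setLIntegral_le_lintegral _ _

lemma enorm_coord_le (v : EuclideanSpace ℂ (Fin n)) (j : Fin n) : ‖v j‖ₑ ≤ ‖v‖ₑ := by
  rw [← ofReal_norm, ← ofReal_norm]
  exact ENNReal.ofReal_le_ofReal (PiLp.norm_apply_le v j)

/-- The weak equation in real form. The gradient relation on space-time follows from the one on
almost every time slice by Fubini. -/
lemma exists_realSolution {A : Rn n → Matrix (Fin n) (Fin n) ℝ} {V : ST n → ℂ}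
    {u : ℝ → Rn n → ℂ} {Du : ℝ → Rn n → EuclideanSpace ℂ (Fin n)} {M : ℝ}
    (hA : ∀ j k, Continuous fun x => A x j k)
    (hV : AEStronglyMeasurable V volume) (hVM : ∀ᵐ z, ‖V z‖ ≤ M)
    (hu : MemL2locH1 u Du) (hsol : IsWeakSolution A V u Du) (R : ℝ) :
    ∃ U₁ U₂ W₁ W₂ G₁ G₂, RealSolution (fun k j x => A x k j) R U₁ U₂ W₁ W₂ G₁ G₂ ∧
      ∀ᵐ z : ST n, z ∈ cyl n R →
        u z.1 z.2 = ((U₁ z : ℝ) : ℂ) + Complex.I * ((U₂ z : ℝ) : ℂ) ∧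
        V z * u z.1 z.2 = ((W₁ z : ℝ) : ℂ) + Complex.I * ((W₂ z : ℝ) : ℂ) ∧
        ∀ j, Du z.1 z.2 j = ((G₁ j z : ℝ) : ℂ) + Complex.I * ((G₂ j z : ℝ) : ℂ) := by
  have hQ := isCompact_cyl (n := n) R
  have hle := volume_restrict_cyl_le (n := n) R
  have hfin := hu.lintegral_cyl_ne_top R
  have um := hu.1.mono_measure hle
  have Dm := hu.2.1.mono_measure hle
  have hfu : ∫⁻ z in cyl n R, ‖u z.1 z.2‖ₑ ^ 2 ≠ ⊤ :=
    ne_top_of_le_ne_top hfin (lintegral_mono fun z => le_self_add)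
  obtain ⟨U₁, U₂, hU₁, hU₂, eU⟩ := exists_L1L2_complex hQ um hfu
  obtain ⟨W₁, W₂, hW₁, hW₂, eW⟩ := exists_L1L2_complex hQ (hV.restrict.mul um) (by
    refine ne_top_of_le_ne_top (ENNReal.mul_ne_top (ENNReal.ofReal_ne_top (r := M ^ 2)) hfu) ?_
    rw [← lintegral_const_mul' _ _ ENNReal.ofReal_ne_top]
    refine lintegral_mono_ae (ae_restrict_of_ae (hVM.mono fun z hz => ?_))
    simp only [Pi.mul_apply, enorm_mul, mul_pow]
    gcongr
    rw [← ofReal_norm, ← ENNReal.ofReal_pow (norm_nonneg _)]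
    exact ENNReal.ofReal_le_ofReal (pow_le_pow_left₀ (norm_nonneg _) hz 2))
  have hG : ∀ j, ∃ H₁ H₂, L1L2 H₁ ∧ L1L2 H₂ ∧ ∀ᵐ z : ST n, z ∈ cyl n R →
      Du z.1 z.2 j = ((H₁ z : ℝ) : ℂ) + Complex.I * ((H₂ z : ℝ) : ℂ) := by
    intro j
    refine exists_L1L2_complex (F := fun z => Du z.1 z.2 j) hQ ?_ ?_
    · exact (PiLp.continuous_apply 2 (fun _ : Fin n => ℂ) j).comp_aestronglyMeasurable Dm
    · refine ne_top_of_le_ne_top hfin (lintegral_mono fun z => ?_)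
      exact le_add_left (pow_le_pow_left' (enorm_coord_le _ _) 2)
  choose G₁ G₂ hG₁ hG₂ eG using hG
  refine ⟨U₁, U₂, W₁, W₂, G₁, G₂, ⟨hU₁, hU₂, hW₁, hW₂, hG₁, hG₂, ?_, ?_⟩, ?_⟩
  · intro X hX h0 j
    have hXd : Differentiable ℝ X := hX.differentiable (by simp)
    have hdX : ContDiff ℝ ∞ (dd (ex j) X) := contDiff_dd hX (by simp) _
    have hd0 := dd_eq_zero_of_notMem hQ.isClosed h0 (ex j)
    obtain ⟨i1, r1⟩ := setIntegral_complex_mul hU₁ hU₂ hdX.continuous hQ hd0 (subset_univ _) eU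
    obtain ⟨i2, r2⟩ := setIntegral_complex_mul (hG₁ j) (hG₂ j) hX.continuous hQ h0
      (subset_univ _) (eG j)
    have key : ∫ z : ST n in univ, u z.1 z.2 * ((dd (ex j) X z : ℝ) : ℂ)
        = -∫ z : ST n in univ, Du z.1 z.2 j * ((X z : ℝ) : ℂ) := by
      rw [setIntegral_univ, setIntegral_univ]
      rw [Measure.volume_eq_prod] at i1 i2 ⊢
      rw [integral_prod _ i1, integral_prod _ i2, ← integral_neg]
      have hw := (ae_restrict_iff' measurableSet_Ioo).1 hu.2.2.1
      refine integral_congr_ae (hw.mono fun t ht => ?_)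
      by_cases htI : t ∈ Ioo (0 : ℝ) 1
      · have hsl : ContDiff ℝ ∞ (fun x : Rn n => X (t, x)) :=
          hX.comp (contDiff_const.prodMk contDiff_id)
        have := (ht htI).2.2 j (fun x => ((X (t, x) : ℝ) : ℂ))
          (Complex.ofRealCLM.contDiff.comp hsl)
          (HasCompactSupport.of_support_subset_isCompact (isCompact_closedBall (0 : Rn n) R)
            fun x hx => by
              by_contra hxb
              exact hx (by simp [h0 (t, x) fun h => hxb h.2]))
        refine Eq.trans (integral_congr_ae (Eventually.of_forall fun x => ?_)) this
        simp only
        rw [fderiv_ofReal_apply (hsl.differentiable (by simp))]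
        have : dd (stdVec j) (fun x => X (t, x)) x = dd (ex j) X (t, x) := by
          have hc := (hXd (t, x)).hasFDerivAt.comp x
            ((hasFDerivAt_const t x).prodMk (hasFDerivAt_id x))
          have := hc.fderiv
          simp only [dd]
          change fderiv ℝ (X ∘ Prod.mk t) x _ = _
          rw [this]
          simp [ex]
        rw [this]
      · have hn : ∀ x, ((t, x) : ST n) ∉ cyl n R := fun x hx => htI (cyl_subset R hx).1
        simp [h0 _ (hn _), hd0 _ (hn _)]
    rw [r1, r2] at key
    have k1 := congrArg Complex.re key
    have k2 := congrArg Complex.im key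
    simp at k1 k2
    exact ⟨k1, k2⟩
  · intro X hX h0
    have hXd : Differentiable ℝ X := hX.differentiable (by simp)
    have hdX : ∀ v, ContDiff ℝ ∞ (dd v X) := fun v => contDiff_dd hX (by simp) _
    have hd0 := fun v => dd_eq_zero_of_notMem hQ.isClosed h0 v
    have hA' : ∀ k j, Continuous (stA (fun k j x => A x k j) k j : ST n → ℝ) :=
      fun k j => (hA k j).comp continuous_snd
    obtain ⟨-, r1⟩ := setIntegral_complex_mul hU₁ hU₂ (hdX et).continuous hQ (hd0 et)
      (cyl_subset R) eU
    obtain ⟨i2, r2⟩ := setIntegral_complex_mul hW₁ hW₂ hX.continuous hQ h0 (cyl_subset R) eW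
    simp only [Pi.mul_apply] at i2 r2
    have hk := fun k j => setIntegral_complex_mul (hG₁ j) (hG₂ j)
      (c := fun z => stA (fun k j x => A x k j) k j z * dd (ex k) X z)
      ((hA' k j).mul (hdX (ex k)).continuous) hQ (fun z hz => by rw [hd0 _ z hz, mul_zero])
      (cyl_subset R) (eG j)
    have hs := hsol (fun z => ((X z : ℝ) : ℂ)) (Complex.ofRealCLM.contDiff.comp hX)
      (HasCompactSupport.of_support_subset_isCompact hQ fun z hz => by
        by_contra h; exact hz (by simp [h0 z h]))
      ((closure_minimal (fun z hz => by
        by_contra h; exact hz (by simp [h0 z h])) hQ.isClosed).trans (cyl_subset R))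
    have e3 : ∀ z : ST n, (-(∑ k, ∑ j, (A z.2 k j : ℂ) * Du z.1 z.2 j
          * fderiv ℝ (fun z => ((X z : ℝ) : ℂ)) z (0, stdVec k))
          + V z * u z.1 z.2 * ((X z : ℝ) : ℂ))
        = -(∑ k, ∑ j, Du z.1 z.2 j
            * ((stA (fun k j x => A x k j) k j z * dd (ex k) X z : ℝ) : ℂ))
          + V z * u z.1 z.2 * ((X z : ℝ) : ℂ) := by
      intro z
      congr 2
      refine Finset.sum_congr rfl fun k _ => Finset.sum_congr rfl fun j _ => ?_
      rw [fderiv_ofReal_apply hXd]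
      simp only [stA, ex]; push_cast; ring
    simp only [e3] at hs
    have e4 : ∀ z : ST n, fderiv ℝ (fun z => ((X z : ℝ) : ℂ)) z (1, 0) = ((dd et X z : ℝ) : ℂ) :=
      fun z => fderiv_ofReal_apply hXd z _
    simp only [e4] at hs
    rw [r1, integral_add, integral_neg, integral_finsetSum, r2] at hs
    · simp_rw [integral_finsetSum _ fun j _ => (hk _ j).1.restrict, (hk _ _).2] at hs
      have k1 := congrArg Complex.re hs
      have k2 := congrArg Complex.im hs
      simp at k1 k2
      have c1 : ∀ k j, ∫ z, stA (fun k j x => A x k j) k j z * G₁ j z * dd (ex k) X z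
          = ∫ z, G₁ j z * (stA (fun k j x => A x k j) k j z * dd (ex k) X z) :=
        fun k j => by congr 1; funext z; ring
      have c2 : ∀ k j, ∫ z, stA (fun k j x => A x k j) k j z * G₂ j z * dd (ex k) X z
          = ∫ z, G₂ j z * (stA (fun k j x => A x k j) k j z * dd (ex k) X z) :=
        fun k j => by congr 1; funext z; ring
      simp only [c1, c2]
      constructor <;> linarith
    · exact fun k _ => integrable_finsetSum _ fun j _ => (hk k j).1.restrict
    · exact (integrable_finsetSum _ fun k _ => integrable_finsetSum _ fun j _ =>
        (hk k j).1.restrict).neg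
    · exact i2.restrict
  · filter_upwards [eU, eW, ae_all_iff.2 eG] with z h1 h2 h3 hz
    exact ⟨h1 hz, h2 hz, fun j => h3 j hz⟩

end WeakFormulation

/-! ### Carleman inequality for the solution -/

section SolutionCarleman

open Filter Topology

variable {n : ℕ} {lam Lam K : ℝ} {a : Fin n → Fin n → Rn n → ℝ}

/-- The interior of `cyl n (R + 1)` on which mollifications at scale below `1/40` only see values
of the solution in `cyl n (R + 1)`. -/
def innerCyl (n : ℕ) (R : ℝ) : Set (ST n) :=
  Ioo (1 / 10 : ℝ) (9 / 10) ×ˢ Metric.ball (0 : Rn n) (R + 1 / 2)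

lemma sub_notMem_closedBall {R δ : ℝ} (hδ : δ < 1 / 40) {z w : ST n} (hz : z ∈ innerCyl n R)
    (hw : w ∉ cyl n (R + 1)) : z - w ∉ Metric.closedBall (0 : ST n) δ := by
  intro h
  rw [Metric.mem_closedBall, dist_zero_right, norm_prod_le_iff] at h
  obtain ⟨⟨h1, h2⟩, h3⟩ := hz
  rw [Metric.mem_ball, dist_zero_right] at h3
  refine hw ⟨?_, ?_⟩
  · have := abs_le.1 (by simpa using h.1)
    constructor <;> linarith [this.1, this.2]
  · rw [Metric.mem_closedBall, dist_zero_right]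
    have := norm_sub_norm_le w.2 z.2
    rw [norm_sub_rev] at this
    have h4 : ‖z.2 - w.2‖ ≤ δ := h.2
    linarith

lemma IsMollifier.dd_rescale_sub {ρ : ST n → ℝ} (hρ : IsMollifier volume ρ) (δ : ℝ) (z v w : ST n) :
    dd v (fun w => rescale ρ δ (z - w)) w = -dd v (rescale ρ δ) (z - w) := by
  have hd : Differentiable ℝ (rescale ρ δ) := hρ.contDiff_rescale.differentiable (by simp)
  have := ((hd (z - w)).hasFDerivAt.comp w ((hasFDerivAt_id w).const_sub z)).fderiv
  simp only [dd]
  change fderiv ℝ (rescale ρ δ ∘ HSub.hSub z) w v = _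
  rw [this]
  simp

/-- Inside `innerCyl n R` the mollified solution satisfies the equation pointwise: the translated
mollifier is an admissible test function. -/
lemma RealSolution.dd_moll {δ₀ R δ : ℝ} (ha : CoeffBounds lam Lam K δ₀ a)
    {U₁ U₂ W₁ W₂ : ST n → ℝ} {G₁ G₂ : Fin n → ST n → ℝ}
    (h : RealSolution a (R + 1) U₁ U₂ W₁ W₂ G₁ G₂) {ρ : ST n → ℝ} (hρ : IsMollifier volume ρ)
    (hδ0 : 0 < δ) (hδ : δ < 1 / 40) {z : ST n} (hz : z ∈ innerCyl n R) :
    (∀ j, dd (ex j) (moll volume ρ δ U₁) z = moll volume ρ δ (G₁ j) z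
      ∧ dd (ex j) (moll volume ρ δ U₂) z = moll volume ρ δ (G₂ j) z) ∧
    dd et (moll volume ρ δ U₂) z
        = ∑ k, ∑ j, dd (ex k) (moll volume ρ δ fun w => stA a k j w * G₁ j w) z
          + moll volume ρ δ W₁ z ∧
    -dd et (moll volume ρ δ U₁) z
        = ∑ k, ∑ j, dd (ex k) (moll volume ρ δ fun w => stA a k j w * G₂ j w) z
          + moll volume ρ δ W₂ z := by
  have hX : ContDiff ℝ ∞ (fun w => rescale ρ δ (z - w)) :=
    hρ.contDiff_rescale.comp (contDiff_const.sub contDiff_id)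
  have h0 : ∀ w ∉ cyl n (R + 1), rescale ρ δ (z - w) = 0 := fun w hw =>
    hρ.rescale_eq_zero hδ0 (sub_notMem_closedBall hδ hz hw)
  have hg := h.grad _ hX h0
  obtain ⟨e1, e2⟩ := h.eqn _ hX h0
  simp only [hρ.dd_rescale_sub, mul_neg, integral_neg, Finset.sum_neg_distrib, neg_neg] at hg e1 e2
  refine ⟨fun j => ⟨?_, ?_⟩, ?_, ?_⟩
  · rw [hρ.dd_moll hδ0 h.u₁.int]
    exact neg_inj.1 (hg j).1
  · rw [hρ.dd_moll hδ0 h.u₂.int]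
    exact neg_inj.1 (hg j).2
  · rw [hρ.dd_moll hδ0 h.u₂.int, e1]
    simp_rw [hρ.dd_moll hδ0 (ha.integrable_mul _ _ (h.g₁ _))]
    rfl
  · rw [hρ.dd_moll hδ0 h.u₁.int, e2]
    simp_rw [hρ.dd_moll hδ0 (ha.integrable_mul _ _ (h.g₂ _))]
    rfl

/-- The shell `ε ≤ |x| ≤ R` over the time interval `[1/8, 7/8]`. -/
def shell (n : ℕ) (ε R : ℝ) : Set (ST n) :=
  Icc (1 / 8 : ℝ) (7 / 8) ×ˢ {x : Rn n | ε ≤ ‖x‖ ∧ ‖x‖ ≤ R}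

lemma isCompact_shell (ε R : ℝ) : IsCompact (shell n ε R) := by
  refine isCompact_Icc.prod ?_
  refine (isCompact_closedBall (0 : Rn n) R).of_isClosed_subset ?_ fun x hx => by simpa using hx.2
  exact (isClosed_le continuous_const continuous_norm).inter
    (isClosed_le continuous_norm continuous_const)

/-- Carleman inequality in the shell for the cut off solution `ζ u`. -/
theorem RealSolution.carleman {δ₀ ε Bb R c : ℝ} {b : ℝ → ℝ} (ha : CoeffBounds lam Lam K δ₀ a)
    (hlam : 0 < lam) (hLam : 0 ≤ Lam) (hK0 : 0 ≤ K) (hsmall : 2 * (n : ℝ) ^ 4 * Lam * δ₀ ≤ lam ^ 2)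
    (hb : ContDiff ℝ ∞ b) (hε : 0 < ε) (hBb : ∀ t, |deriv (deriv b) t| ≤ Bb) (hR1 : 1 ≤ R)
    (hR : 2 * n ^ 4 * (K + Lam) * K ≤ R) (hc : c = (Bb + 1) / (lam * ε))
    {U₁ U₂ W₁ W₂ : ST n → ℝ} {G₁ G₂ : Fin n → ST n → ℝ}
    (h : RealSolution a (R + 1) U₁ U₂ W₁ W₂ G₁ G₂)
    {ζ : ST n → ℝ} (hζ : ContDiff ℝ ∞ ζ) (hζ0 : ∀ z ∉ shell n ε R, ζ z = 0) :
    ENNReal.ofReal (c * R ^ 3)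
        * (eLpNorm (fun z => Real.exp (weightR c R b z) * (ζ z * U₁ z)) 2 volume ^ 2
          + eLpNorm (fun z => Real.exp (weightR c R b z) * (ζ z * U₂ z)) 2 volume ^ 2)
      ≤ eLpNorm (fun z => Real.exp (weightR c R b z) * cutoffTerm a ζ U₁ U₂ G₁ W₁ z) 2 volume ^ 2
        + eLpNorm (fun z => Real.exp (weightR c R b z)
          * cutoffTerm a ζ U₂ (fun z => -U₁ z) G₂ W₂ z) 2 volume ^ 2 := by
  obtain ⟨ρ, hρ⟩ := exists_isMollifier (μ := (volume : Measure (ST n)))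
  have hBb0 : 0 ≤ Bb := (abs_nonneg _).trans (hBb 0)
  have hev : ∀ᶠ δ in 𝓝[>] (0 : ℝ), 0 < δ ∧ δ < 1 / 40 :=
    Ioo_mem_nhdsGT (by norm_num)
  refine carleman_limit ha hK0 (by rw [hc]; positivity) hρ h.u₁ h.u₂ h.w₁ h.w₂ h.g₁ h.g₂
    (O := innerCyl n R) (isOpen_Ioo.prod Metric.isOpen_ball) (isCompact_shell ε R) ?_
    (hev.mono fun δ hδ z hz => (h.dd_moll ha hρ hδ.1 hδ.2 hz).1)
    (hev.mono fun δ hδ z hz => (h.dd_moll ha hρ hδ.1 hδ.2 hz).2) hζ hζ0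
    (Real.continuous_exp.comp (contDiff_weight hb).continuous) ?_
  · rintro ⟨t, x⟩ ⟨⟨h1, h2⟩, h3⟩
    refine ⟨⟨?_, ?_⟩, ?_⟩
    · simp only at h1 ⊢; linarith
    · simp only at h2 ⊢; linarith
    · rw [Metric.mem_ball, dist_zero_right]; linarith [h3.2]
  · intro g₁ g₂ hg₁ hg₂ h₁ h₂
    exact carleman_shell ha hlam hLam hsmall hb hε hBb hR1 hR hc hg₁ hg₂ (isCompact_shell ε R)
      h₁ h₂ fun z hz => hz.2

end SolutionCarleman

/-! ### Bounds on the coefficients -/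

section CoefficientBounds

variable {n : ℕ} {lam Lam K : ℝ}

lemma iteratedFDeriv_succ_eq_dd {E : Type*} [NormedAddCommGroup E] [NormedSpace ℝ E] {f : E → ℝ}
    {i : ℕ} (hf : ContDiff ℝ (i + 1 : ℕ) f) (m : Fin (i + 1) → E) (x : E) :
    iteratedFDeriv ℝ (i + 1) f x m = dd (m 0) (fun y => iteratedFDeriv ℝ i f y (Fin.tail m)) x := by
  rw [iteratedFDeriv_succ_apply_left, dd, fderiv_continuousMultilinear_apply_const_apply]
  exact (hf.differentiable_iteratedFDeriv (by exact_mod_cast i.lt_succ_self)) x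

lemma abs_le_sqrt_sum_sum {ι κ : Type*} [Fintype ι] [Fintype κ] (f : ι → κ → ℝ) (i : ι) (k : κ) :
    |f i k| ≤ Real.sqrt (∑ i, ∑ k, f i k ^ 2) := by
  refine Real.abs_le_sqrt ?_
  calc f i k ^ 2 ≤ ∑ k, f i k ^ 2 :=
        Finset.single_le_sum (f := fun k => f i k ^ 2) (fun _ _ => sq_nonneg _) (Finset.mem_univ k)
    _ ≤ _ := Finset.single_le_sum (f := fun i => ∑ k, f i k ^ 2)
        (fun _ _ => Finset.sum_nonneg fun _ _ => sq_nonneg _) (Finset.mem_univ i)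

lemma abs_iteratedFDeriv_le {A : Rn n → Matrix (Fin n) (Fin n) ℝ}
    (hA : normC3 A ≤ ENNReal.ofReal K) {i : ℕ} (hi : i ∈ Finset.Icc 1 3) (j k : Fin n)
    (J : Fin i → Fin n) (x : Rn n) :
    |iteratedFDeriv ℝ i (fun y => A y j k) x (fun m => stdVec (J m))| ≤ max K 0 := by
  have h1 : ENNReal.ofReal (derivNorm A J x) ≤ ENNReal.ofReal (max K 0) := by
    refine le_trans ?_ (hA.trans (ENNReal.ofReal_le_ofReal (le_max_left _ _)))
    refine le_trans ?_ (Finset.single_le_sum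
      (f := fun i => ⨆ (x : Rn n) (J : Fin i → Fin n), ENNReal.ofReal (derivNorm A J x))
      (fun _ _ => zero_le) hi)
    exact le_iSup₂_of_le x J le_rfl
  rw [ENNReal.ofReal_le_ofReal_iff (le_max_right _ _)] at h1
  exact (abs_le_sqrt_sum_sum (fun j k =>
    iteratedFDeriv ℝ i (fun y => A y j k) x (fun m => stdVec (J m))) j k).trans h1

/-- The entry `a_{kj}` is recovered by polarization from the quadratic form at `e_k ± e_j`. -/
lemma IsSymmElliptic.abs_entry_le {A : Rn n → Matrix (Fin n) (Fin n) ℝ} (hlam : 0 < lam)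
    (hLam : 0 < Lam) (h : IsSymmElliptic lam Lam A) (x : Rn n) (k j : Fin n) :
    |A x k j| ≤ Lam := by
  obtain ⟨hs, he⟩ := h x
  have hpol : ∀ ξ η : Rn n,
      ∑ p, ∑ q, A x p q * (ξ + η) p * (ξ + η) q - ∑ p, ∑ q, A x p q * (ξ - η) p * (ξ - η) q
        = 2 * ∑ p, ∑ q, A x p q * ξ p * η q + 2 * ∑ p, ∑ q, A x p q * η p * ξ q := by
    intro ξ η
    simp only [Finset.mul_sum, ← Finset.sum_sub_distrib, ← Finset.sum_add_distrib]
    refine Finset.sum_congr rfl fun p _ => Finset.sum_congr rfl fun q _ => ?_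
    simp only [PiLp.add_apply, PiLp.sub_apply]
    ring
  have hval : ∀ k j, ∑ p, ∑ q, A x p q * (stdVec k : Rn n) p * (stdVec j : Rn n) q = A x k j := by
    intro k j
    simp [stdVec]
  have hp := hpol (stdVec k) (stdVec j)
  rw [hval, hval, hs.apply k j] at hp
  have n1 : ∀ i : Fin n, ‖(stdVec i : Rn n)‖ = 1 := fun i => by simp [stdVec]
  have n2 : ‖(stdVec k : Rn n) + stdVec j‖ ≤ 2 := by
    have := norm_add_le (stdVec k : Rn n) (stdVec j); rw [n1, n1] at this; linarith
  have n3 : ‖(stdVec k : Rn n) - stdVec j‖ ≤ 2 := by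
    have := norm_sub_le (stdVec k : Rn n) (stdVec j); rw [n1, n1] at this; linarith
  obtain ⟨l1, u1⟩ := he (stdVec k + stdVec j)
  obtain ⟨l2, u2⟩ := he (stdVec k - stdVec j)
  have q1 : Lam * ‖(stdVec k : Rn n) + stdVec j‖ ^ 2 ≤ Lam * 2 ^ 2 := by gcongr
  have q2 : Lam * ‖(stdVec k : Rn n) - stdVec j‖ ^ 2 ≤ Lam * 2 ^ 2 := by gcongr
  have p1 : 0 ≤ lam * ‖(stdVec k : Rn n) + stdVec j‖ ^ 2 := by positivity
  have p2 : 0 ≤ lam * ‖(stdVec k : Rn n) - stdVec j‖ ^ 2 := by positivity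
  rw [abs_le]
  constructor <;> linarith

/-- The hypotheses on the coefficient matrix in entrywise form. -/
lemma coeffBounds_of_isSymmElliptic {A : Rn n → Matrix (Fin n) (Fin n) ℝ} {δ : ℝ} (hlam : 0 < lam)
    (hLam : 0 < Lam) (hδ : 0 < δ) (h : IsSymmElliptic lam Lam A)
    (hA : ∀ j k, ContDiff ℝ 3 (fun x => A x j k)) (hK : normC3 A ≤ ENNReal.ofReal K)
    (hgrad : (⨆ x, ENNReal.ofReal (‖x‖ * gradNorm A x)) < ENNReal.ofReal δ) :
    CoeffBounds lam Lam (max K 0) δ (fun k j x => A x k j) := by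
  have i1 : ∀ k j l x, iteratedFDeriv ℝ 1 (fun y => A y k j) x (fun m : Fin 1 => stdVec (![l] m))
      = dd (stdVec l) (fun y => A y k j) x := by
    intro k j l x
    rw [iteratedFDeriv_one_apply]; rfl
  have i2 : ∀ k j l i x,
      iteratedFDeriv ℝ 2 (fun y => A y k j) x (fun m : Fin 2 => stdVec (![i, l] m))
      = dd (stdVec i) (dd (stdVec l) (fun y => A y k j)) x := by
    intro k j l i x
    rw [iteratedFDeriv_succ_eq_dd ((hA k j).of_le (by norm_num))]
    congr 1
    funext y
    exact i1 k j l y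
  refine ⟨hA, fun k j x => ((h x).1.apply j k), fun x ξ => ?_,
    fun k j x => h.abs_entry_le hlam hLam x k j, fun k j l x => ?_, fun k j l i x => ?_, fun k j l i m x => ?_, fun k j l x => ?_⟩
  · refine ((h x).2 ξ).1.trans (le_of_eq ?_)
    exact Finset.sum_congr rfl fun k _ => Finset.sum_congr rfl fun j _ => by ring
  · rw [← i1]
    exact abs_iteratedFDeriv_le hK (by simp) k j ![l] x
  · rw [← i2]
    exact abs_iteratedFDeriv_le hK (by simp) k j ![i, l] x
  · have : dd (stdVec m) (dd (stdVec i) (dd (stdVec l) (fun y => A y k j))) x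
        = iteratedFDeriv ℝ 3 (fun y => A y k j) x
          (fun q : Fin 3 => stdVec (![m, i, l] q)) := by
      rw [iteratedFDeriv_succ_eq_dd ((hA k j).of_le (by norm_num))]
      congr 1
      funext y
      exact (i2 k j l i y).symm
    rw [this]
    exact abs_iteratedFDeriv_le hK (by simp) k j ![m, i, l] x
  · have h1 : |dd (stdVec l) (fun y => A y k j) x| ≤ gradNorm A x := by
      unfold gradNorm
      refine (abs_le_sqrt_sum_sum
        (fun j k => fderiv ℝ (fun y => A y j k) x (stdVec l)) k j).trans (Real.sqrt_le_sqrt ?_)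
      exact Finset.single_le_sum
        (f := fun l => ∑ j, ∑ k, (fderiv ℝ (fun y => A y j k) x (stdVec l)) ^ 2)
        (fun _ _ => Finset.sum_nonneg fun _ _ => Finset.sum_nonneg fun _ _ => sq_nonneg _)
        (Finset.mem_univ l)
    have h2 : ENNReal.ofReal (‖x‖ * gradNorm A x) ≤ ENNReal.ofReal δ :=
      (le_iSup (fun x => ENNReal.ofReal (‖x‖ * gradNorm A x)) x).trans hgrad.le
    rw [ENNReal.ofReal_le_ofReal_iff hδ.le] at h2
    exact (mul_le_mul_of_nonneg_left h1 (norm_nonneg x)).trans h2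

end CoefficientBounds

/-! ### Cutoffs -/

section Cutoffs

open Filter Topology

variable {n : ℕ}

lemma contDiff_smoothTransition_infty : ContDiff ℝ ∞ Real.smoothTransition :=
  contDiff_infty.2 fun _ => Real.smoothTransition.contDiff

lemma deriv_smoothTransition_eq_zero {s : ℝ} (hs : s ∉ Ioo (0 : ℝ) 1) :
    deriv Real.smoothTransition s = 0 ∧ deriv (deriv Real.smoothTransition) s = 0 := by
  have h1 : ∀ f : ℝ → ℝ, Continuous f → (∀ s < 0, f s = 0) → (∀ s > 1, f s = 0) → f s = 0 := by
    intro f hf hl hr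
    have hcl : IsClosed {s | f s = 0} := isClosed_eq hf continuous_const
    rcases le_or_gt s 0 with h | h
    · exact closure_minimal (s := Iio 0) (fun s hs => hl s hs) hcl (by rwa [closure_Iio])
    · refine closure_minimal (s := Ioi 1) (fun s hs => hr s hs) hcl ?_
      rw [closure_Ioi]
      by_contra h2
      exact hs ⟨h, not_le.1 h2⟩
  have hloc : ∀ {f : ℝ → ℝ} {c : ℝ} {O : Set ℝ}, IsOpen O → (∀ s ∈ O, f s = c) →
      ∀ s ∈ O, deriv f s = 0 := by
    intro f c O hO hf s hs
    have : f =ᶠ[𝓝 s] fun _ => c := by filter_upwards [hO.mem_nhds hs] with y hy using hf y hy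
    rw [this.deriv_eq, deriv_const]
  have hs1 := (contDiff_infty_iff_deriv.mp contDiff_smoothTransition_infty).2
  have hs2 := (contDiff_infty_iff_deriv.mp hs1).2
  have l1 : ∀ s < 0, deriv Real.smoothTransition s = 0 := fun s hs => hloc isOpen_Iio
    (fun s (hs : s < 0) => Real.smoothTransition.zero_of_nonpos hs.le) s hs
  have r1 : ∀ s > 1, deriv Real.smoothTransition s = 0 := fun s hs => hloc isOpen_Ioi
    (fun s (hs : 1 < s) => Real.smoothTransition.one_of_one_le hs.le) s hs
  exact ⟨h1 _ hs1.continuous l1 r1, h1 _ hs2.continuous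
    (fun s hs => hloc isOpen_Iio l1 s hs) (fun s hs => hloc isOpen_Ioi r1 s hs)⟩

lemma exists_bound_deriv_smoothTransition : ∃ B, ∀ s, |deriv Real.smoothTransition s| ≤ B ∧
    |deriv (deriv Real.smoothTransition) s| ≤ B := by
  have hs1 := (contDiff_infty_iff_deriv.mp contDiff_smoothTransition_infty).2
  have hs2 := (contDiff_infty_iff_deriv.mp hs1).2
  obtain ⟨B₁, h₁⟩ := (HasCompactSupport.intro (isCompact_Icc (a := (0 : ℝ)) (b := 1)) fun s hs =>
    (deriv_smoothTransition_eq_zero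
      fun h => hs (Ioo_subset_Icc_self h)).1).exists_bound_of_continuous hs1.continuous
  obtain ⟨B₂, h₂⟩ := (HasCompactSupport.intro (isCompact_Icc (a := (0 : ℝ)) (b := 1)) fun s hs =>
    (deriv_smoothTransition_eq_zero
      fun h => hs (Ioo_subset_Icc_self h)).2).exists_bound_of_continuous hs2.continuous
  exact ⟨max B₁ B₂, fun s => ⟨(h₁ s).trans (le_max_left _ _), (h₂ s).trans (le_max_right _ _)⟩⟩

/-- The radial cutoff `H(q |x|² + p)` on space-time, where `H` is the smooth transition. -/
noncomputable def radialCutoff (q p : ℝ) (z : ST n) : ℝ :=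
  Real.smoothTransition (weight q p (fun _ => 1) z)

lemma contDiff_radialCutoff (q p : ℝ) : ContDiff ℝ ∞ (radialCutoff q p : ST n → ℝ) :=
  contDiff_smoothTransition_infty.comp (contDiff_weight contDiff_const)

lemma dd_ex_radialCutoff (q p : ℝ) (k : Fin n) :
    dd (ex k) (radialCutoff q p : ST n → ℝ) = fun z =>
      deriv Real.smoothTransition (weight q p (fun _ => 1) z) * (2 * q * z.2 k) := by
  funext z
  unfold radialCutoff
  rw [dd_comp _ (contDiff_smoothTransition_infty.differentiable (by simp))
    ((contDiff_weight contDiff_const).differentiable (by simp)), dd_ex_weight contDiff_const]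

lemma dd_et_radialCutoff (q p : ℝ) (z : ST n) : dd et (radialCutoff q p : ST n → ℝ) z = 0 := by
  unfold radialCutoff
  rw [dd_comp _ (contDiff_smoothTransition_infty.differentiable (by simp))
    ((contDiff_weight contDiff_const).differentiable (by simp)), dd_et_weight contDiff_const]
  simp

lemma dd_ex_dd_ex_radialCutoff (q p : ℝ) (l k : Fin n) (z : ST n) :
    dd (ex l) (dd (ex k) (radialCutoff q p : ST n → ℝ)) z =
      deriv (deriv Real.smoothTransition) (weight q p (fun _ => 1) z) * (2 * q * z.2 l)
        * (2 * q * z.2 k)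
      + deriv Real.smoothTransition (weight q p (fun _ => 1) z)
        * (2 * q * if k = l then 1 else 0) := by
  have hs1 := (contDiff_infty_iff_deriv.mp contDiff_smoothTransition_infty).2
  have hw : ContDiff ℝ ∞ (weight q p (fun _ => 1) : ST n → ℝ) := contDiff_weight contDiff_const
  have hc : Differentiable ℝ (fun y : ST n => y.2 k) := (coordX k).differentiable
  have hd1 : Differentiable ℝ
      (fun z : ST n => deriv Real.smoothTransition (weight q p (fun _ => 1) z)) :=
    (hs1.comp hw).differentiable (by simp)
  rw [dd_ex_radialCutoff, dd_mul _ hd1 (hc.const_mul _),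
    dd_comp _ (hs1.differentiable (by simp)) (hw.differentiable (by simp)),
    dd_ex_weight contDiff_const, dd_const_mul _ _ hc, dd_coord_ex]

lemma radialCutoff_bounds {B q p m : ℝ}
    (hB : ∀ s, |deriv Real.smoothTransition s| ≤ B ∧ |deriv (deriv Real.smoothTransition) s| ≤ B)
    (hm : ∀ z : ST n, weight q p (fun _ => 1) z ∈ Ioo (0 : ℝ) 1 → |q| * ‖z.2‖ ≤ m) (hm0 : 0 ≤ m)
    (l k : Fin n) (z : ST n) :
    |dd (ex k) (radialCutoff q p) z| ≤ 2 * B * m ∧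
    |dd (ex l) (dd (ex k) (radialCutoff q p)) z| ≤ 4 * B * m ^ 2 + 2 * B * |q| ∧
    (weight q p (fun _ => 1) z ∉ Ioo (0 : ℝ) 1 → dd (ex k) (radialCutoff q p) z = 0 ∧
      dd (ex l) (dd (ex k) (radialCutoff q p)) z = 0) := by
  have hB0 : 0 ≤ B := (abs_nonneg _).trans (hB 0).1
  rw [dd_ex_dd_ex_radialCutoff, dd_ex_radialCutoff]
  by_cases hz : weight q p (fun _ => 1) z ∈ Ioo (0 : ℝ) 1
  · have hx : ∀ k, |2 * q * z.2 k| ≤ 2 * m := by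
      intro k
      rw [abs_mul, abs_mul, abs_two, mul_assoc]
      have : |q| * |z.2 k| ≤ |q| * ‖z.2‖ := by gcongr; exact abs_coord_le _ _
      linarith [hm z hz]
    have hd : |2 * q * (if k = l then (1 : ℝ) else 0)| ≤ 2 * |q| := by
      rw [abs_mul, abs_mul, abs_two]
      have : |(if k = l then (1 : ℝ) else 0)| ≤ 1 := by split_ifs <;> simp
      exact mul_le_of_le_one_right (by positivity) this
    obtain ⟨b1, b2⟩ := hB (weight q p (fun _ => 1) z)
    refine ⟨?_, ?_, fun h => absurd hz h⟩
    · rw [abs_mul]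
      calc _ ≤ B * (2 * m) := by gcongr; exact hx k
        _ = _ := by ring
    · refine (abs_add_le _ _).trans ?_
      rw [abs_mul, abs_mul, abs_mul (deriv Real.smoothTransition _)]
      calc _ ≤ B * (2 * m) * (2 * m) + B * (2 * |q|) := by
            gcongr
            · exact hx l
            · exact hx k
        _ = _ := by ring
  · obtain ⟨z1, z2⟩ := deriv_smoothTransition_eq_zero hz
    simp only [z1, z2, zero_mul, add_zero, abs_zero]
    exact ⟨by positivity, by positivity, fun _ => ⟨trivial, trivial⟩⟩

/-- A smooth cutoff `ζ` to the shell `ε ≤ |x| ≤ R`, `1/8 ≤ t ≤ 7/8`. Its space derivatives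
are supported in `ε < |x| < 3ε/2` and `R - 1 < |x| < R`, its time derivative outside
`3/16 < t < 13/16`. The bound `B` covers the derivatives that enter `divA` and `dd et`. -/
structure IsShellCutoff (ε R B : ℝ) (ζ : ST n → ℝ) : Prop where
  smooth : ContDiff ℝ ∞ ζ
  eq_zero : ∀ z ∉ shell n ε R, ζ z = 0
  eq_one : ∀ z : ST n, z.1 ∈ Icc (1 / 4 : ℝ) (3 / 4) → 2 * ε ≤ ‖z.2‖ → ‖z.2‖ ≤ R - 1 → ζ z = 1
  space : ∀ k z, |dd (ex k) ζ z| ≤ B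
  space₂ : ∀ l k z, |dd (ex l) (dd (ex k) ζ) z| ≤ B
  time : ∀ z, |dd et ζ z| ≤ B
  time_eq_zero : ∀ z, z.1 ∈ Ioo (3 / 16 : ℝ) (13 / 16) → dd et ζ z = 0
  space_eq_zero : ∀ z : ST n, ‖z.2‖ ∉ Ioo ε (3 / 2 * ε) → ‖z.2‖ ∉ Ioo (R - 1) R → ∀ l k,
    dd (ex k) ζ z = 0 ∧ dd (ex l) (dd (ex k) ζ) z = 0

/-- The cutoff is `X(t) H((R² - |x|²)/(2R - 1)) H(4(|x|² - ε²)/(5ε²))` with the smooth transition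
`H`. The outer factor falls from `1` to `0` between `|x| = R - 1` and `|x| = R`, where its argument
has slope of order one, so that the bounds do not depend on `R`. -/
lemma exists_isShellCutoff {ε : ℝ} (hε : 0 < ε) : ∃ B, ∀ (n : ℕ) (R : ℝ), 1 ≤ R →
    ∃ ζ : ST n → ℝ, IsShellCutoff ε R B ζ := by
  obtain ⟨B, hB⟩ := exists_bound_deriv_smoothTransition
  have hB0 : 0 ≤ B := (abs_nonneg _).trans (hB 0).1
  let X : ContDiffBump (1 / 2 : ℝ) := ⟨5 / 16, 3 / 8, by norm_num, by norm_num⟩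
  have hX : ContDiff ℝ ∞ X := X.contDiff
  have hXd : Differentiable ℝ X := hX.differentiable (by simp)
  have hX0 : ∀ t, t ∉ Icc (1 / 8 : ℝ) (7 / 8) → X t = 0 := by
    intro t ht
    refine X.zero_of_le_dist ?_
    change (3 / 8 : ℝ) ≤ _
    rw [Real.dist_eq]
    by_contra h
    have := abs_lt.1 (not_le.1 h)
    exact ht ⟨by linarith, by linarith⟩
  have hX1 : ∀ t ∈ Ioo (3 / 16 : ℝ) (13 / 16), X t = 1 := by
    intro t ht
    refine X.one_of_mem_closedBall ?_
    change dist t _ ≤ (5 / 16 : ℝ)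
    rw [Real.dist_eq, _root_.abs_le]
    constructor <;> linarith [ht.1, ht.2]
  have hXa : ∀ t, |X t| ≤ 1 := fun t => by rw [abs_of_nonneg X.nonneg]; exact X.le_one
  obtain ⟨T, hT⟩ := (HasCompactSupport.deriv (f := X) (𝕜 := ℝ)
    X.hasCompactSupport).exists_bound_of_continuous ((contDiff_infty_iff_deriv.mp hX).2).continuous
  have hT' : ∀ t, |deriv X t| ≤ T := hT
  set mi : ℝ := 6 / (5 * ε) with hmi
  set qi : ℝ := 4 / (5 * ε ^ 2) with hqi
  have hmi0 : 0 ≤ mi := by positivity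
  have hqi0 : 0 < qi := by positivity
  -- `D` bounds the first and second derivatives of both radial factors
  set D : ℝ := 6 * B + (2 * B * mi + (4 * B * mi ^ 2 + 2 * B * |qi|)) with hD
  have hDp : 0 ≤ 2 * B * mi ∧ 0 ≤ 4 * B * mi ^ 2 + 2 * B * |qi| := ⟨by positivity, by positivity⟩
  have hD0 : 0 ≤ D := by linarith [hDp.1, hDp.2]
  refine ⟨T + (2 * D + 2 * D ^ 2), fun n R hR => ?_⟩
  have hT0 : 0 ≤ T := (abs_nonneg _).trans (hT' 0)
  have hr : 0 < 2 * R - 1 := by linarith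
  set qo : ℝ := -(2 * R - 1)⁻¹ with hqo
  set po : ℝ := R ^ 2 * (2 * R - 1)⁻¹ with hpo
  have hir : 0 < (2 * R - 1)⁻¹ := inv_pos.2 hr
  have hirr : (2 * R - 1) * (2 * R - 1)⁻¹ = 1 := mul_inv_cancel₀ hr.ne'
  have hwo : ∀ z : ST n, weight qo po (fun _ => 1) z = (R ^ 2 - ‖z.2‖ ^ 2) * (2 * R - 1)⁻¹ := by
    intro z; rw [weight, hqo, hpo]; ring
  have hwi : ∀ z : ST n, weight qi (-4 / 5) (fun _ => 1) z = qi * (‖z.2‖ ^ 2 - ε ^ 2) := by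
    intro z; rw [weight, hqi]; field_simp; ring
  have hqi1 : qi * (3 / 2 * ε) ^ 2 - qi * ε ^ 2 = 1 := by rw [hqi]; field_simp; norm_num
  have o0 : ∀ z : ST n, R ≤ ‖z.2‖ → weight qo po (fun _ => 1) z ≤ 0 := by
    intro z hz
    rw [hwo]
    exact mul_nonpos_of_nonpos_of_nonneg (by nlinarith) hir.le
  have o1 : ∀ z : ST n, ‖z.2‖ ≤ R - 1 → 1 ≤ weight qo po (fun _ => 1) z := by
    intro z hz
    rw [hwo]
    refine hirr.symm.le.trans ?_
    refine mul_le_mul_of_nonneg_right ?_ hir.le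
    nlinarith [norm_nonneg z.2]
  have i0 : ∀ z : ST n, ‖z.2‖ ≤ ε → weight qi (-4 / 5) (fun _ => 1) z ≤ 0 := by
    intro z hz
    rw [hwi]
    exact mul_nonpos_of_nonneg_of_nonpos hqi0.le (by nlinarith [norm_nonneg z.2])
  have i1 : ∀ z : ST n, 3 / 2 * ε ≤ ‖z.2‖ → 1 ≤ weight qi (-4 / 5) (fun _ => 1) z := by
    intro z hz
    rw [hwi, ← hqi1, ← mul_sub]
    refine mul_le_mul_of_nonneg_left ?_ hqi0.le
    nlinarith
  have bo := fun l k (z : ST n) => radialCutoff_bounds hB (q := qo) (p := po) (m := 1)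
    (fun z hz => by
    have h1 : ‖z.2‖ ≤ R := by
      by_contra h; exact absurd (o0 z (not_le.1 h).le) (not_le.2 hz.1)
    rw [hqo, abs_neg, abs_of_pos hir, mul_comm]
    refine le_trans ?_ hirr.le
    refine mul_le_mul_of_nonneg_right ?_ hir.le
    linarith) zero_le_one l k z
  have bi := fun l k (z : ST n) => radialCutoff_bounds hB (q := qi) (p := -4 / 5) (m := mi)
    (fun z hz => by
      have h1 : ‖z.2‖ ≤ 3 / 2 * ε := by
        by_contra h; exact absurd (i1 z (not_le.1 h).le) (not_le.2 hz.2)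
      calc |qi| * ‖z.2‖ ≤ qi * (3 / 2 * ε) := by rw [abs_of_pos hqi0]; gcongr
        _ = mi := by rw [hqi, hmi]; field_simp; norm_num) hmi0 l k z
  have hqo1 : |qo| ≤ 1 := by
    rw [hqo, abs_neg, abs_of_pos hir]
    exact inv_le_one_of_one_le₀ (by linarith)
  set f : ST n → ℝ := radialCutoff qo po with hf
  set g : ST n → ℝ := radialCutoff qi (-4 / 5) with hg
  have fs : ContDiff ℝ ∞ f := contDiff_radialCutoff _ _
  have gs : ContDiff ℝ ∞ g := contDiff_radialCutoff _ _
  have fd := fs.differentiable (by simp)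
  have gd := gs.differentiable (by simp)
  have fkd : ∀ k, Differentiable ℝ (dd (ex k) f) :=
    fun k => (contDiff_dd (m := ∞) fs (by simp) _).differentiable (by simp)
  have gkd : ∀ k, Differentiable ℝ (dd (ex k) g) :=
    fun k => (contDiff_dd (m := ∞) gs (by simp) _).differentiable (by simp)
  have Xs : ContDiff ℝ ∞ (fun z : ST n => X z.1) := hX.comp contDiff_fst
  have Xd := Xs.differentiable (by simp)
  have fa : ∀ z, |f z| ≤ 1 := fun z => by
    rw [hf, radialCutoff, abs_of_nonneg (Real.smoothTransition.nonneg _)]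
    exact Real.smoothTransition.le_one _
  have ga : ∀ z, |g z| ≤ 1 := fun z => by
    rw [hg, radialCutoff, abs_of_nonneg (Real.smoothTransition.nonneg _)]
    exact Real.smoothTransition.le_one _
  have f1 : ∀ k z, |dd (ex k) f z| ≤ D := fun k z => (bo k k z).1.trans (by linarith [hDp.1, hDp.2])
  have g1 : ∀ k z, |dd (ex k) g z| ≤ D := fun k z => (bi k k z).1.trans (by linarith [hDp.1, hDp.2])
  have f2 : ∀ l k z, |dd (ex l) (dd (ex k) f) z| ≤ D := fun l k z => (bo l k z).2.1.trans (by
    have : 2 * B * |qo| ≤ 2 * B * 1 := by gcongr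
    linarith [hDp.1, hDp.2])
  have g2 : ∀ l k z, |dd (ex l) (dd (ex k) g) z| ≤ D := fun l k z =>
    (bi l k z).2.1.trans (by linarith [hDp.1, hDp.2])
  have dX : ∀ k (z : ST n), dd (ex k) (fun z : ST n => X z.1) z = 0 := fun k z => by
    rw [dd_comp_fst hXd]; simp [ex]
  have d1 : ∀ k, dd (ex k) (fun z => X z.1 * (f z * g z))
      = fun z => X z.1 * (dd (ex k) f z * g z + f z * dd (ex k) g z) := by
    intro k; funext z
    rw [dd_mul _ Xd (fd.fun_mul gd), dX, dd_mul _ fd gd]; ring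
  have d2 : ∀ l k z, dd (ex l) (dd (ex k) (fun z => X z.1 * (f z * g z))) z
      = X z.1 * (dd (ex l) (dd (ex k) f) z * g z + dd (ex k) f z * dd (ex l) g z
        + (dd (ex l) f z * dd (ex k) g z + f z * dd (ex l) (dd (ex k) g) z)) := by
    intro l k z
    rw [d1, dd_mul _ Xd (((fkd k).fun_mul gd).fun_add (fd.fun_mul (gkd k))), dX,
      dd_add _ ((fkd k).fun_mul gd) (fd.fun_mul (gkd k)), dd_mul _ (fkd k) gd, dd_mul _ fd (gkd k)]
    ring
  have d3 : ∀ z : ST n, dd et (fun z => X z.1 * (f z * g z)) z = deriv X z.1 * (f z * g z) := by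
    intro z
    rw [dd_mul _ Xd (fd.fun_mul gd), dd_comp_fst hXd, dd_mul _ fd gd, hf, hg, dd_et_radialCutoff,
      dd_et_radialCutoff]
    simp [et]
  have mul_bd : ∀ {a b s t : ℝ}, |a| ≤ s → |b| ≤ t → |a * b| ≤ s * t := fun ha hb => by
    rw [abs_mul]; exact mul_le_mul ha hb (abs_nonneg _) ((abs_nonneg _).trans ha)
  refine ⟨fun z => X z.1 * (f z * g z), Xs.mul (fs.mul gs), fun z hz => ?_,
    fun z h1 h2 h3 => ?_, fun k z => ?_, fun l k z => ?_, fun z => ?_, fun z hz => ?_,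
    fun z h1 h2 l k => ?_⟩
  · by_cases h1 : z.1 ∈ Icc (1 / 8 : ℝ) (7 / 8)
    · rcases lt_or_ge ‖z.2‖ ε with h2 | h2
      · simp only [hg, radialCutoff, Real.smoothTransition.zero_of_nonpos (i0 z h2.le), mul_zero]
      · rcases lt_or_ge R ‖z.2‖ with h3 | h3
        · simp only [hf, radialCutoff, Real.smoothTransition.zero_of_nonpos (o0 z h3.le), mul_zero,
            zero_mul]
        · exact absurd ⟨h1, h2, h3⟩ hz
    · simp only [hX0 _ h1, zero_mul]
  · simp only [hf, hg, radialCutoff, Real.smoothTransition.one_of_one_le (o1 z h3),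
      Real.smoothTransition.one_of_one_le (i1 z (by linarith)), mul_one]
    exact hX1 _ ⟨by linarith [h1.1], by linarith [h1.2]⟩
  · rw [d1]
    have := mul_bd (hXa z.1) ((abs_add_le _ _).trans (add_le_add (mul_bd (f1 k z) (ga z))
      (mul_bd (fa z) (g1 k z))))
    nlinarith [sq_nonneg D]
  · rw [d2]
    have := mul_bd (hXa z.1) ((abs_add_le _ _).trans (add_le_add
      ((abs_add_le _ _).trans (add_le_add (mul_bd (f2 l k z) (ga z)) (mul_bd (f1 k z) (g1 l z))))
      ((abs_add_le _ _).trans (add_le_add (mul_bd (f1 l z) (g1 k z)) (mul_bd (fa z) (g2 l k z))))))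
    nlinarith [sq_nonneg D]
  · rw [d3]
    have := mul_bd (hT' z.1) (mul_bd (fa z) (ga z))
    nlinarith [sq_nonneg D]
  · rw [d3]
    have : deriv X z.1 = 0 := by
      have he : (X : ℝ → ℝ) =ᶠ[𝓝 z.1] fun _ => 1 := by
        filter_upwards [isOpen_Ioo.mem_nhds hz] with y hy using hX1 y hy
      rw [he.deriv_eq, deriv_const]
    rw [this, zero_mul]
  · have wo : weight qo po (fun _ => 1) z ∉ Ioo (0 : ℝ) 1 := by
      intro h
      refine h2 ⟨?_, ?_⟩
      · by_contra h'; exact absurd (o1 z (not_lt.1 h')) (not_le.2 h.2)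
      · by_contra h'; exact absurd (o0 z (not_lt.1 h')) (not_le.2 h.1)
    have wi : weight qi (-4 / 5) (fun _ => 1) z ∉ Ioo (0 : ℝ) 1 := by
      intro h
      refine h1 ⟨?_, ?_⟩
      · by_contra h'; exact absurd (i0 z (not_lt.1 h')) (not_le.2 h.1)
      · by_contra h'; exact absurd (i1 z (not_lt.1 h')) (not_le.2 h.2)
    have a1 := fun l k => (bo l k z).2.2 wo
    have a2 := fun l k => (bi l k z).2.2 wi
    rw [d2, d1]
    simp only [(a1 _ _).2, (a2 _ _).2, (a1 l l).1, (a2 l l).1, (a1 k k).1,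
      (a2 k k).1]
    simp

end Cutoffs

/-! ### Weighted bounds for the cutoff terms -/

section LowerBound

open Filter Topology

variable {n : ℕ} {lam Lam K δ₀ ε R B c : ℝ} {a : Fin n → Fin n → Rn n → ℝ}

/-- A time profile `b` for the Carleman weight: `b ≤ 2`, with `b = 2` on `[1/4, 3/4]` and
`b = 0` outside `(3/16, 13/16)`. -/
structure IsTimeProfile (b : ℝ → ℝ) (Bb : ℝ) : Prop where
  smooth : ContDiff ℝ ∞ b
  deriv₂ : ∀ t, |deriv (deriv b) t| ≤ Bb
  le_two : ∀ t, b t ≤ 2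
  eq_two : ∀ t ∈ Icc (1 / 4 : ℝ) (3 / 4), b t = 2
  eq_zero : ∀ t ∉ Ioo (3 / 16 : ℝ) (13 / 16), b t = 0

lemma exists_isTimeProfile : ∃ b Bb, IsTimeProfile b Bb := by
  let X : ContDiffBump (1 / 2 : ℝ) := ⟨1 / 4, 5 / 16, by norm_num, by norm_num⟩
  have hX : ContDiff ℝ ∞ (fun t => 2 * X t) := contDiff_const.mul X.contDiff
  have h1 := (contDiff_infty_iff_deriv.mp hX).2
  have h2 := (contDiff_infty_iff_deriv.mp h1).2
  have hcs : HasCompactSupport (fun t => 2 * X t) := X.hasCompactSupport.mul_left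
  obtain ⟨Bb, hBb⟩ := (hcs.deriv.deriv).exists_bound_of_continuous h2.continuous
  refine ⟨fun t => 2 * X t, Bb, hX, hBb,
    fun t => by linarith [X.le_one (x := t)], fun t ht => ?_, fun t ht => ?_⟩
  · have : X t = 1 := by
      refine X.one_of_mem_closedBall ?_
      change dist t _ ≤ (1 / 4 : ℝ)
      rw [Real.dist_eq, abs_le]
      constructor <;> linarith [ht.1, ht.2]
    simp only [this, mul_one]
  · have : X t = 0 := by
      refine X.zero_of_le_dist ?_
      change (5 / 16 : ℝ) ≤ _
      rw [Real.dist_eq]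
      by_contra h
      have := abs_lt.1 (not_le.1 h)
      exact ht ⟨by linarith, by linarith⟩
    simp only [this, mul_zero]

/-- The part of `cutoffTerm` that involves derivatives of the cutoff. -/
noncomputable def cutoffError (a : Fin n → Fin n → Rn n → ℝ) (ζ U V : ST n → ℝ)
    (G : Fin n → ST n → ℝ) (z : ST n) : ℝ :=
  2 * ∑ k, ∑ j, stA a k j z * G j z * dd (ex k) ζ z + U z * divA ex (stA a) ζ z - dd et ζ z * V z

lemma divA_ex_stA (ha : CoeffBounds lam Lam K δ₀ a) {ζ : ST n → ℝ} (hζ : ContDiff ℝ ∞ ζ)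
    (z : ST n) : divA ex (stA a) ζ z = ∑ k, ∑ j, (dd (stdVec k) (a k j) z.2 * dd (ex j) ζ z
      + a k j z.2 * dd (ex k) (dd (ex j) ζ) z) := by
  have hA : ∀ k j, Differentiable ℝ (stA a k j) :=
    fun k j => (contDiff_stA ha k j).differentiable (by norm_num)
  have hd : ∀ j, Differentiable ℝ (dd (ex j) ζ) :=
    fun j => (contDiff_dd (m := ∞) hζ (by simp) _).differentiable (by simp)
  refine Finset.sum_congr rfl fun k _ => ?_
  rw [dd_sum _ fun j => (hA k j).fun_mul (hd j)]
  refine Finset.sum_congr rfl fun j _ => ?_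
  rw [dd_mul _ (hA k j) (hd j), dd_ex_stA ha]
  rfl

/-- The constant in the pointwise bound of `cutoffError`. -/
def errorConst (n : ℕ) (Lam K B : ℝ) : ℝ :=
  2 * (n * (n * (Lam * B))) + n * (n * (K * B + Lam * B)) + B + 1

/-- The value of `e^{2φ}`, for the Carleman weight `φ`, at `b = 2` and `|x| = 3ε/2`. It bounds
`e^{2φ}` from above where derivatives of the cutoff are supported, apart from the outer shell, and
from below on the set where mass is assumed. -/
noncomputable def innerWeight (c ε R : ℝ) : ℝ :=
  Real.exp (2 * (2 * (c * R ^ 3) + c * R * (9 / 4 * ε ^ 2)))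

lemma abs_cutoffError_le (ha : CoeffBounds lam Lam K δ₀ a) {ζ : ST n → ℝ}
    (hζ : IsShellCutoff ε R B ζ) {U V : ST n → ℝ}
    {G : Fin n → ST n → ℝ} {z : ST n} {s : ℝ} (hU : |U z| ≤ s) (hV : |V z| ≤ s)
    (hG : ∀ j, |G j z| ≤ s) : |cutoffError a ζ U V G z| ≤ errorConst n Lam K B * s := by
  have hs : 0 ≤ s := (abs_nonneg _).trans hU
  have mul_bd : ∀ {a b s t : ℝ}, |a| ≤ s → |b| ≤ t → |a * b| ≤ s * t := fun ha hb => by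
    rw [abs_mul]; exact mul_le_mul ha hb (abs_nonneg _) ((abs_nonneg _).trans ha)
  have h1 : |∑ k, ∑ j, stA a k j z * G j z * dd (ex k) ζ z| ≤ n * (n * (Lam * s * B)) := by
    have := abs_sum_le_card_mul fun k => abs_sum_le_card_mul fun j =>
      mul_bd (mul_bd (ha.entry k j z.2) (hG j)) (hζ.space k z)
    simpa [stA] using this
  have h2 : |divA ex (stA a) ζ z| ≤ n * (n * (K * B + Lam * B)) := by
    rw [divA_ex_stA ha hζ.smooth]
    have := abs_sum_le_card_mul fun k => abs_sum_le_card_mul fun j => (abs_add_le _ _).trans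
      (add_le_add (mul_bd (ha.deriv_one k j k z.2) (hζ.space j z))
        (mul_bd (ha.entry k j z.2) (hζ.space₂ k j z)))
    simpa using this
  have h3 := mul_bd hU h2
  have h4 := mul_bd (hζ.time z) hV
  rw [abs_le] at h1 h3 h4 ⊢
  unfold cutoffError errorConst
  constructor <;> nlinarith [h1.1, h1.2, h3.1, h3.2, h4.1, h4.2]

/-- The weight on the support of the derivatives of the cutoff. On the outer shell `φ ≤ 3 c R³`.
On the inner shell and at times where the cutoff varies, `e^{2φ} ≤ innerWeight c ε R`: in the
second case `b = 0` and `φ = c R |x|² ≤ c R³`. -/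
lemma weighted_cutoffError_sq_le (ha : CoeffBounds lam Lam K δ₀ a) (hc : 0 ≤ c) (hR : 1 ≤ R)
    {ζ : ST n → ℝ} (hζ : IsShellCutoff ε R B ζ) {b : ℝ → ℝ} {Bb : ℝ} (hb : IsTimeProfile b Bb) {U V : ST n → ℝ}
    {G : Fin n → ST n → ℝ} {z : ST n} {e : ℝ} (hU : U z ^ 2 ≤ e) (hV : V z ^ 2 ≤ e)
    (hG : ∀ j, G j z ^ 2 ≤ e) :
    Real.exp (weightR c R b z) ^ 2 * cutoffError a ζ U V G z ^ 2
      ≤ errorConst n Lam K B ^ 2 * ((shell n ε R).indicator (fun _ => innerWeight c ε R * e) z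
        + (Icc (1 / 8 : ℝ) (7 / 8) ×ˢ (ball0 n R \ ball0 n (R - 1))).indicator
          (fun _ => Real.exp (6 * (c * R ^ 3)) * e) z) := by
  have he : 0 ≤ e := (sq_nonneg _).trans hU
  have hR0 : 0 ≤ R := by linarith
  have p1 : 0 ≤ c * R ^ 3 := by positivity
  have p2 : 0 ≤ c * R := by positivity
  have hP : 0 < innerWeight c ε R := Real.exp_pos _
  have hQ : cutoffError a ζ U V G z ^ 2 ≤ errorConst n Lam K B ^ 2 * e := by
    have := abs_cutoffError_le ha hζ (Real.abs_le_sqrt hU) (Real.abs_le_sqrt hV)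
      fun j => Real.abs_le_sqrt (hG j)
    calc cutoffError a ζ U V G z ^ 2 = |cutoffError a ζ U V G z| ^ 2 := (sq_abs _).symm
      _ ≤ (errorConst n Lam K B * Real.sqrt e) ^ 2 := by gcongr
      _ = _ := by rw [mul_pow, Real.sq_sqrt he]
  have hexp : ∀ {y : ℝ}, weightR c R b z ≤ y →
      Real.exp (weightR c R b z) ^ 2 ≤ Real.exp (2 * y) := by
    intro y hy
    rw [← Real.exp_nat_mul]
    exact Real.exp_le_exp.2 (by push_cast; linarith)
  have n0 := indicator_nonneg (s := shell n ε R) (f := fun _ => innerWeight c ε R * e)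
    (fun _ _ => by positivity) z
  have n1 := indicator_nonneg (s := Icc (1 / 8 : ℝ) (7 / 8) ×ˢ (ball0 n R \ ball0 n (R - 1)))
    (f := fun _ => Real.exp (6 * (c * R ^ 3)) * e) (fun _ _ => by positivity) z
  have hzero : cutoffError a ζ U V G z = 0 → Real.exp (weightR c R b z) ^ 2
      * cutoffError a ζ U V G z ^ 2 ≤ errorConst n Lam K B ^ 2 *
        ((shell n ε R).indicator (fun _ => innerWeight c ε R * e) z
        + (Icc (1 / 8 : ℝ) (7 / 8) ×ˢ (ball0 n R \ ball0 n (R - 1))).indicator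
          (fun _ => Real.exp (6 * (c * R ^ 3)) * e) z) := by
    intro h
    rw [h]; simp only [ne_eq, OfNat.ofNat_ne_zero, not_false_eq_true, zero_pow, mul_zero]
    positivity
  by_cases hz : z ∈ shell n ε R
  swap
  · refine hzero ?_
    have hcl := (isCompact_shell (n := n) ε R).isClosed
    have d1 : ∀ v, ∀ z ∉ shell n ε R, dd v ζ z = 0 := dd_eq_zero_of_notMem hcl hζ.eq_zero
    have d2 := fun v w => dd_eq_zero_of_notMem hcl (d1 v) w z hz
    unfold cutoffError
    rw [divA_ex_stA ha hζ.smooth]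
    simp [d1 _ z hz, d2]
  obtain ⟨hz1, hz2, hz3⟩ := id hz
  have hb2 := hb.le_two z.1
  have inner : Real.exp (weightR c R b z) ^ 2 ≤ innerWeight c ε R → Real.exp (weightR c R b z) ^ 2
      * cutoffError a ζ U V G z ^ 2 ≤ errorConst n Lam K B ^ 2 *
        ((shell n ε R).indicator (fun _ => innerWeight c ε R * e) z
        + (Icc (1 / 8 : ℝ) (7 / 8) ×ˢ (ball0 n R \ ball0 n (R - 1))).indicator
          (fun _ => Real.exp (6 * (c * R ^ 3)) * e) z) := by
    intro h
    rw [indicator_of_mem hz]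
    calc _ ≤ innerWeight c ε R * (errorConst n Lam K B ^ 2 * e) := by gcongr
      _ = errorConst n Lam K B ^ 2 * (innerWeight c ε R * e + 0) := by ring
      _ ≤ _ := by gcongr
  have wb : c * R ^ 3 * b z.1 ≤ 2 * (c * R ^ 3) := by nlinarith
  by_cases ho : ‖z.2‖ ∈ Ioo (R - 1) R
  · have hmem : z ∈ Icc (1 / 8 : ℝ) (7 / 8) ×ˢ (ball0 n R \ ball0 n (R - 1)) := by
      refine ⟨hz1, ?_, ?_⟩
      · simpa [ball0] using hz3
      · simpa [ball0] using ho.1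
    have hw : weightR c R b z ≤ 3 * (c * R ^ 3) := by
      have : c * R * ‖z.2‖ ^ 2 ≤ c * R * R ^ 2 := by gcongr
      simp only [weightR, weight]
      nlinarith
    rw [indicator_of_mem hmem]
    calc _ ≤ Real.exp (2 * (3 * (c * R ^ 3))) * (errorConst n Lam K B ^ 2 * e) := by
          gcongr; exact hexp hw
      _ = errorConst n Lam K B ^ 2 * (0 + Real.exp (6 * (c * R ^ 3)) * e) := by
          rw [← mul_assoc (2 : ℝ)]; norm_num; ring
      _ ≤ _ := by gcongr
  by_cases hi : ‖z.2‖ ∈ Ioo ε (3 / 2 * ε)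
  · refine inner (hexp ?_)
    have : c * R * ‖z.2‖ ^ 2 ≤ c * R * (3 / 2 * ε) ^ 2 := by gcongr; exact hi.2.le
    simp only [weightR, weight]
    nlinarith
  · have hsp := hζ.space_eq_zero z hi ho
    have herr : cutoffError a ζ U V G z = -(dd et ζ z * V z) := by
      unfold cutoffError
      rw [divA_ex_stA ha hζ.smooth]
      simp [(hsp _ _).2, fun k => (hsp k k).1]
    by_cases ht : z.1 ∈ Ioo (3 / 16 : ℝ) (13 / 16)
    · exact hzero (by rw [herr, hζ.time_eq_zero z ht]; simp)
    · refine inner (hexp ?_)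
      have : c * R * ‖z.2‖ ^ 2 ≤ c * R * R ^ 2 := by gcongr
      have h9 : 0 ≤ c * R * (9 / 4 * ε ^ 2) := by positivity
      simp only [weightR, weight, hb.eq_zero _ ht]
      nlinarith

lemma cutoffTerm_eq (a : Fin n → Fin n → Rn n → ℝ) (ζ U V : ST n → ℝ) (G : Fin n → ST n → ℝ)
    (W : ST n → ℝ) (z : ST n) :
    cutoffTerm a ζ U V G W z = cutoffError a ζ U V G z - ζ z * W z := by
  unfold cutoffTerm cutoffError; ring

lemma weighted_cutoffTerm_sq_le (w : ℝ) (a : Fin n → Fin n → Rn n → ℝ) (ζ U V : ST n → ℝ)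
    (G : Fin n → ST n → ℝ) (W : ST n → ℝ) (z : ST n) :
    (w * cutoffTerm a ζ U V G W z) ^ 2
      ≤ 2 * (w ^ 2 * ζ z ^ 2 * W z ^ 2) + 2 * (w ^ 2 * cutoffError a ζ U V G z ^ 2) := by
  rw [cutoffTerm_eq]
  nlinarith [sq_nonneg (w * cutoffError a ζ U V G z + w * (ζ z * W z))]

lemma weighted_cutoffTerm_sq_add_le (ha : CoeffBounds lam Lam K δ₀ a) (hc : 0 ≤ c) (hR : 1 ≤ R)
    {ζ : ST n → ℝ} (hζ : IsShellCutoff ε R B ζ) {b : ℝ → ℝ} {Bb M : ℝ} (hb : IsTimeProfile b Bb)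
    {U₁ U₂ W₁ W₂ : ST n → ℝ} {G₁ G₂ : Fin n → ST n → ℝ} {z : ST n} {e : ST n → ℝ}
    (he : e z = U₁ z ^ 2 + U₂ z ^ 2 + ∑ j, (G₁ j z ^ 2 + G₂ j z ^ 2))
    (hW : z ∈ shell n ε R → W₁ z ^ 2 + W₂ z ^ 2 ≤ M ^ 2 * (U₁ z ^ 2 + U₂ z ^ 2)) :
    (Real.exp (weightR c R b z) * cutoffTerm a ζ U₁ U₂ G₁ W₁ z) ^ 2
        + (Real.exp (weightR c R b z) * cutoffTerm a ζ U₂ (fun z => -U₁ z) G₂ W₂ z) ^ 2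
      ≤ 2 * M ^ 2 * (Real.exp (weightR c R b z) ^ 2 * ζ z ^ 2 * (U₁ z ^ 2 + U₂ z ^ 2))
        + 4 * errorConst n Lam K B ^ 2 * innerWeight c ε R * (shell n ε R).indicator e z
        + 4 * errorConst n Lam K B ^ 2 * Real.exp (6 * (c * R ^ 3))
          * (Icc (1 / 8 : ℝ) (7 / 8) ×ˢ (ball0 n R \ ball0 n (R - 1))).indicator e z := by
  have hG : ∀ j, G₁ j z ^ 2 + G₂ j z ^ 2 ≤ ∑ j, (G₁ j z ^ 2 + G₂ j z ^ 2) := fun j =>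
    Finset.single_le_sum (f := fun j => G₁ j z ^ 2 + G₂ j z ^ 2) (fun _ _ => by positivity)
      (Finset.mem_univ j)
  have hs : 0 ≤ ∑ j, (G₁ j z ^ 2 + G₂ j z ^ 2) := Finset.sum_nonneg fun _ _ => by positivity
  have p1 := sq_nonneg (U₁ z)
  have p2 := sq_nonneg (U₂ z)
  have u1 : U₁ z ^ 2 ≤ e z := by linarith
  have u2 : U₂ z ^ 2 ≤ e z := by linarith
  have q1 := weighted_cutoffError_sq_le ha hc hR hζ hb u1 u2 (G := G₁)
    fun j => by linarith [hG j, sq_nonneg (G₂ j z)]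
  have q2 := weighted_cutoffError_sq_le ha hc hR hζ hb (U := U₂) (V := fun z => -U₁ z) (G := G₂)
    u2 (by simpa using u1) fun j => by linarith [hG j, sq_nonneg (G₁ j z)]
  have ind : ∀ (S : Set (ST n)) (x : ℝ),
      S.indicator (fun _ => x * e z) z = x * S.indicator e z := by
    intro S x
    by_cases h : z ∈ S <;> simp [h]
  rw [ind, ind] at q1 q2
  have hW' : Real.exp (weightR c R b z) ^ 2 * ζ z ^ 2 * (W₁ z ^ 2 + W₂ z ^ 2)
      ≤ M ^ 2 * (Real.exp (weightR c R b z) ^ 2 * ζ z ^ 2 * (U₁ z ^ 2 + U₂ z ^ 2)) := by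
    by_cases h : z ∈ shell n ε R
    · calc _ ≤ Real.exp (weightR c R b z) ^ 2 * ζ z ^ 2 * (M ^ 2 * (U₁ z ^ 2 + U₂ z ^ 2)) := by
            gcongr; exact hW h
        _ = _ := by ring
    · simp [hζ.eq_zero z h]
  have c1 := weighted_cutoffTerm_sq_le (Real.exp (weightR c R b z)) a ζ U₁ U₂ G₁ W₁ z
  have c2 := weighted_cutoffTerm_sq_le (Real.exp (weightR c R b z)) a ζ U₂ (fun z => -U₁ z) G₂ W₂ z
  linarith

lemma measurable_cutoffTerm (ha : CoeffBounds lam Lam K δ₀ a) {ζ : ST n → ℝ} (hζ : ContDiff ℝ ∞ ζ)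
    {U V W : ST n → ℝ} {G : Fin n → ST n → ℝ} (hU : Measurable U) (hV : Measurable V)
    (hG : ∀ j, Measurable (G j)) (hW : Measurable W) : Measurable (cutoffTerm a ζ U V G W) := by
  have hA : ∀ k j, Measurable (stA a k j) := fun k j => (contDiff_stA ha k j).continuous.measurable
  have hd : ∀ v, Measurable (dd v ζ) := fun v =>
    (contDiff_dd (m := 0) hζ (by simp) v).continuous.measurable
  have hL : Measurable (divA ex (stA a) ζ) :=
    (contDiff_divA (m := 0) (r := 1) (l := 2) (fun k j => (contDiff_stA ha k j).of_le
      (by norm_num)) (hζ.of_le ENat.LEInfty.out) (by norm_num)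
      (by norm_num)).continuous.measurable
  exact (((hζ.continuous.measurable.mul hW).neg.add ((Finset.measurable_fun_sum _ fun k _ =>
    Finset.measurable_fun_sum _ fun j _ => ((hA k j).mul (hG j)).mul (hd _)).const_mul 2)).add
    (hU.mul hL)).sub ((hd et).mul hV)

lemma L1L2.eLpNorm_mul_ne_top {w ζ U : ST n → ℝ} (hU : L1L2 U) (hw : Continuous w)
    (hζ : Continuous ζ) {S : Set (ST n)} (hS : IsCompact S) (hζ0 : ∀ z ∉ S, ζ z = 0) :
    eLpNorm (fun z => w z * (ζ z * U z)) 2 volume ≠ ⊤ := by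
  obtain ⟨C, hC⟩ := exists_abs_le_of_continuous_of_notMem (c := fun z => w z * ζ z) (hw.mul hζ)
    hS fun z hz => by rw [hζ0 z hz, mul_zero]
  have := hU.sq.of_le_mul (f := fun z => w z * (ζ z * U z)) (c := C)
    (hw.measurable.mul (hζ.measurable.mul hU.meas)).aestronglyMeasurable
    (Eventually.of_forall fun z => by
      rw [← mul_assoc, norm_mul]
      exact mul_le_mul_of_nonneg_right (hC z) (norm_nonneg _))
  exact this.2.ne

lemma energy_eq {u : ℝ → Rn n → ℂ} {Du : ℝ → Rn n → EuclideanSpace ℂ (Fin n)}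
    (hu : MemL2locH1 u Du) (S : Set (Rn n)) :
    energy u Du (1 / 8) (7 / 8) S
      = ∫⁻ z in Icc (1 / 8 : ℝ) (7 / 8) ×ˢ S, (‖u z.1 z.2‖ₑ ^ 2 + ‖Du z.1 z.2‖ₑ ^ 2) := by
  have hle : (volume : Measure (ST n)).restrict (Icc (1 / 8 : ℝ) (7 / 8) ×ˢ S)
      ≤ (volume.restrict (Ioo (0 : ℝ) 1)).prod volume := by
    rw [← Measure.restrict_univ (μ := (volume : Measure (Rn n))), Measure.prod_restrict,
      ← Measure.volume_eq_prod]
    refine Measure.restrict_mono (prod_mono (fun t ht => ?_) (subset_univ _)) le_rfl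
    exact ⟨by linarith [ht.1], by linarith [ht.2]⟩
  have hm : AEMeasurable (fun z : ST n => ‖u z.1 z.2‖ₑ ^ 2 + ‖Du z.1 z.2‖ₑ ^ 2)
      (volume.restrict (Icc (1 / 8 : ℝ) (7 / 8) ×ˢ S)) :=
    ((hu.1.mono_measure hle).enorm.pow_const 2).add ((hu.2.1.mono_measure hle).enorm.pow_const 2)
  rw [Measure.volume_eq_prod] at hm ⊢
  rw [setLIntegral_prod _ hm]
  rfl

lemma mass_eq {u : ℝ → Rn n → ℂ} {Du : ℝ → Rn n → EuclideanSpace ℂ (Fin n)}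
    (hu : MemL2locH1 u Du) (S : Set (Rn n)) :
    mass u (1 / 4) (3 / 4) S = ∫⁻ z in Icc (1 / 4 : ℝ) (3 / 4) ×ˢ S, ‖u z.1 z.2‖ₑ ^ 2 := by
  have hle : (volume : Measure (ST n)).restrict (Icc (1 / 4 : ℝ) (3 / 4) ×ˢ S)
      ≤ (volume.restrict (Ioo (0 : ℝ) 1)).prod volume := by
    rw [← Measure.restrict_univ (μ := (volume : Measure (Rn n))), Measure.prod_restrict,
      ← Measure.volume_eq_prod]
    refine Measure.restrict_mono (prod_mono (fun t ht => ?_) (subset_univ _)) le_rfl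
    exact ⟨by linarith [ht.1], by linarith [ht.2]⟩
  have hm : AEMeasurable (fun z : ST n => ‖u z.1 z.2‖ₑ ^ 2)
      (volume.restrict (Icc (1 / 4 : ℝ) (3 / 4) ×ˢ S)) :=
    (hu.1.mono_measure hle).enorm.pow_const 2
  rw [Measure.volume_eq_prod] at hm ⊢
  rw [setLIntegral_prod _ hm]
  rfl

lemma eLpNorm_two_sq_eq_lintegral (f : ST n → ℝ) :
    eLpNorm f 2 volume ^ 2 = ∫⁻ z, ENNReal.ofReal (f z ^ 2) := by
  have := eLpNorm_nnreal_pow_eq_lintegral (p := 2) (μ := (volume : Measure (ST n))) (f := f)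
    (by norm_num)
  simp only [NNReal.coe_ofNat, ENNReal.coe_ofNat, ENNReal.rpow_ofNat] at this
  rw [this]
  refine lintegral_congr fun z => ?_
  rw [← ofReal_norm, ← ENNReal.ofReal_pow (norm_nonneg _), Real.norm_eq_abs, sq_abs]

lemma norm_ofReal_add_I_mul_sq (x y : ℝ) : ‖(x : ℂ) + Complex.I * y‖ ^ 2 = x ^ 2 + y ^ 2 := by
  rw [← Complex.normSq_eq_norm_sq, mul_comm, Complex.normSq_add_mul_I]

end LowerBound

/-! ### Mass below energy, and the lower bound -/

section Conclusion

open Filter Topology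

variable {n : ℕ} {lam Lam K δ₀ ε R B c : ℝ} {a : Fin n → Fin n → Rn n → ℝ}

/-- The Carleman inequality for `ζ u` in terms of mass and energies of `u`. The potential is
absorbed because `κ = c R³` is large. -/
lemma mass_le_energy {A : Rn n → Matrix (Fin n) (Fin n) ℝ} {V : ST n → ℂ}
    {u : ℝ → Rn n → ℂ} {Du : ℝ → Rn n → EuclideanSpace ℂ (Fin n)} {M Bb R₀ : ℝ} {b : ℝ → ℝ}
    (ha : CoeffBounds lam Lam K δ₀ fun k j x => A x k j)
    (hlam : 0 < lam) (hLam : 0 ≤ Lam) (hK0 : 0 ≤ K) (hsmall : 2 * (n : ℝ) ^ 4 * Lam * δ₀ ≤ lam ^ 2)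
    (hb : IsTimeProfile b Bb) (hε : 0 < ε) (hc : c = (Bb + 1) / (lam * ε))
    (hR1 : 1 ≤ R) (hR : 2 * n ^ 4 * (K + Lam) * K ≤ R) (hR₀ : R₀ ≤ R - 1)
    (hM : 4 * M ^ 2 ≤ c * R ^ 3) {ζ : ST n → ℝ} (hζ : IsShellCutoff ε R B ζ)
    (hV : AEStronglyMeasurable V volume) (hVM : ∀ᵐ z, ‖V z‖ ≤ M)
    (hu : MemL2locH1 u Du) (hsol : IsWeakSolution A V u Du) :
    ENNReal.ofReal (c * R ^ 3) * (ENNReal.ofReal (innerWeight c ε R) *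
        mass u (1 / 4) (3 / 4) (ball0 n R₀ \ ball0 n (2 * ε)))
      ≤ ENNReal.ofReal (8 * errorConst n Lam K B ^ 2) *
        (ENNReal.ofReal (innerWeight c ε R) * energy u Du (1 / 8) (7 / 8) univ
        + ENNReal.ofReal (Real.exp (6 * (c * R ^ 3)))
          * energy u Du (1 / 8) (7 / 8) (ball0 n R \ ball0 n (R - 1))) := by
  have hBb0 : 0 ≤ Bb := (abs_nonneg _).trans (hb.deriv₂ 0)
  have hc0 : 0 < c := by rw [hc]; positivity
  have hR0 : 0 ≤ R := by linarith
  have hA : ∀ j k, Continuous fun x => A x j k := fun j k => (ha.smooth j k).continuous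
  obtain ⟨U₁, U₂, W₁, W₂, G₁, G₂, hU, hae⟩ := exists_realSolution hA hV hVM hu hsol (R + 1)
  set a : Fin n → Fin n → Rn n → ℝ := fun k j x => A x k j with hadef
  have carl := hU.carleman ha hlam hLam hK0 hsmall hb.smooth hε hb.deriv₂ hR1 hR hc hζ.smooth
    hζ.eq_zero
  set w : ST n → ℝ := fun z => Real.exp (weightR c R b z) with hw
  have hwc : Continuous w := Real.continuous_exp.comp (contDiff_weight hb.smooth).continuous
  set S := shell n ε R with hS
  have hSm : MeasurableSet S := (isCompact_shell ε R).isClosed.measurableSet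
  set T : Set (ST n) := Icc (1 / 8 : ℝ) (7 / 8) ×ˢ (ball0 n R \ ball0 n (R - 1)) with hT
  have hTm : MeasurableSet T := measurableSet_Icc.prod
    (Metric.isClosed_closedBall.measurableSet.diff Metric.isClosed_closedBall.measurableSet)
  have hScyl : S ⊆ cyl n (R + 1) := by
    rintro z ⟨h1, h2, h3⟩
    refine ⟨⟨by linarith [h1.1], by linarith [h1.2]⟩, ?_⟩
    rw [Metric.mem_closedBall, dist_zero_right]; linarith
  have hTcyl : T ⊆ cyl n (R + 1) := by
    rintro z ⟨h1, h2, h3⟩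
    refine ⟨⟨by linarith [h1.1], by linarith [h1.2]⟩, ?_⟩
    simp only [ball0, Metric.mem_closedBall, dist_zero_right] at h2 ⊢; linarith
  -- the real densities of mass and energy
  set f : ST n → ℝ := fun z => U₁ z ^ 2 + U₂ z ^ 2 with hf
  set e : ST n → ℝ := fun z => f z + ∑ j, (G₁ j z ^ 2 + G₂ j z ^ 2) with he
  have fm : Measurable f := (hU.u₁.meas.pow_const 2).add (hU.u₂.meas.pow_const 2)
  have em : Measurable e := fm.add (Finset.measurable_fun_sum _ fun j _ =>
    ((hU.g₁ j).meas.pow_const 2).add ((hU.g₂ j).meas.pow_const 2))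
  have f0 : ∀ z, 0 ≤ f z := fun z => by positivity
  have e0 : ∀ z, 0 ≤ e z := fun z => by positivity
  have hfu : ∀ᵐ z : ST n, z ∈ cyl n (R + 1) → ‖u z.1 z.2‖ₑ ^ 2 = ENNReal.ofReal (f z) := by
    filter_upwards [hae] with z hz hzc
    rw [(hz hzc).1, ← ofReal_norm, ← ENNReal.ofReal_pow (norm_nonneg _), norm_ofReal_add_I_mul_sq]
  have heu : ∀ᵐ z : ST n, z ∈ cyl n (R + 1) →
      ‖u z.1 z.2‖ₑ ^ 2 + ‖Du z.1 z.2‖ₑ ^ 2 = ENNReal.ofReal (e z) := by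
    filter_upwards [hae, hfu] with z hz hzf hzc
    rw [hzf hzc, ← ofReal_norm, ← ENNReal.ofReal_pow (norm_nonneg _), EuclideanSpace.norm_sq_eq,
      ← ENNReal.ofReal_add (f0 z) (by positivity)]
    congr 2
    exact Finset.sum_congr rfl fun j _ => by rw [(hz hzc).2.2 j, norm_ofReal_add_I_mul_sq]
  have hWf : ∀ᵐ z : ST n, z ∈ cyl n (R + 1) → W₁ z ^ 2 + W₂ z ^ 2 ≤ M ^ 2 * f z := by
    filter_upwards [hae, hVM] with z hz hzM hzc
    rw [← norm_ofReal_add_I_mul_sq, ← (hz hzc).2.1, norm_mul, mul_pow, (hz hzc).1,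
      norm_ofReal_add_I_mul_sq]
    gcongr
  -- the left-hand side of the Carleman inequality
  set I₀ : ENNReal := ∫⁻ z, ENNReal.ofReal (w z ^ 2 * ζ z ^ 2 * f z) with hI₀
  have hmul : ∀ U : ST n → ℝ, Measurable U →
      Measurable fun z => ENNReal.ofReal ((w z * (ζ z * U z)) ^ 2) := fun U hU =>
    ((hwc.measurable.mul (hζ.smooth.continuous.measurable.mul hU)).pow_const 2).ennreal_ofReal
  have lhs : eLpNorm (fun z => w z * (ζ z * U₁ z)) 2 volume ^ 2
      + eLpNorm (fun z => w z * (ζ z * U₂ z)) 2 volume ^ 2 = I₀ := by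
    rw [eLpNorm_two_sq_eq_lintegral, eLpNorm_two_sq_eq_lintegral,
      ← lintegral_add_left (hmul _ hU.u₁.meas)]
    refine lintegral_congr fun z => ?_
    rw [← ENNReal.ofReal_add (sq_nonneg _) (sq_nonneg _)]
    congr 1
    simp only [hf]; ring
  have hI₀top : I₀ ≠ ⊤ := by
    have hfin := fun (U : ST n → ℝ) (hU : L1L2 U) =>
      hU.eLpNorm_mul_ne_top hwc hζ.smooth.continuous (isCompact_shell ε R) hζ.eq_zero
    rw [← lhs]
    exact ENNReal.add_ne_top.2 ⟨ENNReal.pow_ne_top (hfin _ hU.u₁),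
      ENNReal.pow_ne_top (hfin _ hU.u₂)⟩
  -- the right-hand side of the Carleman inequality
  set N := errorConst n Lam K B with hN
  set P := innerWeight c ε R with hP
  set Q := Real.exp (6 * (c * R ^ 3)) with hQ
  have hP0 : 0 < P := Real.exp_pos _
  have hQ0 : 0 < Q := Real.exp_pos _
  have pointwise : ∀ᵐ z : ST n,
      (w z * cutoffTerm a ζ U₁ U₂ G₁ W₁ z) ^ 2
        + (w z * cutoffTerm a ζ U₂ (fun z => -U₁ z) G₂ W₂ z) ^ 2
      ≤ 2 * M ^ 2 * (w z ^ 2 * ζ z ^ 2 * f z) + 4 * N ^ 2 * P * S.indicator e z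
        + 4 * N ^ 2 * Q * T.indicator e z :=
    hWf.mono fun z hz => weighted_cutoffTerm_sq_add_le ha hc0.le hR1 hζ hb rfl
      fun h => hz (hScyl h)
  have rhs : eLpNorm (fun z => w z * cutoffTerm a ζ U₁ U₂ G₁ W₁ z) 2 volume ^ 2
        + eLpNorm (fun z => w z * cutoffTerm a ζ U₂ (fun z => -U₁ z) G₂ W₂ z) 2 volume ^ 2
      ≤ ENNReal.ofReal (2 * M ^ 2) * I₀ + (ENNReal.ofReal (4 * N ^ 2 * P)
          * (∫⁻ z in S, ENNReal.ofReal (e z))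
        + ENNReal.ofReal (4 * N ^ 2 * Q) * ∫⁻ z in T, ENNReal.ofReal (e z)) := by
    have hm : Measurable fun z => ENNReal.ofReal ((w z * cutoffTerm a ζ U₁ U₂ G₁ W₁ z) ^ 2) :=
      ((hwc.measurable.mul (measurable_cutoffTerm ha hζ.smooth hU.u₁.meas hU.u₂.meas
        (fun j => (hU.g₁ j).meas) hU.w₁.meas)).pow_const 2).ennreal_ofReal
    have hm' : Measurable fun z =>
        ENNReal.ofReal (4 * N ^ 2 * P) * S.indicator (fun z => ENNReal.ofReal (e z)) z
          + ENNReal.ofReal (4 * N ^ 2 * Q) * T.indicator (fun z => ENNReal.ofReal (e z)) z :=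
      ((em.ennreal_ofReal.indicator hSm).const_mul _).add
        ((em.ennreal_ofReal.indicator hTm).const_mul _)
    rw [eLpNorm_two_sq_eq_lintegral, eLpNorm_two_sq_eq_lintegral, ← lintegral_add_left hm,
      ← lintegral_indicator hSm, ← lintegral_indicator hTm,
      ← lintegral_const_mul' _ _ ENNReal.ofReal_ne_top,
      ← lintegral_const_mul' _ _ ENNReal.ofReal_ne_top,
      ← lintegral_const_mul' _ _ ENNReal.ofReal_ne_top,
      ← lintegral_add_right _ ((em.ennreal_ofReal.indicator hTm).const_mul _),
      ← lintegral_add_right _ hm']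
    refine lintegral_mono_ae (pointwise.mono fun z hz => ?_)
    have ind : ∀ S' : Set (ST n), S'.indicator (fun z => ENNReal.ofReal (e z)) z
        = ENNReal.ofReal (S'.indicator e z) := fun S' => by
      by_cases h : z ∈ S' <;> simp [h]
    have ind0 : ∀ S' : Set (ST n), 0 ≤ S'.indicator e z := fun S' =>
      indicator_nonneg (fun z _ => e0 z) z
    have n1 := ind0 S
    have n2 := ind0 T
    have n3 := f0 z
    simp only [ind]
    rw [← ENNReal.ofReal_add (sq_nonneg _) (sq_nonneg _), ← ENNReal.ofReal_mul (by positivity),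
      ← ENNReal.ofReal_mul (by positivity), ← ENNReal.ofReal_mul (by positivity),
      ← ENNReal.ofReal_add (by positivity) (by positivity),
      ← ENNReal.ofReal_add (by positivity) (by positivity), ← add_assoc]
    exact ENNReal.ofReal_le_ofReal hz
  have hSE : ∫⁻ z in S, ENNReal.ofReal (e z) ≤ energy u Du (1 / 8) (7 / 8) univ := by
    rw [energy_eq hu]
    calc ∫⁻ z in S, ENNReal.ofReal (e z)
        = ∫⁻ z in S, (‖u z.1 z.2‖ₑ ^ 2 + ‖Du z.1 z.2‖ₑ ^ 2) :=
          setLIntegral_congr_fun_ae hSm (heu.mono fun z hz h => (hz (hScyl h)).symm)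
      _ ≤ _ := lintegral_mono_set (prod_mono subset_rfl (subset_univ _))
  have hTE : ∫⁻ z in T, ENNReal.ofReal (e z)
      = energy u Du (1 / 8) (7 / 8) (ball0 n R \ ball0 n (R - 1)) := by
    rw [energy_eq hu]
    exact setLIntegral_congr_fun_ae hTm (heu.mono fun z hz h => (hz (hTcyl h)).symm)
  have hmass : ENNReal.ofReal P * mass u (1 / 4) (3 / 4) (ball0 n R₀ \ ball0 n (2 * ε)) ≤ I₀ := by
    rw [mass_eq hu, ← lintegral_const_mul' _ _ ENNReal.ofReal_ne_top]
    have hm : MeasurableSet (Icc (1 / 4 : ℝ) (3 / 4) ×ˢ (ball0 n R₀ \ ball0 n (2 * ε))) :=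
      measurableSet_Icc.prod
        (Metric.isClosed_closedBall.measurableSet.diff Metric.isClosed_closedBall.measurableSet)
    refine le_trans ?_ (setLIntegral_le_lintegral
      (Icc (1 / 4 : ℝ) (3 / 4) ×ˢ (ball0 n R₀ \ ball0 n (2 * ε))) _)
    refine lintegral_mono_ae ((ae_restrict_iff' hm).2 (hfu.mono fun z hz hzm => ?_))
    obtain ⟨h1, h2, h3⟩ := hzm
    simp only [ball0, Metric.mem_closedBall, dist_zero_right, not_le] at h2 h3
    have hzc : z ∈ cyl n (R + 1) := by
      refine ⟨⟨by linarith [h1.1], by linarith [h1.2]⟩, ?_⟩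
      rw [Metric.mem_closedBall, dist_zero_right]; linarith
    rw [hz hzc, ← ENNReal.ofReal_mul hP0.le, hζ.eq_one z h1 h3.le (h2.trans hR₀), one_pow, mul_one]
    refine ENNReal.ofReal_le_ofReal (mul_le_mul_of_nonneg_right ?_ (f0 z))
    rw [hw]
    simp only
    rw [← Real.exp_nat_mul, hP, innerWeight]
    refine Real.exp_le_exp.2 ?_
    push_cast
    have hcR : 0 ≤ c * R := by positivity
    have h4 : c * R * (9 / 4 * ε ^ 2) ≤ c * R * ‖z.2‖ ^ 2 := by
      gcongr
      nlinarith
    simp only [weightR, weight, hb.eq_two _ h1]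
    linarith
  -- absorbing the potential
  set X := mass u (1 / 4) (3 / 4) (ball0 n R₀ \ ball0 n (2 * ε))
  set E := energy u Du (1 / 8) (7 / 8) univ
  set F := energy u Du (1 / 8) (7 / 8) (ball0 n R \ ball0 n (R - 1))
  rw [lhs] at carl
  have h1 : ENNReal.ofReal (c * R ^ 3 / 2) * I₀
      ≤ ENNReal.ofReal (4 * N ^ 2 * P) * E + ENNReal.ofReal (4 * N ^ 2 * Q) * F := by
    have h2 : ENNReal.ofReal (2 * M ^ 2) * I₀ + ENNReal.ofReal (c * R ^ 3 / 2) * I₀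
        ≤ ENNReal.ofReal (2 * M ^ 2) * I₀
          + (ENNReal.ofReal (4 * N ^ 2 * P) * E + ENNReal.ofReal (4 * N ^ 2 * Q) * F) := by
      rw [← add_mul, ← ENNReal.ofReal_add (by positivity) (by positivity)]
      refine (mul_le_mul_left (ENNReal.ofReal_le_ofReal (by linarith)) _).trans
        (carl.trans (rhs.trans ?_))
      rw [hTE]
      gcongr
    exact (ENNReal.add_le_add_iff_left (ENNReal.mul_ne_top ENNReal.ofReal_ne_top hI₀top)).1 h2
  calc ENNReal.ofReal (c * R ^ 3) * (ENNReal.ofReal P * X)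
      = ENNReal.ofReal 2 * (ENNReal.ofReal (c * R ^ 3 / 2) * (ENNReal.ofReal P * X)) := by
        rw [← mul_assoc (ENNReal.ofReal 2), ← ENNReal.ofReal_mul zero_le_two]; congr 2; ring
    _ ≤ ENNReal.ofReal 2 * (ENNReal.ofReal (4 * N ^ 2 * P) * E
          + ENNReal.ofReal (4 * N ^ 2 * Q) * F) := by
        gcongr
        exact (mul_le_mul' le_rfl hmass).trans h1
    _ = _ := by
        have k1 : ENNReal.ofReal 2 * ENNReal.ofReal (4 * N ^ 2 * P)
            = ENNReal.ofReal (8 * N ^ 2) * ENNReal.ofReal P := by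
          rw [← ENNReal.ofReal_mul zero_le_two, ← ENNReal.ofReal_mul (by positivity)]; congr 1; ring
        have k2 : ENNReal.ofReal 2 * ENNReal.ofReal (4 * N ^ 2 * Q)
            = ENNReal.ofReal (8 * N ^ 2) * ENNReal.ofReal Q := by
          rw [← ENNReal.ofReal_mul zero_le_two, ← ENNReal.ofReal_mul (by positivity)]; congr 1; ring
        rw [mul_add, mul_add, ← mul_assoc, ← mul_assoc, ← mul_assoc, ← mul_assoc, k1, k2]

end Conclusion

lemma ae_norm_le_of_eLpNorm_top_le {n : ℕ} {V : ST n → ℂ} {M : ℝ}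
    (hV : eLpNorm V ⊤ volume ≤ ENNReal.ofReal M) : ∀ᵐ z, ‖V z‖ ≤ max M 0 := by
  rw [eLpNorm_exponent_top] at hV
  filter_upwards [ae_le_eLpNormEssSup (f := V) (μ := volume)] with z hz
  have h := (hz.trans hV).trans (ENNReal.ofReal_le_ofReal (le_max_left M 0))
  rw [← ofReal_norm, ENNReal.ofReal_le_ofReal_iff (le_max_right _ _)] at h
  exact h

/-- The gain `κ` beats the energy term with the same weight `P`, and the weight of the remaining
term exceeds `P` by at most the factor `e^{2κ}`. -/
lemma le_of_mass_le_energy {κ P E₁ E₂ D c : ℝ} {X E F : ENNReal} (hD : 0 < D) (hc : 0 < c)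
    (hE₂ : 0 < E₂) (hcκ : c ≤ κ) (hκ : 2 * D * E₁ ^ 2 ≤ E₂ ^ 2 * κ)
    (hP : Real.exp (4 * κ) ≤ P) (hX : ENNReal.ofReal (E₂ ^ 2) ≤ X)
    (hE : E ≤ ENNReal.ofReal (E₁ ^ 2)) (hFE : F ≤ E)
    (h : ENNReal.ofReal κ * (ENNReal.ofReal P * X) ≤ ENNReal.ofReal D *
      (ENNReal.ofReal P * E + ENNReal.ofReal (Real.exp (6 * κ)) * F)) :
    ENNReal.ofReal (c * E₂ ^ 2 / (2 * D) * Real.exp (-2 * κ)) ≤ F := by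
  have hκ0 : 0 < κ := hc.trans_le hcκ
  have hP0 : 0 < P := (Real.exp_pos _).trans_le hP
  have hF : F ≠ ⊤ := ne_top_of_le_ne_top ENNReal.ofReal_ne_top (hFE.trans hE)
  obtain ⟨y, hy0, rfl⟩ : ∃ y : ℝ, 0 ≤ y ∧ ENNReal.ofReal y = F :=
    ⟨F.toReal, ENNReal.toReal_nonneg, ENNReal.ofReal_toReal hF⟩
  have h2 : ENNReal.ofReal (κ * (P * E₂ ^ 2))
      ≤ ENNReal.ofReal (D * (P * E₁ ^ 2 + Real.exp (6 * κ) * y)) := by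
    rw [ENNReal.ofReal_mul hκ0.le, ENNReal.ofReal_mul hP0.le, ENNReal.ofReal_mul hD.le,
      ENNReal.ofReal_add (by positivity) (by positivity), ENNReal.ofReal_mul hP0.le,
      ENNReal.ofReal_mul (Real.exp_pos _).le]
    calc _ ≤ ENNReal.ofReal κ * (ENNReal.ofReal P * X) := by gcongr
      _ ≤ _ := h
      _ ≤ _ := by gcongr
  rw [ENNReal.ofReal_le_ofReal_iff (by positivity)] at h2
  refine ENNReal.ofReal_le_ofReal ?_
  have h3 : P * (κ * E₂ ^ 2 / 2) ≤ D * (Real.exp (6 * κ) * y) := by nlinarith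
  have h4 : Real.exp (4 * κ) * (κ * E₂ ^ 2 / 2) ≤ D * (Real.exp (6 * κ) * y) :=
    (mul_le_mul_of_nonneg_right hP (by positivity)).trans h3
  have h5 : Real.exp (6 * κ) = Real.exp (4 * κ) * Real.exp (2 * κ) := by
    rw [← Real.exp_add]; ring_nf
  have h6 : κ * E₂ ^ 2 / 2 ≤ D * (Real.exp (2 * κ) * y) := by
    refine le_of_mul_le_mul_left ?_ (Real.exp_pos (4 * κ))
    calc _ ≤ _ := h4
      _ = _ := by rw [h5]; ring
  rw [neg_mul, Real.exp_neg, ← div_eq_mul_inv, div_div, div_le_iff₀ (by positivity)]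
  have h7 : c * E₂ ^ 2 ≤ κ * E₂ ^ 2 := by gcongr
  linarith

end VarSchrodinger

theorem theorem4p2 :
    ∃ ε₀ : ℕ → ℝ → ℝ → ℝ, (∀ n lam Lam, 0 < lam → 0 < Lam → 0 < ε₀ n lam Lam) ∧
    ∀ lam ε : ℝ, 0 < lam → 0 < ε → ∃ C₀ : ℝ, 0 < C₀ ∧
    ∀ (n : ℕ) (Lam K M₁ E₁ E₂ R₀ : ℝ), 0 < Lam → 0 < E₂ →
    ∃ R₁ C : ℝ, 0 < R₁ ∧ 0 < C ∧
    ∀ (A : VarSchrodinger.Rn n → Matrix (Fin n) (Fin n) ℝ)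
      (V : ℝ × VarSchrodinger.Rn n → ℂ)
      (u : ℝ → VarSchrodinger.Rn n → ℂ)
      (Du : ℝ → VarSchrodinger.Rn n → EuclideanSpace ℂ (Fin n)),
      VarSchrodinger.IsSymmElliptic lam Lam A →
      (∀ j k, ContDiff ℝ 3 (fun x => A x j k)) →
      VarSchrodinger.normC3 A ≤ ENNReal.ofReal K →
      (⨆ x, ENNReal.ofReal (‖x‖ * VarSchrodinger.gradNorm A x)) <
        ENNReal.ofReal (ε₀ n lam Lam) →
      AEStronglyMeasurable V volume →
      eLpNorm V ⊤ volume ≤ ENNReal.ofReal M₁ →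
      VarSchrodinger.MemLinftyL2 u →
      VarSchrodinger.MemL2locH1 u Du →
      VarSchrodinger.IsWeakSolution A V u Du →
      VarSchrodinger.energy u Du (1 / 8) (7 / 8) univ ≤ ENNReal.ofReal (E₁ ^ 2) →
      ENNReal.ofReal (E₂ ^ 2) ≤
        VarSchrodinger.mass u (1 / 4) (3 / 4)
          (VarSchrodinger.ball0 n R₀ \ VarSchrodinger.ball0 n (2 * ε)) →
      ∀ R : ℝ, R₁ < R →
        ENNReal.ofReal (C * Real.exp (-C₀ * R ^ 3)) ≤
          VarSchrodinger.energy u Du (1 / 8) (7 / 8)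
            (VarSchrodinger.ball0 n R \ VarSchrodinger.ball0 n (R - 1)) := by
  obtain ⟨b, Bb, hb⟩ := VarSchrodinger.exists_isTimeProfile
  have hBb0 : 0 ≤ Bb := (abs_nonneg _).trans (hb.deriv₂ 0)
  refine ⟨fun n lam Lam => lam ^ 2 / (2 * ((n : ℝ) + 1) ^ 4 * Lam), fun n lam Lam hl hL => by
    positivity, fun lam ε hlam hε => ?_⟩
  set c : ℝ := (Bb + 1) / (lam * ε) with hc
  have hc0 : 0 < c := by positivity
  obtain ⟨B, hB⟩ := VarSchrodinger.exists_isShellCutoff hε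
  refine ⟨2 * c, by positivity, fun n Lam K M₁ E₁ E₂ R₀ hLam hE₂ => ?_⟩
  set K' : ℝ := max K 0
  set M : ℝ := max M₁ 0
  have hK0 : 0 ≤ K' := le_max_right _ _
  -- `1 +` keeps the constant positive without inspecting the signs inside `errorConst`
  set D : ℝ := 1 + 8 * VarSchrodinger.errorConst n Lam K' B ^ 2 with hD
  have hD0 : 0 < D := by positivity
  refine ⟨1 + 2 * n ^ 4 * (K' + Lam) * K' + |R₀| + 4 * M ^ 2 / c + 2 * D * E₁ ^ 2 / (E₂ ^ 2 * c),
    c * E₂ ^ 2 / (2 * D), by positivity, by positivity, ?_⟩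
  intro A V u Du hell hA hK hgrad hV hVM _ hu hsol hE hmass R hR
  have t1 : 0 ≤ 2 * (n : ℝ) ^ 4 * (K' + Lam) * K' := by positivity
  have t2 : 0 ≤ 4 * M ^ 2 / c := by positivity
  have t3 : 0 ≤ 2 * D * E₁ ^ 2 / (E₂ ^ 2 * c) := by positivity
  have t4 := abs_nonneg R₀
  have hR1 : 1 ≤ R := by linarith
  have hR3 : R ≤ R ^ 3 := le_self_pow₀ hR1 (by norm_num)
  have hcR : c * R ≤ c * R ^ 3 := by gcongr
  have ha := VarSchrodinger.coeffBounds_of_isSymmElliptic hlam hLam (by positivity) hell hA hK hgrad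
  obtain ⟨ζ, hζ⟩ := hB n R hR1
  have hsmall : 2 * (n : ℝ) ^ 4 * Lam * (lam ^ 2 / (2 * ((n : ℝ) + 1) ^ 4 * Lam)) ≤ lam ^ 2 := by
    rw [mul_div_assoc', div_le_iff₀ (by positivity)]
    have : (n : ℝ) ^ 4 ≤ ((n : ℝ) + 1) ^ 4 := by gcongr; linarith
    calc 2 * (n : ℝ) ^ 4 * Lam * lam ^ 2 ≤ 2 * ((n : ℝ) + 1) ^ 4 * Lam * lam ^ 2 := by gcongr
      _ = _ := by ring
  have hM : 4 * M ^ 2 ≤ c * R ^ 3 := by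
    have : 4 * M ^ 2 / c ≤ R := by linarith
    rw [div_le_iff₀ hc0] at this
    linarith
  have key := VarSchrodinger.mass_le_energy ha hlam hLam.le hK0 hsmall hb hε hc hR1 (by linarith)
    (R₀ := R₀) (by linarith [le_abs_self R₀]) hM hζ hV
    (VarSchrodinger.ae_norm_le_of_eLpNorm_top_le hVM) hu hsol
  have e1 : -(2 * c) * R ^ 3 = -2 * (c * R ^ 3) := by ring
  rw [e1]
  refine VarSchrodinger.le_of_mass_le_energy hD0 hc0 hE₂ ?_ ?_ ?_ hmass hE ?_
    (key.trans (mul_le_mul' (ENNReal.ofReal_le_ofReal ?_) le_rfl))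
  · nlinarith
  · have h1 : 2 * D * E₁ ^ 2 / (E₂ ^ 2 * c) ≤ R := by linarith
    rw [div_le_iff₀ (by positivity)] at h1
    have h2 : E₂ ^ 2 * (c * R) ≤ E₂ ^ 2 * (c * R ^ 3) := by gcongr
    linarith
  · refine Real.exp_le_exp.2 ?_
    have : 0 ≤ c * R * (9 / 4 * ε ^ 2) := by positivity
    linarith
  · exact lintegral_mono fun t => lintegral_mono_set (subset_univ _)
  · rw [hD]; linarith
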